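/- Let $r\ge 2$, $p_1,\dots,p_r\ge 1$, and let a Gaussian process on a subset of $\mathbb R^{p_1}\times\cdots\times\mathbb R^{p_r}$ with variance $\sigma^2>0$ be observed on a Cartesian product design $S=S_1\times\cdots\times S_r$, where $S_k=\{x_{1k},\dots,x_{n_kk}\}\subset\mathbb R^{p_k}$ consists of $n_k\ge 2$ distinct points; put $n=\prod_k n_k$. The correlation function is separable, $$c(x,x^*\mid\xi)=\prod_{k=1}^r\rho^0\big(d(x_k,x_k^*)\,\xi_k\big),\qquad \xi\in(0,\infty)^r,$$ where $d$ is the Euclidean distance and $\rho^0$ is a valid isotropic correlation function on each $\mathbb R^{p_k}$ (that is, $\rho^0(0)=1$ and all matrices $[\rho^0(d(z_i,z_j))]_{ij}$ are nonnegative definite), differentiable on $(0,\infty)$, with $\lim_{u\to\infty}\rho^0(u)=0$. Let $\Sigma_k(\xi_k)=[\rho^0(d(x_{ik},x_{jk})\xi_k)]_{ij}$, assumed positive definite for every $\xi_k>0$, and $\Sigma=\Sigma(\xi)=\Sigma_1\otimes\cdots\otimes\Sigma_r$. The data vector satisfies $\mathbf Y\mid\theta,\sigma^2,\xi\sim N(\mathbf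 X\theta,\sigma^2\Sigma)$ with $\theta\in\mathbb R$ and $\mathbf X=\mathbf X_1\otimes\cdots\otimes\mathbf X_r$, $\mathbf X_k\in\mathbb R^{n_k}$, so that the likelihood is $$L(\theta,\sigma^2,\xi\mid\mathbf y)\propto(\sigma^2)^{-n/2}|\Sigma|^{-1/2}\exp\Big\{-\tfrac1{2\sigma^2}(\mathbf y-\mathbf X\theta)'\Sigma^{-1}(\mathbf y-\mathbf X\theta)\Big\}.$$ Write $\dot\Sigma_k$ for the entrywise derivative of $\Sigma_k$ with respect to $\xi_k$, and $\mathbf 1$ for a vector of ones. Assume: 1. There are nonsingular matrices $\mathbf D_k$, matrices $\mathbf D_k^*$, functions $\nu>0$ and $\omega$, and matrix functions $\mathbf R_k$, all differentiable near the origin on $(0,\infty)$ and with $\nu'\ne0$ there, such that for all sufficiently small $t>0$ and all $k$ $$\Sigma_k(t)=\mathbf 1\mathbf 1'+\nu(t)\mathbf D_k+\omega(t)\mathbf D_k^*+\mathbf R_k(t),\qquad \dot\Sigma_k(t)=\nu'(t)\mathbf D_k+\omega'(t)\mathbf D_k^*+\mathbf R_k'(t).$$ 2. As $t\to0^+$,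 $\omega/\nu\to0$, $\omega'/\nu'\to0$, $\|\mathbf R_k\|_\infty/\nu\to0$ and $\|\mathbf R_k'\|_\infty/\nu'\to0$, where $\|\cdot\|_\infty$ is the largest absolute value of an entry. 3. $\mathbf 1'\mathbf D_k^{-1}\mathbf 1\ne0$, $\mathbf X_k'\mathbf D_k^{-1}\mathbf X_k\ne0$ and, if $\mathbf X_k\ne\mathbf 1$, $\mathbf 1'\mathbf D_k^{-1}\mathbf 1\ne\mathbf 1'\mathbf D_k^{-1}\mathbf X_k(\mathbf X_k'\mathbf D_k^{-1}\mathbf X_k)^{-1}\mathbf X_k'\mathbf D_k^{-1}\mathbf 1$. 4. For every $k$ and every $\delta>0$, $[\operatorname{tr}(\dot\Sigma_k^2)]^{1/2}$ is integrable on $(\delta,\infty)$. Let $\dot\Sigma^k=\partial\Sigma/\partial\xi_k$, $\mathbf U_k=\dot\Sigma^k\Sigma^{-1}$ and $\mathbf W_k=\dot\Sigma^k\Sigma^{-1}\big(\mathbf I-\mathbf X(\mathbf X'\Sigma^{-1}\mathbf X)^{-1}\mathbf X'\Sigma^{-1}\big)$. For a number $c$ and matrices $\mathbf V_1,\dots,\mathbf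 V_r$ let $I(c;\mathbf V)$ be the symmetric $(r+1)\times(r+1)$ matrix with first row $(c,\operatorname{tr}\mathbf V_1,\dots,\operatorname{tr}\mathbf V_r)$ and remaining block $[\operatorname{tr}(\mathbf V_i\mathbf V_j)]_{ij}$. Let $\pi(\xi)$ be one of the reference, independence Jeffreys and Jeffreys-rule marginal priors $$\pi^R(\xi)=|I(n-1;\mathbf W)|^{1/2},\qquad \pi^{J1}(\xi)=|I(n;\mathbf U)|^{1/2},\qquad \pi^{J2}(\xi)=|\mathbf X'\Sigma^{-1}\mathbf X|^{1/2}\,\pi^{J1}(\xi).$$ Then for Lebesgue-almost every $\mathbf y\in\mathbb R^n$, and for every $a>1/2$, the posterior for the prior $\pi(\theta,\sigma^2,\xi)\propto\pi(\xi)/(\sigma^2)^a$ is proper, that is, $$0<\int_{(0,\infty)^r}\int_0^\infty\int_{\mathbb R}L(\theta,\sigma^2,\xi\mid\mathbf y)\,\frac{\pi(\xi)}{(\sigma^2)^a}\,d\theta\,d\sigma^2\,d\xi<\infty,$$ with one exception: in the case $\pi=\pi^{J2}$, $r=2$, $n_1=n_2=2$, $\mathbf X_1\ne\mathbf 1$ and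 $\mathbf X_2\ne\mathbf 1$, this is asserted only for $a>3/2$. -/

import Mathlib

open MeasureTheory Filter Topology Set Matrix

namespace GPPropriety

/-- `ρ0`, as a function of the distance, is a valid isotropic correlation function on `ℝ^p`:
it equals one at distance zero, and every matrix `[ρ0 (d (x_i, x_j))]` is nonnegative definite. -/
def IsIsotropicCorrelation (p : ℕ) (ρ0 : ℝ → ℝ) : Prop :=
  ρ0 0 = 1 ∧ ∀ (m : ℕ) (x : Fin m → EuclideanSpace ℝ (Fin p)),
    (Matrix.of fun i j => ρ0 (dist (x i) (x j))).PosSemidef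

/-- The locations `x = (x_1, …, x_r)`, with `x_k ∈ ℝ^{p_k}`. -/
abbrev Location {r : ℕ} (p : Fin r → ℕ) : Type := ∀ k, EuclideanSpace ℝ (Fin (p k))

/-- The index set of a Cartesian-product design with `n_k` points in the `k`-th factor. -/
abbrev DesignIndex {r : ℕ} (n : Fin r → ℕ) : Type := ∀ k, Fin (n k)

noncomputable section

/-- The separable correlation function `c(x, x* | ξ) = ∏_k ρ0 (d(x_k, x*_k) ξ_k)`. -/
def sepCorr {r : ℕ} {p : Fin r → ℕ} (ρ0 : ℝ → ℝ) (ξ : Fin r → ℝ) (x x' : Location p) : ℝ :=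
  ∏ k, ρ0 (dist (x k) (x' k) * ξ k)

/-- The correlation matrix `Σ(ξ)` of the data observed on the design `S_1 × ⋯ × S_r`,
where `S_k = {s k 1, …, s k n_k}`. -/
def corrMatrix {r : ℕ} {p n : Fin r → ℕ} (ρ0 : ℝ → ℝ)
    (s : ∀ k, Fin (n k) → EuclideanSpace ℝ (Fin (p k))) (ξ : Fin r → ℝ) :
    Matrix (DesignIndex n) (DesignIndex n) ℝ :=
  Matrix.of fun i j => sepCorr ρ0 ξ (fun k => s k (i k)) (fun k => s k (j k))

/-- The matrix of entrywise partial derivatives of `Σ(ξ)` with respect to `ξ_k`. -/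
def corrMatrixDeriv {r : ℕ} {p n : Fin r → ℕ} (ρ0 : ℝ → ℝ)
    (s : ∀ k, Fin (n k) → EuclideanSpace ℝ (Fin (p k))) (k : Fin r) (ξ : Fin r → ℝ) :
    Matrix (DesignIndex n) (DesignIndex n) ℝ :=
  Matrix.of fun i j => deriv (fun t => corrMatrix ρ0 s (Function.update ξ k t) i j) (ξ k)

/-- The correlation matrix `Σ_k(t)` of one factor of the design, at range parameter `t`. -/
def factorCorr {p m : ℕ} (ρ0 : ℝ → ℝ) (x : Fin m → EuclideanSpace ℝ (Fin p)) (t : ℝ) :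
    Matrix (Fin m) (Fin m) ℝ :=
  Matrix.of fun i j => ρ0 (dist (x i) (x j) * t)

/-- The entrywise derivative of `Σ_k(t)` with respect to `t`. -/
def factorCorrDeriv {p m : ℕ} (ρ0 : ℝ → ℝ) (x : Fin m → EuclideanSpace ℝ (Fin p)) (t : ℝ) :
    Matrix (Fin m) (Fin m) ℝ :=
  Matrix.of fun i j => deriv (fun u => factorCorr ρ0 x u i j) t

/-- The Kronecker product `X_1 ⊗ ⋯ ⊗ X_r` of column vectors. -/
def kronVec {r : ℕ} {n : Fin r → ℕ} (X : ∀ k, Fin (n k) → ℝ) : DesignIndex n → ℝ :=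
  fun i => ∏ k, X k (i k)

/-- The likelihood of `(θ, σ², ξ)` for the model `y ∼ N(X θ, σ² Σ)` with scalar `θ`, without its
constant factor; here `C` is the correlation matrix `Σ` and `v` is the variance `σ²`. -/
def likelihood {ι : Type*} [Fintype ι] [DecidableEq ι] (X y : ι → ℝ) (C : Matrix ι ι ℝ)
    (θ v : ℝ) : ℝ :=
  v ^ (-(Fintype.card ι : ℝ) / 2) * C.det ^ (-(1 : ℝ) / 2) *
    Real.exp (-(1 / (2 * v)) * ((y - θ • X) ⬝ᵥ (C⁻¹ *ᵥ (y - θ • X))))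

/-- The `(r+1) × (r+1)` symmetric matrix with corner entry `c`, remaining first row
`tr W_1, …, tr W_r`, and remaining block `[tr (W_i W_j)]`. -/
def infoMatrix {ι : Type*} [Fintype ι] {r : ℕ} (c : ℝ) (W : Fin r → Matrix ι ι ℝ) :
    Matrix (Option (Fin r)) (Option (Fin r)) ℝ :=
  Matrix.of fun a b =>
    match a, b with
    | none, none => c
    | none, some j => (W j).trace
    | some i, none => (W i).trace
    | some i, some j => (W i * W j).trace

/-- `Q = Σ⁻¹ P` with `P = I - X (X' Σ⁻¹ X)⁻¹ X' Σ⁻¹`, for a single covariate vector `X`. -/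
def residualQ {ι : Type*} [Fintype ι] [DecidableEq ι] (X : ι → ℝ) (C : Matrix ι ι ℝ) :
    Matrix ι ι ℝ :=
  C⁻¹ * (1 - (X ⬝ᵥ (C⁻¹ *ᵥ X))⁻¹ • (Matrix.vecMulVec X X * C⁻¹))

/-- The three choices of the marginal prior for `ξ`. -/
inductive PriorKind : Type
  | reference
  | independenceJeffreys
  | jeffreysRule

/-- The independence Jeffreys marginal prior: the square root of the determinant of the matrix
built from `U_k`, the derivative of `Σ` in `ξ_k` times `Σ⁻¹`, with corner entry `n`. -/
def indepJeffreysPrior {r : ℕ} {p n : Fin r → ℕ} (ρ0 : ℝ → ℝ)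
    (s : ∀ k, Fin (n k) → EuclideanSpace ℝ (Fin (p k))) (ξ : Fin r → ℝ) : ℝ :=
  Real.sqrt (infoMatrix (Fintype.card (DesignIndex n) : ℝ)
    (fun k => corrMatrixDeriv ρ0 s k ξ * (corrMatrix ρ0 s ξ)⁻¹)).det

/-- The reference marginal prior: the same construction from `W_k`, the derivative of `Σ` in `ξ_k`
times `Q`, with corner entry `n - 1` (there is one mean parameter). -/
def referencePrior {r : ℕ} {p n : Fin r → ℕ} (ρ0 : ℝ → ℝ)
    (s : ∀ k, Fin (n k) → EuclideanSpace ℝ (Fin (p k))) (X : ∀ k, Fin (n k) → ℝ)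
    (ξ : Fin r → ℝ) : ℝ :=
  Real.sqrt (infoMatrix ((Fintype.card (DesignIndex n) : ℝ) - 1)
    (fun k => corrMatrixDeriv ρ0 s k ξ * residualQ (kronVec X) (corrMatrix ρ0 s ξ))).det

/-- The Jeffreys-rule marginal prior: `|X' Σ⁻¹ X|^{1/2}` times the independence Jeffreys one. -/
def jeffreysRulePrior {r : ℕ} {p n : Fin r → ℕ} (ρ0 : ℝ → ℝ)
    (s : ∀ k, Fin (n k) → EuclideanSpace ℝ (Fin (p k))) (X : ∀ k, Fin (n k) → ℝ)
    (ξ : Fin r → ℝ) : ℝ :=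
  Real.sqrt (kronVec X ⬝ᵥ ((corrMatrix ρ0 s ξ)⁻¹ *ᵥ kronVec X)) * indepJeffreysPrior ρ0 s ξ

/-- The marginal prior `π(ξ)` of the given kind. -/
def marginalPrior {r : ℕ} {p n : Fin r → ℕ} (ρ0 : ℝ → ℝ)
    (s : ∀ k, Fin (n k) → EuclideanSpace ℝ (Fin (p k))) (X : ∀ k, Fin (n k) → ℝ) :
    PriorKind → (Fin r → ℝ) → ℝ
  | .reference => referencePrior ρ0 s X
  | .independenceJeffreys => indepJeffreysPrior ρ0 s
  | .jeffreysRule => jeffreysRulePrior ρ0 s X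

/-- The total mass of likelihood times the prior `π(ξ) / (σ²)^a`, over `θ ∈ ℝ`, `σ² > 0` and
`ξ ∈ (0, ∞)^r`. -/
def posteriorMass {r : ℕ} {p n : Fin r → ℕ} (ρ0 : ℝ → ℝ)
    (s : ∀ k, Fin (n k) → EuclideanSpace ℝ (Fin (p k))) (X : ∀ k, Fin (n k) → ℝ)
    (prior : (Fin r → ℝ) → ℝ) (a : ℝ) (y : DesignIndex n → ℝ) : ENNReal :=
  ∫⁻ ξ in {ξ : Fin r → ℝ | ∀ k, 0 < ξ k}, ∫⁻ v in Ioi (0 : ℝ), ∫⁻ θ : ℝ,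
    ENNReal.ofReal (likelihood (kronVec X) y (corrMatrix ρ0 s ξ) θ v * (prior ξ / v ^ a))

/-- The posterior for the prior `π(ξ) / (σ²)^a` and data `y` is proper: likelihood times prior can
be normalized to a probability density. -/
def ProperPosterior {r : ℕ} {p n : Fin r → ℕ} (ρ0 : ℝ → ℝ)
    (s : ∀ k, Fin (n k) → EuclideanSpace ℝ (Fin (p k))) (X : ∀ k, Fin (n k) → ℝ)
    (prior : (Fin r → ℝ) → ℝ) (a : ℝ) (y : DesignIndex n → ℝ) : Prop :=
  0 < posteriorMass ρ0 s X prior a y ∧ posteriorMass ρ0 s X prior a y < ⊤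

/-- The small-range expansion
`Σ_k(t) = 1 1' + ν(t) D_k + ω(t) D*_k + R_k(t)` as `t → 0+`, which may be differentiated term by
term, with `ω` and `R_k` negligible with respect to `ν`, also after differentiation (limits of the
max-norm of a matrix are written entrywise), together with the nondegeneracy of `D_k` with respect
to the vectors `1` and `X_k`. The quotients by `ν` and its derivative presuppose that these do not
vanish near the origin. -/
structure SmallRangeExpansion {r : ℕ} {p n : Fin r → ℕ} (ρ0 : ℝ → ℝ)
    (s : ∀ k, Fin (n k) → EuclideanSpace ℝ (Fin (p k))) (X : ∀ k, Fin (n k) → ℝ)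
    (ν ω : ℝ → ℝ) (D Dstar : ∀ k, Matrix (Fin (n k)) (Fin (n k)) ℝ)
    (R : ∀ k, ℝ → Matrix (Fin (n k)) (Fin (n k)) ℝ) : Prop where
  det_ne_zero : ∀ k, (D k).det ≠ 0
  nu_pos : ∀ᶠ t in 𝓝[>] (0 : ℝ), 0 < ν t
  nu_diff : ∀ᶠ t in 𝓝[>] (0 : ℝ), DifferentiableAt ℝ ν t
  omega_diff : ∀ᶠ t in 𝓝[>] (0 : ℝ), DifferentiableAt ℝ ω t
  rem_diff : ∀ k i j, ∀ᶠ t in 𝓝[>] (0 : ℝ), DifferentiableAt ℝ (fun u => R k u i j) t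
  expansion : ∀ k i j, ∀ᶠ t in 𝓝[>] (0 : ℝ),
    factorCorr ρ0 (s k) t i j = 1 + ν t * D k i j + ω t * Dstar k i j + R k t i j
  expansion_deriv : ∀ k i j, ∀ᶠ t in 𝓝[>] (0 : ℝ),
    factorCorrDeriv ρ0 (s k) t i j =
      deriv ν t * D k i j + deriv ω t * Dstar k i j + deriv (fun u => R k u i j) t
  deriv_nu_ne_zero : ∀ᶠ t in 𝓝[>] (0 : ℝ), deriv ν t ≠ 0
  omega_small : Tendsto (fun t => ω t / ν t) (𝓝[>] 0) (𝓝 0)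
  deriv_omega_small : Tendsto (fun t => deriv ω t / deriv ν t) (𝓝[>] 0) (𝓝 0)
  rem_small : ∀ k i j, Tendsto (fun t => R k t i j / ν t) (𝓝[>] 0) (𝓝 0)
  deriv_rem_small : ∀ k i j,
    Tendsto (fun t => deriv (fun u => R k u i j) t / deriv ν t) (𝓝[>] 0) (𝓝 0)
  one_form_ne_zero : ∀ k, (1 : Fin (n k) → ℝ) ⬝ᵥ ((D k)⁻¹ *ᵥ 1) ≠ 0
  mean_form_ne_zero : ∀ k, X k ⬝ᵥ ((D k)⁻¹ *ᵥ X k) ≠ 0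
  mixed_form_ne : ∀ k, X k ≠ 1 →
    (1 : Fin (n k) → ℝ) ⬝ᵥ ((D k)⁻¹ *ᵥ 1) ≠
      ((1 : Fin (n k) → ℝ) ⬝ᵥ ((D k)⁻¹ *ᵥ X k)) * (X k ⬝ᵥ ((D k)⁻¹ *ᵥ X k))⁻¹ *
        (X k ⬝ᵥ ((D k)⁻¹ *ᵥ 1))

end

end GPPropriety

namespace GPPropriety

/-! Integrating out `θ` (a Gaussian integral) and `σ²` (an inverse gamma integral) leaves, up to a
constant, `|Σ|^{-1/2} (X'Σ⁻¹X)^{-1/2} RSS^{-β} π(ξ)`, with `RSS` the generalized least squares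
residual sum of squares and `β = n/2 + a - 3/2` (`lintegral_likelihood`). Since `Σ` is a Kronecker
product, this is bounded by a product of functions of the single `ξ_k`, and finiteness becomes a
count of exponents.

For each factor, `FactorBound` provides a degeneracy scale `μ_k` and a bound `h_k` for the entries
of `Σ̇_k Σ_k⁻¹`. Near the origin `ν' ≠ 0` makes `ν` monotone, and correlations being at most one
makes it bounded, so `ν` has a limit `L ≥ 0`. If `L = 0`, then `Σ_k = 11' + νE` with `E → D_k`, and
rank-one update formulas give the bounds with `μ_k = ν` and `h_k` a multiple of `|ν'|/ν`
(`exists_eventually_factorBound`). If `L > 0`, then `Σ_k` tends to `(1-c)I + c11'` with `0 ≤ c < 1`,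
which is nonsingular, and `μ_k = 1` works. Away from the origin `Σ_k` is uniformly nonsingular
because it tends to `I`; there `μ_k = 1` and `h_k` is integrable by the trace assumption. In every
case `h_k μ_k^b` is integrable on `(0,∞)` for each `b > 0`, since `|ν'| ν^{b-1}` is up to sign the
derivative of `ν^b / b`.

The prior is at most a constant times `∏ h_k`, with an extra `∏ μ_k^{-e_k/2}` for the Jeffreys rule,
where `e_k` is `0` if `X_k = 1` and `1` otherwise (`exists_marginalPrior_le`). The determinant and
`X'Σ⁻¹X` give explicit powers of `μ_k`. For `RSS`, Cauchy–Schwarz gives `RSS ≥ (w'y)² / w'Σw` for `w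
⊥ X`. A product contrast that is orthogonal to `1` in every factor and to `X_j` in one factor makes
`w'Σw` of order `∏ μ_k`. It exists unless all `n_j = 2` and all `X_j ≠ 1`; then one factor is lost,
and a geometric mean over the lost factor leaves the power `1 - 1/r` (`exists_le_residualSS`). The
resulting exponents are positive for `a > 1/2`, the Jeffreys rule with `r = 2` in this degenerate
case needing `a > 3/2` (`likelihoodRate_pos`, `likelihoodRate_sub_pos`). The excluded `y` lie on the
finitely many hyperplanes `w'y = 0`.

The mass is positive because the information matrix is a Gram matrix of `Σ` and its partial
derivatives, which are linearly independent as quadratic forms on the contrasts for `ξ` near the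
origin (`posDef_infoMatrix`, `coeff_eq_zero_of_form_eq_zero`). -/

/-! ### Kronecker products indexed by a finite family -/

/-- The Kronecker product `A_1 ⊗ ⋯ ⊗ A_r`, indexed by the product of the index sets. -/
def piKron {r : ℕ} {n : Fin r → ℕ} (A : ∀ k, Matrix (Fin (n k)) (Fin (n k)) ℝ) :
    Matrix (DesignIndex n) (DesignIndex n) ℝ :=
  Matrix.of fun i j => ∏ k, A k (i k) (j k)

section piKron

variable {r : ℕ} {n : Fin r → ℕ}

theorem piKron_apply (A : ∀ k, Matrix (Fin (n k)) (Fin (n k)) ℝ) (i j : DesignIndex n) :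
    piKron A i j = ∏ k, A k (i k) (j k) := rfl

theorem sum_designIndex_prod (f : ∀ k, Fin (n k) → ℝ) :
    ∑ i : DesignIndex n, ∏ k, f k (i k) = ∏ k, ∑ j, f k j := by
  rw [Finset.prod_univ_sum, Fintype.piFinset_univ]

theorem piKron_mul (A B : ∀ k, Matrix (Fin (n k)) (Fin (n k)) ℝ) :
    piKron A * piKron B = piKron fun k => A k * B k := by
  ext i j
  simp only [mul_apply, piKron_apply, ← Finset.prod_mul_distrib]
  exact sum_designIndex_prod fun k l => A k (i k) l * B k l (j k)

theorem piKron_one : piKron (fun k => (1 : Matrix (Fin (n k)) (Fin (n k)) ℝ)) = 1 := by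
  ext i j
  simp only [piKron_apply, one_apply]
  by_cases h : i = j
  · simp [h]
  · rw [if_neg h]
    obtain ⟨k, hk⟩ := Function.ne_iff.1 h
    exact Finset.prod_eq_zero (Finset.mem_univ k) (if_neg hk)

theorem piKron_transpose (A : ∀ k, Matrix (Fin (n k)) (Fin (n k)) ℝ) :
    (piKron A)ᵀ = piKron fun k => (A k)ᵀ := rfl

theorem piKron_diagonal (l : ∀ k, Fin (n k) → ℝ) :
    piKron (fun k => diagonal (l k)) = diagonal (kronVec l) := by
  ext i j
  by_cases h : i = j
  · subst h; simp [piKron_apply, kronVec]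
  · rw [diagonal_apply_ne _ h]
    obtain ⟨k, hk⟩ := Function.ne_iff.1 h
    exact Finset.prod_eq_zero (Finset.mem_univ k) (diagonal_apply_ne _ hk)

theorem piKron_inv (A : ∀ k, Matrix (Fin (n k)) (Fin (n k)) ℝ) (hA : ∀ k, IsUnit (A k).det) :
    (piKron A)⁻¹ = piKron fun k => (A k)⁻¹ := by
  apply inv_eq_right_inv
  rw [piKron_mul, ← piKron_one]
  congr 1
  funext k
  exact mul_nonsing_inv _ (hA k)

theorem piKron_vecMulVec (u v : ∀ k, Fin (n k) → ℝ) :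
    piKron (fun k => vecMulVec (u k) (v k)) = vecMulVec (kronVec u) (kronVec v) := by
  ext i j
  simp [piKron_apply, vecMulVec_apply, kronVec, Finset.prod_mul_distrib]

theorem prod_smul_piKron (c : Fin r → ℝ) (A : ∀ k, Matrix (Fin (n k)) (Fin (n k)) ℝ) :
    (∏ k, c k) • piKron A = piKron fun k => c k • A k := by
  ext i j
  simp [piKron_apply, Finset.prod_mul_distrib]

theorem piKron_mulVec (A : ∀ k, Matrix (Fin (n k)) (Fin (n k)) ℝ) (v : ∀ k, Fin (n k) → ℝ) :
    piKron A *ᵥ kronVec v = kronVec fun k => A k *ᵥ v k := by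
  ext i
  simp only [mulVec, dotProduct, piKron_apply, kronVec, ← Finset.prod_mul_distrib]
  exact sum_designIndex_prod fun k l => A k (i k) l * v k l

theorem kronVec_dotProduct (u v : ∀ k, Fin (n k) → ℝ) :
    kronVec u ⬝ᵥ kronVec v = ∏ k, u k ⬝ᵥ v k := by
  simp only [dotProduct, kronVec, ← Finset.prod_mul_distrib]
  exact sum_designIndex_prod fun k l => u k l * v k l

theorem kronVec_ne_zero {v : ∀ k, Fin (n k) → ℝ} (hv : ∀ k, v k ≠ 0) : kronVec v ≠ 0 := by
  choose i hi using fun k => Function.ne_iff.1 (hv k)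
  intro h
  exact Finset.prod_ne_zero_iff.2 (fun k _ => hi k) (congrFun h i)

theorem card_fiber_designIndex (k : Fin r) (a : Fin (n k)) :
    (Finset.univ.filter fun i : DesignIndex n => i k = a).card =
      ∏ l ∈ Finset.univ.erase k, n l := by
  have := Fintype.card_filter_piFinset_eq_of_mem
    (fun l => (Finset.univ : Finset (Fin (n l)))) k (Finset.mem_univ a)
  simpa [Fintype.piFinset_univ] using this

theorem card_designIndex : Fintype.card (DesignIndex n) = ∏ k, n k := by
  simp [DesignIndex]

/-- The spectral decomposition of a real positive definite matrix. -/
theorem exists_spectral {ι : Type*} [Fintype ι] [DecidableEq ι] {A : Matrix ι ι ℝ}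
    (hA : A.PosDef) : ∃ (V : Matrix ι ι ℝ) (l : ι → ℝ), (∀ i, 0 < l i) ∧ V * Vᵀ = 1 ∧
      A = V * diagonal l * Vᵀ ∧ A.det = ∏ i, l i := by
  have h := hA.isHermitian
  refine ⟨h.eigenvectorUnitary, h.eigenvalues, hA.eigenvalues_pos, ?_, ?_, ?_⟩
  · have := Unitary.coe_mul_star_self h.eigenvectorUnitary
    rwa [Unitary.coe_star, star_eq_conjTranspose,
      conjTranspose_eq_transpose_of_trivial] at this
  · have := h.spectral_theorem
    rw [Unitary.conjStarAlgAut_apply, star_eq_conjTranspose,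
      conjTranspose_eq_transpose_of_trivial] at this
    exact this
  · have := h.det_eq_prod_eigenvalues
    exact this

theorem exists_eq_mul_transpose {ι : Type*} [Fintype ι] [DecidableEq ι] {A : Matrix ι ι ℝ}
    (hA : A.PosDef) : ∃ L : Matrix ι ι ℝ, A = L * Lᵀ := by
  obtain ⟨V, l, hl, -, h, -⟩ := exists_spectral hA
  refine ⟨V * diagonal fun i => √(l i), ?_⟩
  rw [transpose_mul, diagonal_transpose, Matrix.mul_assoc, ← Matrix.mul_assoc (diagonal _),
    diagonal_mul_diagonal, h, Matrix.mul_assoc]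
  simp only [Real.mul_self_sqrt (hl _).le]

/-- Diagonalizing every factor diagonalizes the product; each eigenvalue of the `k`-th factor occurs
once for every choice of the other indices. -/
theorem det_piKron {A : ∀ k, Matrix (Fin (n k)) (Fin (n k)) ℝ} (hA : ∀ k, (A k).PosDef) :
    (piKron A).det = ∏ k, (A k).det ^ (∏ l ∈ Finset.univ.erase k, n l) := by
  choose V l hl hV hA' hdet using fun k => exists_spectral (hA k)
  have h1 : piKron A = piKron V * diagonal (kronVec l) * (piKron V)ᵀ := by
    rw [← piKron_diagonal, piKron_transpose, piKron_mul, piKron_mul]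
    congr 1
    funext k
    exact hA' k
  have h2 : piKron V * (piKron V)ᵀ = 1 := by
    rw [piKron_transpose, piKron_mul, ← piKron_one]
    congr 1
    funext k
    exact hV k
  have h3 : (piKron V).det * (piKron V).det = 1 := by
    have := congrArg det h2
    rwa [det_mul, det_transpose, det_one] at this
  rw [h1, det_mul, det_mul, det_transpose, det_diagonal, mul_right_comm, h3, one_mul]
  simp only [kronVec]
  rw [Finset.prod_comm]
  refine Finset.prod_congr rfl fun k _ => ?_
  rw [hdet, ← Finset.prod_fiberwise' Finset.univ (fun i : DesignIndex n => i k) (l k),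
    ← Finset.prod_pow]
  refine Finset.prod_congr rfl fun a _ => ?_
  rw [Finset.prod_const, card_fiber_designIndex]

/-- Writing each factor as `L Lᵀ` writes the product in the same form; the determinant formula makes
the product of the `L` invertible. -/
theorem posDef_piKron {A : ∀ k, Matrix (Fin (n k)) (Fin (n k)) ℝ} (hA : ∀ k, (A k).PosDef) :
    (piKron A).PosDef := by
  choose L hL using fun k => exists_eq_mul_transpose (hA k)
  have h1 : piKron A = (piKron L) * (piKron L)ᵀ := by
    rw [piKron_transpose, piKron_mul]
    congr 1
    funext k
    exact hL k
  have hdet : (piKron A).det ≠ 0 := by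
    rw [det_piKron hA]
    exact Finset.prod_ne_zero_iff.2 fun k _ => pow_ne_zero _ (hA k).det_pos.ne'
  have hu : IsUnit (piKron L) := by
    rw [isUnit_iff_isUnit_det, isUnit_iff_ne_zero]
    rw [h1, det_mul] at hdet
    exact left_ne_zero_of_mul hdet
  rw [h1, ← conjTranspose_eq_transpose_of_trivial]
  exact PosDef.mul_conjTranspose_self _ (vecMul_injective_iff_isUnit.2 hu)

end piKron

/-! ### The correlation matrix as a Kronecker product -/

section corr

variable {r : ℕ} {p n : Fin r → ℕ} (ρ0 : ℝ → ℝ)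
  (s : ∀ k, Fin (n k) → EuclideanSpace ℝ (Fin (p k)))

theorem corrMatrix_eq_piKron (ξ : Fin r → ℝ) :
    corrMatrix ρ0 s ξ = piKron fun k => factorCorr ρ0 (s k) (ξ k) := rfl

/-- Only the `k`-th factor depends on `ξ_k`. The constant-multiple rule for `deriv` over a field
holds with the default value of `deriv` too, so no differentiability is asked for. -/
theorem corrMatrixDeriv_eq_piKron (k : Fin r) (ξ : Fin r → ℝ) :
    corrMatrixDeriv ρ0 s k ξ = piKron (Function.update
      (fun l => factorCorr ρ0 (s l) (ξ l)) k (factorCorrDeriv ρ0 (s k) (ξ k))) := by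
  ext i j
  have h : ∀ t, corrMatrix ρ0 s (Function.update ξ k t) i j =
      (∏ l ∈ Finset.univ.erase k, factorCorr ρ0 (s l) (ξ l) (i l) (j l)) *
        factorCorr ρ0 (s k) t (i k) (j k) := by
    intro t
    rw [corrMatrix_eq_piKron, piKron_apply, ← Finset.prod_erase_mul _ _ (Finset.mem_univ k)]
    congr 1
    · refine Finset.prod_congr rfl fun l hl => ?_
      rw [Function.update_of_ne (Finset.ne_of_mem_erase hl)]
    · rw [Function.update_self]
  rw [piKron_apply, ← Finset.prod_erase_mul _ _ (Finset.mem_univ k), Function.update_self]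
  simp only [corrMatrixDeriv, of_apply, h]
  rw [deriv_const_mul_field]
  congr 1
  refine Finset.prod_congr rfl fun l hl => ?_
  rw [Function.update_of_ne (Finset.ne_of_mem_erase hl)]

end corr

/-! ### The integrated likelihood -/

section quadratic

theorem posDef_transpose {ι : Type*} {C : Matrix ι ι ℝ} (hC : C.PosDef) : Cᵀ = C := by
  rw [← conjTranspose_eq_transpose_of_trivial]
  exact hC.isHermitian

variable {ι : Type*} [Fintype ι] {C : Matrix ι ι ℝ}

theorem dotProduct_mulVec_comm_of_symm (hC : Cᵀ = C) (u v : ι → ℝ) :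
    u ⬝ᵥ (C *ᵥ v) = v ⬝ᵥ (C *ᵥ u) := by
  rw [dotProduct_mulVec, ← mulVec_transpose, hC, dotProduct_comm]

theorem posDef_pos (hC : C.PosDef) {v : ι → ℝ} (hv : v ≠ 0) : 0 < v ⬝ᵥ (C *ᵥ v) := by
  simpa using hC.dotProduct_mulVec_pos hv

theorem posDef_nonneg (hC : C.PosDef) (v : ι → ℝ) : 0 ≤ v ⬝ᵥ (C *ᵥ v) := by
  simpa using hC.posSemidef.dotProduct_mulVec_nonneg v

theorem form_sub_smul (hC : Cᵀ = C) (u v : ι → ℝ) (t : ℝ) :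
    (u - t • v) ⬝ᵥ (C *ᵥ (u - t • v)) =
      u ⬝ᵥ (C *ᵥ u) - 2 * t * (v ⬝ᵥ (C *ᵥ u)) + t ^ 2 * (v ⬝ᵥ (C *ᵥ v)) := by
  have h := dotProduct_mulVec_comm_of_symm hC u v
  simp only [mulVec_sub, mulVec_smul, dotProduct_sub, sub_dotProduct, smul_dotProduct,
    dotProduct_smul, smul_eq_mul]
  rw [h]
  ring

variable [DecidableEq ι]

theorem posDef_isUnit_det (hC : C.PosDef) : IsUnit C.det :=
  isUnit_iff_ne_zero.2 hC.det_pos.ne'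

/-- The Cauchy–Schwarz inequality for the forms of `C` and of its inverse. -/
theorem sq_dotProduct_le (hC : C.PosDef) (w z : ι → ℝ) :
    (w ⬝ᵥ z) ^ 2 ≤ (z ⬝ᵥ (C⁻¹ *ᵥ z)) * (w ⬝ᵥ (C *ᵥ w)) := by
  set u := C⁻¹ *ᵥ z with hu
  have hCu : C *ᵥ u = z := by
    rw [hu, mulVec_mulVec, mul_nonsing_inv _ (posDef_isUnit_det hC), one_mulVec]
  by_cases hw : w = 0
  · subst hw; simp
  have ha := posDef_pos hC hw
  have hz : z ⬝ᵥ u = u ⬝ᵥ (C *ᵥ u) := by rw [hCu, dotProduct_comm]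
  have hwz : w ⬝ᵥ z = w ⬝ᵥ (C *ᵥ u) := by rw [hCu]
  have h := posDef_nonneg hC (u - ((w ⬝ᵥ z) / (w ⬝ᵥ (C *ᵥ w))) • w)
  rw [form_sub_smul (posDef_transpose hC), ← hwz, ← hz] at h
  have h2 := mul_nonneg h ha.le
  have : (z ⬝ᵥ u - 2 * (w ⬝ᵥ z / w ⬝ᵥ C *ᵥ w) * w ⬝ᵥ z +
      (w ⬝ᵥ z / w ⬝ᵥ C *ᵥ w) ^ 2 * w ⬝ᵥ C *ᵥ w) * w ⬝ᵥ C *ᵥ w =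
      (z ⬝ᵥ u) * (w ⬝ᵥ (C *ᵥ w)) - (w ⬝ᵥ z) ^ 2 := by
    field_simp
    ring
  rw [this] at h2
  linarith

/-- The residual sum of squares `y' Σ⁻¹ y - (X' Σ⁻¹ y)² / (X' Σ⁻¹ X)`. -/
noncomputable def residualSS (X y : ι → ℝ) (C : Matrix ι ι ℝ) : ℝ :=
  y ⬝ᵥ (C⁻¹ *ᵥ y) - (X ⬝ᵥ (C⁻¹ *ᵥ y)) ^ 2 / (X ⬝ᵥ (C⁻¹ *ᵥ X))

/-- Completion of the square in `θ` around the generalized least squares estimate. -/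
theorem form_residual (hC : C.PosDef) {X : ι → ℝ} (hX : X ≠ 0) (y : ι → ℝ) (θ : ℝ) :
    (y - θ • X) ⬝ᵥ (C⁻¹ *ᵥ (y - θ • X)) = (X ⬝ᵥ (C⁻¹ *ᵥ X)) *
      (θ - (X ⬝ᵥ (C⁻¹ *ᵥ y)) / (X ⬝ᵥ (C⁻¹ *ᵥ X))) ^ 2 + residualSS X y C := by
  have hA := posDef_pos hC.inv hX
  rw [form_sub_smul (posDef_transpose hC.inv), residualSS]
  field_simp
  ring

/-- Cauchy–Schwarz applied to the residual vector at the least squares estimate; since `w ⊥ X`, the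
residual and `y` have the same product with `w`. This is the only source of lower bounds for the
residual sum of squares. -/
theorem sq_div_le_residualSS (hC : C.PosDef) {X : ι → ℝ} (hX : X ≠ 0) (y w : ι → ℝ)
    (hw : w ≠ 0) (hwX : w ⬝ᵥ X = 0) :
    (w ⬝ᵥ y) ^ 2 / (w ⬝ᵥ (C *ᵥ w)) ≤ residualSS X y C := by
  rw [div_le_iff₀ (posDef_pos hC hw)]
  have h := form_residual hC hX y ((X ⬝ᵥ (C⁻¹ *ᵥ y)) / (X ⬝ᵥ (C⁻¹ *ᵥ X)))
  rw [sub_self, zero_pow two_ne_zero, mul_zero, zero_add] at h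
  rw [← h]
  refine le_trans (le_of_eq ?_) (sq_dotProduct_le hC w _)
  rw [dotProduct_sub, dotProduct_smul, hwX, smul_zero, sub_zero]

end quadratic

/-! ### Integrating out the mean and the variance -/

section integrals

theorem lintegral_gaussian_shift {b : ℝ} (hb : 0 < b) (c : ℝ) :
    ∫⁻ θ : ℝ, ENNReal.ofReal (Real.exp (-b * (θ - c) ^ 2)) = ENNReal.ofReal √(Real.pi / b) := by
  rw [← ofReal_integral_eq_lintegral_ofReal ((integrable_exp_neg_mul_sq hb).comp_sub_right c)
    (Eventually.of_forall fun _ => (Real.exp_pos _).le)]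
  rw [integral_sub_right_eq_self (fun x => Real.exp (-b * x ^ 2)), integral_gaussian]

/-- The substitution `v ↦ v⁻¹` turns the integral into Euler's Gamma integral. -/
theorem lintegral_inverse_gamma {β S : ℝ} (hβ : 0 < β) (hS : 0 < S) :
    ∫⁻ v in Ioi (0 : ℝ), ENNReal.ofReal (v ^ (-β - 1) * Real.exp (-(S / (2 * v)))) =
      ENNReal.ofReal ((2 / S) ^ β * Real.Gamma β) := by
  have hS2 : 0 < S / 2 := by positivity
  have key : ∀ v ∈ Ioi (0 : ℝ), v ^ (-β - 1) * Real.exp (-(S / (2 * v))) =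
      (|(-1 : ℝ)| * v ^ ((-1 : ℝ) - 1)) •
        ((v ^ (-1 : ℝ)) ^ (β - 1) * Real.exp (-(S / 2 * v ^ (-1 : ℝ)))) := by
    intro v hv
    have hv' : 0 < v := hv
    rw [← Real.rpow_mul hv'.le, Real.rpow_neg_one, smul_eq_mul, ← mul_assoc, abs_neg, abs_one,
      one_mul, ← Real.rpow_add hv']
    congr 2
    · ring
    · field_simp
  have hint : IntegrableOn (fun u : ℝ => u ^ (β - 1) * Real.exp (-(S / 2 * u))) (Ioi 0) := by
    -- A nonintegrable function has Bochner integral `0` by convention, which contradicts the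
    -- positive value given by the Gamma formula.
    by_contra h
    have h0 := Real.integral_rpow_mul_exp_neg_mul_Ioi hβ hS2
    rw [integral_undef h] at h0
    have : 0 < (1 / (S / 2)) ^ β * Real.Gamma β := by
      have := Real.Gamma_pos_of_pos hβ
      positivity
    linarith
  have hint' := (integrableOn_Ioi_comp_rpow_iff
    (fun u : ℝ => u ^ (β - 1) * Real.exp (-(S / 2 * u))) (p := -1) (by norm_num)).2 hint
  rw [setLIntegral_congr_fun measurableSet_Ioi fun v hv => by rw [key v hv]]
  rw [← ofReal_integral_eq_lintegral_ofReal hint', integral_comp_rpow_Ioi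
    (fun u : ℝ => u ^ (β - 1) * Real.exp (-(S / 2 * u))) (by norm_num),
    Real.integral_rpow_mul_exp_neg_mul_Ioi hβ hS2]
  · congr 3
    field_simp
  · refine (ae_restrict_iff' measurableSet_Ioi).2 (Eventually.of_forall fun v hv => ?_)
    have hv' : 0 < v := hv
    simp only [smul_eq_mul, Pi.zero_apply]
    positivity

variable {ι : Type*} [Fintype ι] [DecidableEq ι] {C : Matrix ι ι ℝ}

/-- The exponent of the residual sum of squares in the integrated likelihood. -/
noncomputable def ssExponent (ι : Type*) [Fintype ι] (a : ℝ) : ℝ :=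
  (Fintype.card ι : ℝ) / 2 + a - 3 / 2

/-- The likelihood integrated over `θ` and `σ²`, without its constant factor. -/
noncomputable def integratedLikelihood (X y : ι → ℝ) (a : ℝ) (C : Matrix ι ι ℝ) : ℝ :=
  C.det ^ (-(1 : ℝ) / 2) * (X ⬝ᵥ (C⁻¹ *ᵥ X)) ^ (-(1 : ℝ) / 2) *
    residualSS X y C ^ (-ssExponent ι a)

theorem lintegral_likelihood (hC : C.PosDef) {X y : ι → ℝ} (hX : X ≠ 0)
    (hS : 0 < residualSS X y C) {a : ℝ} (hβ : 0 < ssExponent ι a) {q : ℝ} (hq : 0 ≤ q) :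
    ∫⁻ v in Ioi (0 : ℝ), ∫⁻ θ : ℝ, ENNReal.ofReal (likelihood X y C θ v * (q / v ^ a)) =
      ENNReal.ofReal (√(2 * Real.pi) * 2 ^ ssExponent ι a * Real.Gamma (ssExponent ι a) *
        (integratedLikelihood X y a C * q)) := by
  set A := X ⬝ᵥ (C⁻¹ *ᵥ X) with hAdef
  set S := residualSS X y C with hSdef
  set β := ssExponent ι a with hβdef
  have hA : 0 < A := posDef_pos hC.inv hX
  have hdet := hC.det_pos
  have inner : ∀ v ∈ Ioi (0 : ℝ), ∫⁻ θ : ℝ, ENNReal.ofReal (likelihood X y C θ v * (q / v ^ a)) =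
      ENNReal.ofReal (√(2 * Real.pi) * (C.det ^ (-(1 : ℝ) / 2) * A ^ (-(1 : ℝ) / 2) * q)) *
        ENNReal.ofReal (v ^ (-β - 1) * Real.exp (-(S / (2 * v)))) := by
    intro v hv
    have hv' : 0 < v := hv
    have h1 : ∀ θ : ℝ, ENNReal.ofReal (likelihood X y C θ v * (q / v ^ a)) =
        ENNReal.ofReal (v ^ (-(Fintype.card ι : ℝ) / 2) * C.det ^ (-(1 : ℝ) / 2) *
          Real.exp (-(S / (2 * v))) * (q / v ^ a)) *
        ENNReal.ofReal (Real.exp (-(A / (2 * v)) * (θ - (X ⬝ᵥ (C⁻¹ *ᵥ y)) / A) ^ 2)) := by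
      intro θ
      rw [← ENNReal.ofReal_mul (by positivity), likelihood, form_residual hC hX]
      congr 1
      have : -(1 / (2 * v)) * (A * (θ - (X ⬝ᵥ (C⁻¹ *ᵥ y)) / A) ^ 2 + S) =
          -(S / (2 * v)) + -(A / (2 * v)) * (θ - (X ⬝ᵥ (C⁻¹ *ᵥ y)) / A) ^ 2 := by
        field_simp
        ring
      rw [this, Real.exp_add]
      ring
    simp only [h1]
    rw [lintegral_const_mul' _ _ ENNReal.ofReal_ne_top,
      lintegral_gaussian_shift (by positivity : 0 < A / (2 * v)),
      ← ENNReal.ofReal_mul (by positivity), ← ENNReal.ofReal_mul (by positivity)]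
    congr 1
    have h2 : √(Real.pi / (A / (2 * v))) =
        √(2 * Real.pi) * A ^ (-(1 : ℝ) / 2) * v ^ ((1 : ℝ) / 2) := by
      rw [show Real.pi / (A / (2 * v)) = 2 * Real.pi * A⁻¹ * v by field_simp,
        Real.sqrt_mul (by positivity), Real.sqrt_mul (by positivity), Real.sqrt_inv,
        Real.sqrt_eq_rpow A, Real.sqrt_eq_rpow v, ← Real.rpow_neg hA.le]
      norm_num
    -- The power of `v`: `-n/2` from the likelihood, `+1/2` from the Gaussian integral over `θ`, and
    -- `-a` from the prior.
    have h3 : v ^ (-β - 1) = v ^ (-(Fintype.card ι : ℝ) / 2) * v ^ ((1 : ℝ) / 2) / v ^ a := by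
      rw [← Real.rpow_add hv', ← Real.rpow_sub hv']
      congr 1
      rw [hβdef, ssExponent]
      ring
    rw [h2, h3]
    ring
  rw [setLIntegral_congr_fun measurableSet_Ioi inner,
    lintegral_const_mul' _ _ ENNReal.ofReal_ne_top, lintegral_inverse_gamma hβ hS,
    ← ENNReal.ofReal_mul (by positivity)]
  congr 1
  rw [Real.div_rpow (by norm_num) hS.le, integratedLikelihood, Real.rpow_neg hS.le,
    ← hβdef, ← hAdef]
  field_simp

end integrals

/-! ### The information matrix -/

theorem exists_ne_zero_orthogonal {q m : ℕ} (hq : q < m) (x : Fin q → Fin m → ℝ) :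
    ∃ u : Fin m → ℝ, u ≠ 0 ∧ ∀ i, u ⬝ᵥ x i = 0 := by
  have h := LinearMap.ker_ne_bot_of_finrank_lt (f := (Matrix.of x).mulVecLin) (by simpa using hq)
  obtain ⟨u, hu, hu0⟩ := Submodule.exists_mem_ne_zero_of_ne_bot h
  refine ⟨u, hu0, fun i => ?_⟩
  have := congrFun (LinearMap.mem_ker.1 hu) i
  rw [dotProduct_comm]
  exact this

section residual

variable {ι : Type*} [Fintype ι]

theorem infoMatrix_transpose {r : ℕ} (c : ℝ) (W : Fin r → Matrix ι ι ℝ) :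
    (infoMatrix c W)ᵀ = infoMatrix c W := by
  ext a b
  cases a with
  | none => cases b <;> rfl
  | some i =>
    cases b with
    | none => rfl
    | some j => exact trace_mul_comm (W j) (W i)

/-- Each entry `(a, b)` is at most `m² g_a g_b`, with `g = 1` at the extra index and `g = h_k`
otherwise. In the Leibniz formula every permutation meets each index once as a row and once as a
column, so each term is at most a constant times `(∏ h_k)²`. -/
theorem sqrt_det_infoMatrix_le {r : ℕ} [Nonempty ι] {c : ℝ} (hc0 : 0 ≤ c)
    (hc : c ≤ Fintype.card ι) {W : Fin r → Matrix ι ι ℝ} {h : Fin r → ℝ} (hh : ∀ k, 0 ≤ h k)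
    (hW : ∀ k i j, |W k i j| ≤ h k) :
    √(infoMatrix c W).det ≤
      √((Fintype.card (Option (Fin r))).factorial *
        ((Fintype.card ι : ℝ) ^ 2) ^ Fintype.card (Option (Fin r))) * ∏ k, h k := by
  set m : ℝ := (Fintype.card ι : ℝ) with hm
  have hm1 : 1 ≤ m := by
    rw [hm]; exact_mod_cast Fintype.card_pos
  let g : Option (Fin r) → ℝ := fun a => a.elim 1 h
  have hg : ∀ a, 0 ≤ g a := by
    intro a
    cases a with
    | none => exact zero_le_one
    | some k => exact hh k
  have htr : ∀ k, |(W k).trace| ≤ m * h k := by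
    intro k
    refine (Finset.abs_sum_le_sum_abs _ _).trans ?_
    refine (Finset.sum_le_sum fun i _ => hW k i i).trans ?_
    simp [hm]
  have hM : ∀ a b, |infoMatrix c W a b| ≤ m ^ 2 * (g a * g b) := by
    intro a b
    cases a with
    | none =>
      cases b with
      | none =>
        simp only [infoMatrix, of_apply, g, Option.elim]
        rw [abs_of_nonneg hc0]
        nlinarith
      | some j =>
        simp only [infoMatrix, of_apply, g, Option.elim]
        refine (htr j).trans ?_
        rw [one_mul]
        exact mul_le_mul_of_nonneg_right (by nlinarith) (hh j)
    | some i =>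
      cases b with
      | none =>
        simp only [infoMatrix, of_apply, g, Option.elim]
        refine (htr i).trans ?_
        rw [mul_one]
        exact mul_le_mul_of_nonneg_right (by nlinarith) (hh i)
      | some j =>
        simp only [infoMatrix, of_apply, g, Option.elim]
        refine (Finset.abs_sum_le_sum_abs _ _).trans ?_
        have : ∀ a, |(W i * W j) a a| ≤ m * (h i * h j) := by
          intro a
          rw [mul_apply]
          refine (Finset.abs_sum_le_sum_abs _ _).trans ?_
          refine (Finset.sum_le_sum fun b _ => ?_).trans_eq
            (b := ∑ _b : ι, h i * h j) (by simp [hm])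
          rw [abs_mul]
          exact mul_le_mul (hW i a b) (hW j b a) (abs_nonneg _) (hh i)
        refine (Finset.sum_le_sum fun a _ => this a).trans_eq ?_
        simp [← hm]
        ring
  have hdet : (infoMatrix c W).det ≤ (Fintype.card (Option (Fin r))).factorial *
      (m ^ 2) ^ Fintype.card (Option (Fin r)) * (∏ k, h k) ^ 2 := by
    refine (le_abs_self _).trans ?_
    rw [det_apply]
    refine (Finset.abs_sum_le_sum_abs _ _).trans ?_
    refine (Finset.sum_le_sum fun σ _ => ?_).trans_eq
      (b := ∑ _σ : Equiv.Perm (Option (Fin r)),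
        (m ^ 2) ^ Fintype.card (Option (Fin r)) * (∏ k, h k) ^ 2) ?_
    · have hsign : ∀ z : ℝ, |Equiv.Perm.sign σ • z| = |z| := by
        intro z
        rcases Int.units_eq_one_or (Equiv.Perm.sign σ) with h | h <;> simp [h]
      rw [hsign, Finset.abs_prod]
      refine (Finset.prod_le_prod (fun _ _ => abs_nonneg _) fun a _ => hM (σ a) a).trans_eq ?_
      rw [Finset.prod_mul_distrib, Finset.prod_mul_distrib, Equiv.prod_comp σ g,
        Finset.prod_const, Fintype.prod_option]
      simp only [g, Option.elim, Finset.card_univ]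
      ring
    · rw [Finset.sum_const, Finset.card_univ, Fintype.card_perm, nsmul_eq_mul, mul_assoc]
  refine (Real.sqrt_le_sqrt hdet).trans_eq ?_
  rw [Real.sqrt_mul (by positivity), Real.sqrt_sq (Finset.prod_nonneg fun k _ => hh k)]

variable [DecidableEq ι] {C : Matrix ι ι ℝ}

/-- With `X = 0` the independence Jeffreys matrix becomes an instance of the reference construction,
so one positivity proof covers both. -/
theorem residualQ_zero : residualQ 0 C = C⁻¹ := by
  simp [residualQ]

theorem residualQ_eq (hC : C.PosDef) (X : ι → ℝ) :
    residualQ X C = C⁻¹ - (X ⬝ᵥ (C⁻¹ *ᵥ X))⁻¹ • vecMulVec (C⁻¹ *ᵥ X) (C⁻¹ *ᵥ X) := by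
  rw [residualQ, Matrix.mul_sub, Matrix.mul_one, Matrix.mul_smul, vecMulVec_mul, mul_vecMulVec,
    ← mulVec_transpose, posDef_transpose hC.inv]

theorem residualQ_transpose (hC : C.PosDef) (X : ι → ℝ) : (residualQ X C)ᵀ = residualQ X C := by
  rw [residualQ_eq hC, transpose_sub, transpose_smul, transpose_vecMulVec,
    posDef_transpose hC.inv]

theorem mul_residualQ (hC : C.PosDef) (X : ι → ℝ) :
    C * residualQ X C = 1 - (X ⬝ᵥ (C⁻¹ *ᵥ X))⁻¹ • vecMulVec X (C⁻¹ *ᵥ X) := by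
  rw [residualQ_eq hC, Matrix.mul_sub, Matrix.mul_smul, mul_vecMulVec, mulVec_mulVec,
    mul_nonsing_inv _ (posDef_isUnit_det hC), one_mulVec]

/-- The rank-one correction in `C Q` is killed by `Q` because `Q X = 0`. This identity gives the
corner entry and the first row of the information matrix the same trace form as the other entries.
-/
theorem residualQ_mul_mul (hC : C.PosDef) (X : ι → ℝ) :
    residualQ X C * C * residualQ X C = residualQ X C := by
  rw [Matrix.mul_assoc, mul_residualQ hC, Matrix.mul_sub, Matrix.mul_one, Matrix.mul_smul,
    mul_vecMulVec, sub_eq_self, residualQ_eq hC, sub_mulVec, smul_mulVec, vecMulVec_mulVec,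
    dotProduct_comm (C⁻¹ *ᵥ X) X]
  by_cases h : X ⬝ᵥ (C⁻¹ *ᵥ X) = 0
  · simp [h]
  · rw [op_smul_eq_smul, smul_smul, inv_mul_cancel₀ h, one_smul, sub_self, zero_vecMulVec,
      smul_zero]

/-- `Q C` differs from the identity by a rank-one matrix with row vector `X`, so it fixes everything
orthogonal to `X`. -/
theorem residualQ_mulVec_mulVec (hC : C.PosDef) {X v : ι → ℝ} (hv : v ⬝ᵥ X = 0) :
    residualQ X C *ᵥ (C *ᵥ v) = v := by
  have h : (residualQ X C * C)ᵀ = C * residualQ X C := by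
    rw [transpose_mul, residualQ_transpose hC, posDef_transpose hC]
  have h2 : residualQ X C * C = 1 - (X ⬝ᵥ (C⁻¹ *ᵥ X))⁻¹ • vecMulVec (C⁻¹ *ᵥ X) X := by
    rw [← transpose_transpose (residualQ X C * C), h, mul_residualQ hC, transpose_sub,
      transpose_one, transpose_smul, transpose_vecMulVec]
  rw [mulVec_mulVec, h2, sub_mulVec, one_mulVec, smul_mulVec, vecMulVec_mulVec,
    dotProduct_comm X v, hv]
  simp

theorem trace_mul_residualQ (hC : C.PosDef) (X : ι → ℝ) :
    (C * residualQ X C).trace =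
      Fintype.card ι - (X ⬝ᵥ (C⁻¹ *ᵥ X))⁻¹ * (X ⬝ᵥ (C⁻¹ *ᵥ X)) := by
  rw [mul_residualQ hC, trace_sub, trace_one, trace_smul, trace_vecMulVec, smul_eq_mul]

theorem trace_mul_residualQ_of_ne_zero (hC : C.PosDef) {X : ι → ℝ} (hX : X ≠ 0) :
    (C * residualQ X C).trace = Fintype.card ι - 1 := by
  rw [trace_mul_residualQ hC, inv_mul_cancel₀ (posDef_pos hC.inv hX).ne']

theorem trace_mul_residualQ_zero (hC : C.PosDef) :
    (C * residualQ 0 C).trace = Fintype.card ι := by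
  rw [trace_mul_residualQ hC]
  simp

/-- The matrix is the Gram matrix of `C, S_1, …, S_r` for the form `(M, N) ↦ tr(MQNQ)`. With `Q = F
Fᵀ` the square norm of a combination `N` is the Frobenius norm squared of `Fᵀ N F`. It vanishes only
if `N` vanishes as a quadratic form on the range of `F`, which contains every contrast `v ⊥ X`. -/
theorem posDef_infoMatrix {r : ℕ} (hC : C.PosDef) (X : ι → ℝ) {S : Fin r → Matrix ι ι ℝ}
    (hS : ∀ k, (S k)ᵀ = S k)
    (hnd : ∀ (c0 : ℝ) (c : Fin r → ℝ), (∀ v, v ⬝ᵥ X = 0 →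
      v ⬝ᵥ ((c0 • C + ∑ k, c k • S k) *ᵥ v) = 0) → c0 = 0 ∧ ∀ k, c k = 0) :
    (infoMatrix (C * residualQ X C).trace fun k => S k * residualQ X C).PosDef := by
  set Q := residualQ X C with hQ
  obtain ⟨L, hL⟩ := exists_eq_mul_transpose hC
  have hQt : Qᵀ = Q := residualQ_transpose hC X
  have hQCQ : Q * (C * Q) = Q := by rw [← Matrix.mul_assoc]; exact residualQ_mul_mul hC X
  refine PosDef.of_dotProduct_mulVec_pos ?_ fun x hx => ?_
  · rw [IsHermitian, conjTranspose_eq_transpose_of_trivial, infoMatrix_transpose]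
  -- The extra index stands for `C` itself; `Q C Q = Q` then reproduces the corner entry and the
  -- first row.
  let M : Option (Fin r) → Matrix ι ι ℝ := fun a => a.elim C S
  have hM : ∀ a b, infoMatrix (C * Q).trace (fun k => S k * Q) a b =
      (M a * Q * (M b * Q)).trace := by
    intro a b
    cases a with
    | none =>
      cases b with
      | none => simp only [infoMatrix, of_apply, M, Option.elim, Matrix.mul_assoc, hQCQ]
      | some j =>
        simp only [infoMatrix, of_apply, M, Option.elim]
        rw [trace_mul_comm (C * Q), Matrix.mul_assoc (S j), hQCQ]
    | some i =>
      cases b with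
      | none => simp only [infoMatrix, of_apply, M, Option.elim, Matrix.mul_assoc, hQCQ]
      | some j => simp only [infoMatrix, of_apply, M, Option.elim]
  set N : Matrix ι ι ℝ := ∑ a, x a • M a with hN
  have hMt : ∀ a, (M a)ᵀ = M a := by
    intro a
    cases a with
    | none => exact posDef_transpose hC
    | some i => exact hS i
  have hNt : Nᵀ = N := by
    simp only [hN, transpose_sum, transpose_smul, hMt]
  have hform : star x ⬝ᵥ (infoMatrix (C * Q).trace (fun k => S k * Q) *ᵥ x) =
      (N * Q * (N * Q)).trace := by
    have : N * Q = ∑ a, x a • (M a * Q) := by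
      rw [hN, Finset.sum_mul]
      simp only [Matrix.smul_mul]
    simp only [this, Finset.sum_mul, Finset.mul_sum, trace_sum, Matrix.smul_mul, Matrix.mul_smul,
      trace_smul, smul_eq_mul, dotProduct, mulVec, hM, star_trivial]
    refine Finset.sum_congr rfl fun a _ => Finset.sum_congr rfl fun b _ => ?_
    rw [trace_mul_comm (M b * Q)]
    ring
  -- From `C = L Lᵀ` and `Q C Q = Q` this is a square root of `Q`.
  set F := Q * L with hF
  have hQF : Q = F * Fᵀ := by
    rw [hF, transpose_mul, hQt, Matrix.mul_assoc, ← Matrix.mul_assoc L, ← hL, hQCQ]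
  set G := Fᵀ * N * F with hG
  have hGt : Gᵀ = G := by
    rw [hG, transpose_mul, transpose_mul Fᵀ, hNt, transpose_transpose, Matrix.mul_assoc]
  have htr : (N * Q * (N * Q)).trace = (Gᴴ * G).trace := by
    rw [conjTranspose_eq_transpose_of_trivial, hGt, hQF, hG]
    have : N * (F * Fᵀ) * (N * (F * Fᵀ)) = N * F * (Fᵀ * N * F * Fᵀ) := by
      simp only [Matrix.mul_assoc]
    rw [this, trace_mul_comm]
    simp only [Matrix.mul_assoc]
  rw [hform, htr]
  refine lt_of_le_of_ne (posSemidef_conjTranspose_mul_self G).trace_nonneg fun h0 => hx ?_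
  have hG0 : G = 0 := trace_conjTranspose_mul_self_eq_zero_iff.1 h0.symm
  have hNsum : N = x none • C + ∑ k, x (some k) • S k := by
    rw [hN, Fintype.sum_option]
    rfl
  obtain ⟨h1, h2⟩ := hnd (x none) (fun k => x (some k)) fun v hv => by
    rw [← hNsum]
    have hv' : v = F *ᵥ (Lᵀ *ᵥ v) := by
      rw [mulVec_mulVec, hF, Matrix.mul_assoc, ← hL, ← mulVec_mulVec]
      exact (residualQ_mulVec_mulVec hC hv).symm
    obtain ⟨z, rfl⟩ : ∃ z, v = F *ᵥ z := ⟨_, hv'⟩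
    have hz : (F *ᵥ z) ⬝ᵥ (N *ᵥ (F *ᵥ z)) = z ⬝ᵥ (G *ᵥ z) := by
      rw [hG, Matrix.mul_assoc, ← mulVec_mulVec z Fᵀ (N * F), dotProduct_mulVec z Fᵀ,
        vecMul_transpose, ← mulVec_mulVec z N F]
    rw [hz, hG0, zero_mulVec, dotProduct_zero]
  funext a
  cases a with
  | none => exact h1
  | some k => exact h2 k

end residual

/-! ### Linear independence of `Σ` and its partial derivatives on the contrasts -/

section nondegenerate

variable {r : ℕ} {n : Fin r → ℕ}

theorem form_piKron (A : ∀ k, Matrix (Fin (n k)) (Fin (n k)) ℝ) (v : ∀ k, Fin (n k) → ℝ) :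
    kronVec v ⬝ᵥ (piKron A *ᵥ kronVec v) = ∏ k, v k ⬝ᵥ (A k *ᵥ v k) := by
  rw [piKron_mulVec, kronVec_dotProduct]

theorem form_piKron_update {A : ∀ k, Matrix (Fin (n k)) (Fin (n k)) ℝ} (k : Fin r)
    (B : Matrix (Fin (n k)) (Fin (n k)) ℝ) {v : ∀ k, Fin (n k) → ℝ}
    (hv : v k ⬝ᵥ (A k *ᵥ v k) ≠ 0) :
    kronVec v ⬝ᵥ (piKron (Function.update A k B) *ᵥ kronVec v) =
      (v k ⬝ᵥ (B *ᵥ v k)) / (v k ⬝ᵥ (A k *ᵥ v k)) * ∏ l, v l ⬝ᵥ (A l *ᵥ v l) := by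
  rw [form_piKron, ← Finset.mul_prod_erase _ _ (Finset.mem_univ k), Function.update_self,
    ← Finset.mul_prod_erase Finset.univ (fun l => v l ⬝ᵥ (A l *ᵥ v l)) (Finset.mem_univ k),
    ← mul_assoc, div_mul_cancel₀ _ hv]
  congr 1
  refine Finset.prod_congr rfl fun l hl => ?_
  rw [Function.update_of_ne (Finset.ne_of_mem_erase hl)]

/-- With zero diagonal, the form takes the value `2 B i j` at `e_i + e_j`. -/
theorem exists_form_ne_zero {m : ℕ} {B : Matrix (Fin m) (Fin m) ℝ} (hB : Bᵀ = B)
    (hd : ∀ i, B i i = 0) (h0 : B ≠ 0) : ∃ w : Fin m → ℝ, w ≠ 0 ∧ w ⬝ᵥ (B *ᵥ w) ≠ 0 := by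
  obtain ⟨i, j, hij⟩ : ∃ i j, B i j ≠ 0 := by
    by_contra! h
    exact h0 (Matrix.ext h)
  have hw : (Pi.single i 1 + Pi.single j 1 : Fin m → ℝ) ⬝ᵥ
      (B *ᵥ (Pi.single i 1 + Pi.single j 1)) = 2 * B i j := by
    have hji : B j i = B i j := congrFun (congrFun hB i) j
    simp [mulVec_add, dotProduct_add, add_dotProduct, hd, hji]
    ring
  have hne : (Pi.single i 1 + Pi.single j 1 : Fin m → ℝ) ⬝ᵥ
      (B *ᵥ (Pi.single i 1 + Pi.single j 1)) ≠ 0 := by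
    rw [hw]
    exact mul_ne_zero two_ne_zero hij
  refine ⟨_, fun h => hne ?_, hne⟩
  rw [h, zero_dotProduct]

/-- On a product vector the relation, divided by `∏ v_l'A_l v_l`, reads `c0 + ∑ c_l (v_l'B_l
v_l)/(v_l'A_l v_l) = 0`. Since `r ≥ 2`, orthogonality to `X` can be carried by a factor `j ≠ k`, so
`v_k` is free; varying it alone isolates `c_k`. -/
theorem coeff_eq_zero_of_form_eq_zero (hr : 2 ≤ r) (hn : ∀ k, 2 ≤ n k)
    {A B : ∀ k, Matrix (Fin (n k)) (Fin (n k)) ℝ} (hA : ∀ k, (A k).PosDef)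
    (hB : ∀ k, (B k)ᵀ = B k) (hd : ∀ k i, B k i i = 0) (h0 : ∀ k, B k ≠ 0)
    (X : ∀ k, Fin (n k) → ℝ) (c0 : ℝ) (c : Fin r → ℝ)
    (h : ∀ v, v ⬝ᵥ kronVec X = 0 → v ⬝ᵥ ((c0 • piKron A +
      ∑ k, c k • piKron (Function.update A k (B k))) *ᵥ v) = 0) : c0 = 0 ∧ ∀ k, c k = 0 := by
  choose u hu huX using fun k => exists_ne_zero_orthogonal
    (show 1 < n k from hn k) (fun _ => X k)
  have hprod : ∀ v : ∀ k, Fin (n k) → ℝ, (∀ k, v k ≠ 0) → (∃ j, v j ⬝ᵥ X j = 0) →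
      c0 + ∑ k, c k * ((v k ⬝ᵥ (B k *ᵥ v k)) / (v k ⬝ᵥ (A k *ᵥ v k))) = 0 := by
    rintro v hv ⟨j, hj⟩
    have hne : ∀ k, v k ⬝ᵥ (A k *ᵥ v k) ≠ 0 := fun k => (posDef_pos (hA k) (hv k)).ne'
    have h1 := h (kronVec v) (by
      rw [kronVec_dotProduct]
      exact Finset.prod_eq_zero (Finset.mem_univ j) hj)
    rw [add_mulVec, dotProduct_add, smul_mulVec, dotProduct_smul, form_piKron, sum_mulVec,
      dotProduct_sum] at h1
    simp only [smul_mulVec, dotProduct_smul, smul_eq_mul, form_piKron_update _ _ (hne _),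
      ← mul_assoc, ← Finset.sum_mul, ← add_mul] at h1
    simpa only [mul_div_assoc] using
      (mul_eq_zero.1 h1).resolve_right (Finset.prod_ne_zero_iff.2 fun k _ => hne k)
  have hc : ∀ k, c k = 0 := by
    intro k
    have : Nontrivial (Fin r) := Fin.nontrivial_iff_two_le.2 hr
    obtain ⟨j, hj⟩ := exists_ne k
    obtain ⟨w, hw, hBw⟩ := exists_form_ne_zero (hB k) (hd k) (h0 k)
    -- A coordinate vector: the form of `B k` vanishes there because its diagonal does, which serves
    -- as the reference value to compare with `w`.
    let e : Fin (n k) → ℝ := Pi.single ⟨0, by have := hn k; omega⟩ 1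
    have he : e ≠ 0 := by simp [e]
    have hBe : e ⬝ᵥ (B k *ᵥ e) = 0 := by simp [e, hd]
    have hupd : ∀ z : Fin (n k) → ℝ, z ≠ 0 → c0 + ∑ l, c l *
        ((Function.update u k z l ⬝ᵥ (B l *ᵥ Function.update u k z l)) /
          (Function.update u k z l ⬝ᵥ (A l *ᵥ Function.update u k z l))) = 0 := by
      intro z hz
      refine hprod _ (fun l => ?_) ⟨j, ?_⟩
      · by_cases hl : l = k
        · subst hl; rwa [Function.update_self]
        · rw [Function.update_of_ne hl]; exact hu l
      · rw [Function.update_of_ne hj]; exact huX j 0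
    have h1 := hupd w hw
    have h2 := hupd e he
    have h3 := h1.trans h2.symm
    rw [add_right_inj, ← sub_eq_zero, ← Finset.sum_sub_distrib,
      Finset.sum_eq_single k, Function.update_self, Function.update_self, hBe, zero_div,
      mul_zero, sub_zero] at h3
    · exact (mul_eq_zero.1 h3).resolve_right
        (div_ne_zero hBw (posDef_pos (hA k) hw).ne')
    · intro l _ hl
      rw [Function.update_of_ne hl, Function.update_of_ne hl, sub_self]
    · simp
  refine ⟨?_, hc⟩
  have := hprod u hu ⟨⟨0, by omega⟩, huX _ 0⟩
  simpa [hc] using this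

end nondegenerate

/-! ### Bounds for a single factor -/

theorem abs_dotProduct_le {ι : Type*} [Fintype ι] {u v : ι → ℝ} {b : ℝ} (hv : ∀ i, |v i| ≤ b) :
    |u ⬝ᵥ v| ≤ b * ∑ i, |u i| := by
  rw [Finset.mul_sum]
  refine (Finset.abs_sum_le_sum_abs _ _).trans (Finset.sum_le_sum fun i _ => ?_)
  rw [abs_mul, mul_comm]
  exact mul_le_mul_of_nonneg_right (hv i) (abs_nonneg _)

theorem abs_mulVec_le {ι : Type*} [Fintype ι] {M : Matrix ι ι ℝ} {v : ι → ℝ} {b : ℝ}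
    (hM : ∀ i j, |M i j| ≤ b) (i : ι) : |(M *ᵥ v) i| ≤ b * ∑ i, |v i| := by
  rw [mulVec, dotProduct_comm]
  exact abs_dotProduct_le (hM i)

theorem abs_form_le {ι : Type*} [Fintype ι] {M : Matrix ι ι ℝ} {u v : ι → ℝ} {b : ℝ}
    (hM : ∀ i j, |M i j| ≤ b) : |u ⬝ᵥ (M *ᵥ v)| ≤ b * (∑ i, |v i|) * ∑ i, |u i| :=
  abs_dotProduct_le (abs_mulVec_le hM)

theorem sum_abs_nonneg {ι : Type*} [Fintype ι] (v : ι → ℝ) : 0 ≤ ∑ i, |v i| :=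
  Finset.sum_nonneg fun _ _ => abs_nonneg _

open Classical in
/-- The order of `(X' Σ⁻¹ X)⁻¹` in the small parameter of a factor: `0` if `X = 1`, else `1`. -/
noncomputable def meanExponent {m : ℕ} (X : Fin m → ℝ) : ℕ := if X = 1 then 0 else 1

/-- The matrix of the generalized least squares projection onto `X`. -/
noncomputable def glsProj {ι : Type*} [Fintype ι] [DecidableEq ι] (X : ι → ℝ)
    (C : Matrix ι ι ℝ) : Matrix ι ι ℝ :=
  (X ⬝ᵥ (C⁻¹ *ᵥ X))⁻¹ • (vecMulVec X X * C⁻¹)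

theorem glsProj_apply {ι : Type*} [Fintype ι] [DecidableEq ι] (X : ι → ℝ) {C : Matrix ι ι ℝ}
    (hC : C.PosDef) (i j : ι) :
    glsProj X C i j = (X ⬝ᵥ (C⁻¹ *ᵥ X))⁻¹ * (X i * (C⁻¹ *ᵥ X) j) := by
  rw [glsProj, vecMulVec_mul, Matrix.smul_apply, vecMulVec_apply, smul_eq_mul, ← mulVec_transpose,
    posDef_transpose hC.inv]

/-- Bounds for the correlation matrix `S` of a factor and its derivative `S'` in terms of
`μ`, which measures how close `S` is to the singular matrix `1 1'`, and of `h`. -/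
structure FactorBound {m : ℕ} (S S' : Matrix (Fin m) (Fin m) ℝ) (X : Fin m → ℝ)
    (μ h K : ℝ) : Prop where
  mu_pos : 0 < μ
  mu_le : μ ≤ K
  h_nonneg : 0 ≤ h
  det_ge : μ ^ (m - 1) ≤ K * S.det
  form_ge : 1 ≤ K * (μ ^ meanExponent X * (X ⬝ᵥ (S⁻¹ *ᵥ X)))
  form_le : μ ^ meanExponent X * (X ⬝ᵥ (S⁻¹ *ᵥ X)) ≤ K
  quad_le : ∀ v, v ⬝ᵥ (S *ᵥ v) ≤ K * (∑ i, |v i|) ^ 2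
  quad_le_of_orthogonal : ∀ v, v ⬝ᵥ 1 = 0 → v ⬝ᵥ (S *ᵥ v) ≤ K * μ * (∑ i, |v i|) ^ 2
  deriv_le : ∀ i j, |(S' * S⁻¹) i j| ≤ h
  proj_le : ∀ i j, |glsProj X S i j| ≤ K

theorem FactorBound.mono {m : ℕ} {S S' : Matrix (Fin m) (Fin m) ℝ} {X : Fin m → ℝ}
    {μ h K K' : ℝ} (H : FactorBound S S' X μ h K) (hS : S.PosDef) (hK : K ≤ K') :
    FactorBound S S' X μ h K' := by
  have h1 := hS.det_pos.le
  have h2 := posDef_nonneg hS.inv X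
  have h3 := H.mu_pos
  exact
  { mu_pos := H.mu_pos
    mu_le := H.mu_le.trans hK
    h_nonneg := H.h_nonneg
    det_ge := H.det_ge.trans (by gcongr)
    form_ge := H.form_ge.trans (by gcongr)
    form_le := H.form_le.trans hK
    quad_le := fun v => (H.quad_le v).trans (by gcongr)
    quad_le_of_orthogonal := fun v hv => (H.quad_le_of_orthogonal v hv).trans (by gcongr)
    deriv_le := H.deriv_le
    proj_le := fun i j => (H.proj_le i j).trans hK }

theorem abs_adjugate_le {m : ℕ} {S : Matrix (Fin m) (Fin m) ℝ} (hS : ∀ i j, |S i j| ≤ 1)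
    (i j : Fin m) : |S.adjugate i j| ≤ m.factorial := by
  rw [adjugate_apply]
  have h : ∀ a b, |(S.updateRow j (Pi.single i 1)) a b| ≤ 1 := by
    intro a b
    rw [updateRow_apply]
    split_ifs
    · rw [Pi.single_apply]
      split_ifs <;> simp
    · exact hS a b
  simpa using det_le (abv := AbsoluteValue.abs) h

/-- Entries at most one and a determinant bounded below bound the inverse through the adjugate,
whose entries are at most `m!`. Everything else follows with degeneracy scale `1`; the lower bound
for `X'S⁻¹X` comes from Cauchy–Schwarz with both vectors equal to `X`. -/
theorem exists_factorBound_of_det {m : ℕ} {X : Fin m → ℝ} (hX : X ≠ 0) (K0 : ℝ) (hK0 : 0 ≤ K0) :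
    ∃ K, 0 ≤ K ∧ ∀ S S' : Matrix (Fin m) (Fin m) ℝ, S.PosDef → (∀ i j, |S i j| ≤ 1) →
      1 ≤ K0 * S.det → FactorBound S S' X 1 (K * ∑ i, ∑ j, |S' i j|) K := by
  set M := ∑ i, |X i| with hM
  have hM0 : 0 ≤ M := sum_abs_nonneg X
  set b : ℝ := K0 * m.factorial with hb
  have hb0 : 0 ≤ b := by positivity
  have hXX : 0 < X ⬝ᵥ X := by
    refine lt_of_le_of_ne (Finset.sum_nonneg fun i _ => mul_self_nonneg _) fun h => hX ?_
    exact dotProduct_self_eq_zero.1 h.symm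
  set a := M ^ 2 / (X ⬝ᵥ X) ^ 2 with ha
  have ha0 : 0 ≤ a := by positivity
  refine ⟨1 + K0 + b + b * M ^ 2 + a + a * (M * (b * M)), by positivity, fun S S' hS hS1 hdet => ?_⟩
  have hinv : ∀ i j, |S⁻¹ i j| ≤ b := by
    intro i j
    rw [inv_def, Matrix.smul_apply, smul_eq_mul, Ring.inverse_eq_inv', abs_mul, abs_inv,
      abs_of_pos hS.det_pos]
    refine mul_le_mul ?_ (abs_adjugate_le hS1 i j) (abs_nonneg _) hK0
    rw [inv_eq_one_div, div_le_iff₀ hS.det_pos]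
    exact hdet
  have hform := posDef_pos hS.inv hX
  have hquad : ∀ v : Fin m → ℝ, v ⬝ᵥ (S *ᵥ v) ≤ (∑ i, |v i|) ^ 2 := by
    intro v
    refine (le_abs_self _).trans ((abs_form_le hS1).trans_eq ?_)
    ring
  have hlow : (X ⬝ᵥ X) ^ 2 ≤ (X ⬝ᵥ (S⁻¹ *ᵥ X)) * M ^ 2 :=
    (sq_dotProduct_le hS X X).trans (mul_le_mul_of_nonneg_left (hquad X) hform.le)
  have hinvform : (X ⬝ᵥ (S⁻¹ *ᵥ X))⁻¹ ≤ a := by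
    rw [inv_eq_one_div, div_le_iff₀ hform, ha, div_mul_eq_mul_div, le_div_iff₀ (by positivity)]
    linarith
  set T := ∑ i, ∑ j, |S' i j| with hT
  have hT0 : 0 ≤ T := Finset.sum_nonneg fun i _ => sum_abs_nonneg _
  have hbM : 0 ≤ b * M ^ 2 := by positivity
  have haM : 0 ≤ a * (M * (b * M)) := by positivity
  refine ⟨one_pos, by linarith, by positivity, ?_, ?_, ?_, fun v => ?_, fun v _ => ?_, ?_, ?_⟩
  · rw [one_pow]
    refine hdet.trans (mul_le_mul_of_nonneg_right (by linarith) hS.det_pos.le)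
  · rw [one_pow, one_mul]
    have : 1 ≤ a * (X ⬝ᵥ (S⁻¹ *ᵥ X)) := by
      rwa [inv_eq_one_div, div_le_iff₀ hform] at hinvform
    exact this.trans (mul_le_mul_of_nonneg_right (by linarith) hform.le)
  · rw [one_pow, one_mul]
    have : X ⬝ᵥ (S⁻¹ *ᵥ X) ≤ b * M ^ 2 := by
      refine (le_abs_self _).trans ((abs_form_le hinv).trans_eq ?_)
      rw [← hM]
      ring
    linarith
  · refine (hquad v).trans (le_mul_of_one_le_left (sq_nonneg _) (by linarith))
  · rw [mul_one]
    refine (hquad v).trans (le_mul_of_one_le_left (sq_nonneg _) (by linarith))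
  · intro i j
    have h1 : |(S' * S⁻¹) i j| ≤ b * ∑ l, |S' i l| := by
      rw [mul_apply]
      exact abs_dotProduct_le (u := S' i) fun l => hinv l j
    refine h1.trans (mul_le_mul (by linarith) ?_ (sum_abs_nonneg _) (by positivity))
    exact Finset.single_le_sum (f := fun i => ∑ j, |S' i j|)
      (fun i _ => sum_abs_nonneg _) (Finset.mem_univ i)
  · intro i j
    rw [glsProj_apply X hS, abs_mul, abs_mul, abs_inv, abs_of_pos hform]
    have h1 : |X i| ≤ M :=
      Finset.single_le_sum (f := fun i => |X i|) (fun i _ => abs_nonneg _) (Finset.mem_univ i)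
    have h2 : (X ⬝ᵥ (S⁻¹ *ᵥ X))⁻¹ * (|X i| * |(S⁻¹ *ᵥ X) j|) ≤ a * (M * (b * M)) :=
      mul_le_mul hinvform (mul_le_mul h1 (abs_mulVec_le hinv j) (abs_nonneg _) hM0)
        (by positivity) ha0
    linarith

/-! ### Rank-one updates `S = 11' + νE` -/

section rankOne

variable {m : ℕ} {S E : Matrix (Fin m) (Fin m) ℝ} {ν : ℝ}

/-- Sherman–Morrison on the vector `1`: `S` maps `E⁻¹1` to a multiple of `1`. The result stays
bounded as `ν → 0`. -/
theorem inv_mulVec_one_of_eq (hS : IsUnit S.det) (hE : IsUnit E.det)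
    (h : S = vecMulVec 1 1 + ν • E) (hκ : 1 ⬝ᵥ (E⁻¹ *ᵥ 1) + ν ≠ 0) :
    S⁻¹ *ᵥ 1 = (1 ⬝ᵥ (E⁻¹ *ᵥ 1) + ν)⁻¹ • (E⁻¹ *ᵥ 1) := by
  have h1 : S *ᵥ (E⁻¹ *ᵥ 1) = (1 ⬝ᵥ (E⁻¹ *ᵥ 1) + ν) • (1 : Fin m → ℝ) := by
    rw [h, add_mulVec, vecMulVec_mulVec, smul_mulVec, mulVec_mulVec, mul_nonsing_inv _ hE,
      one_mulVec, add_smul, op_smul_eq_smul]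
  rw [eq_inv_smul_iff₀ hκ, ← mulVec_smul, ← h1, mulVec_mulVec, nonsing_inv_mul _ hS, one_mulVec]

/-- Multiply `S = 11' + νE` by `S⁻¹`. The right-hand side contains no division by `ν`, so `ν S⁻¹`
has a limit as soon as `S⁻¹1` and `E⁻¹` do. -/
theorem smul_inv_of_eq (hS : IsUnit S.det) (hE : IsUnit E.det)
    (h : S = vecMulVec 1 1 + ν • E) :
    ν • S⁻¹ = (1 - vecMulVec (S⁻¹ *ᵥ 1) 1) * E⁻¹ := by
  have h1 : S⁻¹ * (ν • E) = 1 - vecMulVec (S⁻¹ *ᵥ 1) 1 := by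
    rw [← mul_vecMulVec, eq_sub_iff_add_eq, ← Matrix.mul_add, add_comm, ← h,
      nonsing_inv_mul _ hS]
  rw [← h1, Matrix.mul_smul, Matrix.smul_mul, Matrix.mul_assoc, mul_nonsing_inv _ hE,
    Matrix.mul_one]

/-- The matrix determinant lemma: the rank-one term contributes a factor of order `ν⁻¹`, which turns
`ν^m` into `ν^(m-1)`. -/
theorem det_of_eq (hm : 1 ≤ m) (hE : IsUnit E.det) (hν : ν ≠ 0)
    (h : S = vecMulVec 1 1 + ν • E) :
    S.det = ν ^ (m - 1) * (E.det * (1 ⬝ᵥ (E⁻¹ *ᵥ 1) + ν)) := by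
  have h1 : S = E * (ν • (1 + replicateCol Unit (ν⁻¹ • (E⁻¹ *ᵥ 1)) *
      replicateRow Unit (1 : Fin m → ℝ))) := by
    rw [← vecMulVec_eq, smul_vecMulVec, smul_add, smul_smul, mul_inv_cancel₀ hν, one_smul,
      Matrix.mul_add, mul_vecMulVec, mulVec_mulVec, mul_nonsing_inv _ hE, one_mulVec,
      Matrix.mul_smul, Matrix.mul_one, add_comm, h]
  obtain ⟨q, rfl⟩ : ∃ q, m = q + 1 := ⟨m - 1, by omega⟩
  rw [h1, det_mul, det_smul, det_one_add_replicateCol_mul_replicateRow, Fintype.card_fin,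
    dotProduct_smul, smul_eq_mul, Nat.add_sub_cancel]
  field_simp
  ring

end rankOne

theorem eventually_abs_le_of_tendsto {α : Type*} {l : Filter α} {f : α → ℝ} {L : ℝ}
    (h : Tendsto f l (𝓝 L)) : ∀ᶠ t in l, |f t| ≤ |L| + 1 :=
  h.abs.eventually_le_const (by linarith)

theorem exists_eventually_matrix_le {α : Type*} {l : Filter α} {m : ℕ}
    {M : α → Matrix (Fin m) (Fin m) ℝ} {L : Matrix (Fin m) (Fin m) ℝ}
    (h : Tendsto M l (𝓝 L)) : ∃ K, 0 ≤ K ∧ ∀ᶠ t in l, ∀ i j, |M t i j| ≤ K := by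
  refine ⟨∑ i, ∑ j, (|L i j| + 1), by positivity, ?_⟩
  simp only [eventually_all]
  intro i j
  filter_upwards [eventually_abs_le_of_tendsto
    (tendsto_pi_nhds.1 (tendsto_pi_nhds.1 h i) j)] with t ht
  refine ht.trans ?_
  refine (Finset.single_le_sum (f := fun j => |L i j| + 1) (fun j _ => by positivity)
    (Finset.mem_univ j)).trans ?_
  exact Finset.single_le_sum (f := fun i => ∑ j, (|L i j| + 1)) (fun i _ => by positivity)
    (Finset.mem_univ i)

theorem exists_eventually_one_le_mul {α : Type*} {l : Filter α} {f : α → ℝ} {L : ℝ}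
    (h : Tendsto f l (𝓝 L)) (hL : L ≠ 0) (hf : ∀ᶠ t in l, 0 ≤ f t) :
    ∃ K, 0 ≤ K ∧ ∀ᶠ t in l, 1 ≤ K * f t := by
  have hL' : 0 < |L| := abs_pos.2 hL
  refine ⟨(|L| / 2)⁻¹, by positivity, ?_⟩
  filter_upwards [h.abs.eventually_const_le (show |L| / 2 < |L| by linarith), hf] with t h1 h2
  rw [abs_of_nonneg h2] at h1
  rw [inv_mul_eq_div, le_div_iff₀ (by positivity)]
  linarith

/-- Bounds for a factor whose correlation matrix degenerates to `1 1'`. -/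
theorem exists_eventually_factorBound {m : ℕ} (hm : 2 ≤ m) {l : Filter ℝ}
    {S S' E E' : ℝ → Matrix (Fin m) (Fin m) ℝ} {D : Matrix (Fin m) (Fin m) ℝ}
    {X : Fin m → ℝ} {ν ν' : ℝ → ℝ}
    (hS : ∀ᶠ t in l, (S t).PosDef) (hS1 : ∀ᶠ t in l, ∀ i j, |S t i j| ≤ 1)
    (hSE : ∀ᶠ t in l, S t = vecMulVec 1 1 + ν t • E t) (hSE' : ∀ᶠ t in l, S' t = ν' t • E' t)
    (hE : Tendsto E l (𝓝 D)) (hE' : Tendsto E' l (𝓝 D)) (hν : ∀ᶠ t in l, 0 < ν t)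
    (hν0 : Tendsto ν l (𝓝 0)) (hD : D.det ≠ 0)
    (hone : (1 : Fin m → ℝ) ⬝ᵥ (D⁻¹ *ᵥ 1) ≠ 0) (hX : X ⬝ᵥ (D⁻¹ *ᵥ X) ≠ 0)
    (hmix : X ≠ 1 → (1 : Fin m → ℝ) ⬝ᵥ (D⁻¹ *ᵥ 1) ≠
      (1 ⬝ᵥ (D⁻¹ *ᵥ X)) * (X ⬝ᵥ (D⁻¹ *ᵥ X))⁻¹ * (X ⬝ᵥ (D⁻¹ *ᵥ 1))) :
    ∃ K, 0 ≤ K ∧ ∀ᶠ t in l, FactorBound (S t) (S' t) X (ν t) (K * (|ν' t| / ν t)) K := by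
  have hX0 : X ≠ 0 := by
    rintro rfl
    simp at hX
  have hdetE : Tendsto (fun t => (E t).det) l (𝓝 D.det) :=
    ((continuous_id.matrix_det).tendsto D).comp hE
  have hEu : ∀ᶠ t in l, IsUnit (E t).det :=
    (hdetE.eventually_ne hD).mono fun t ht => isUnit_iff_ne_zero.2 ht
  have hEinv : Tendsto (fun t => (E t)⁻¹) l (𝓝 D⁻¹) := by
    refine (continuousAt_matrix_inv D ?_).tendsto.comp hE
    rw [Ring.inverse_eq_inv']
    exact continuousAt_inv₀ hD
  have hu : Tendsto (fun t => (E t)⁻¹ *ᵥ (1 : Fin m → ℝ)) l (𝓝 (D⁻¹ *ᵥ 1)) :=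
    ((continuous_id.matrix_mulVec continuous_const).tendsto D⁻¹).comp hEinv
  have h1u : Tendsto (fun t => (1 : Fin m → ℝ) ⬝ᵥ ((E t)⁻¹ *ᵥ 1)) l (𝓝 (1 ⬝ᵥ (D⁻¹ *ᵥ 1))) :=
    ((Continuous.dotProduct continuous_const continuous_id).tendsto (D⁻¹ *ᵥ 1)).comp hu
  have hκ : Tendsto (fun t => (1 : Fin m → ℝ) ⬝ᵥ ((E t)⁻¹ *ᵥ 1) + ν t) l
      (𝓝 (1 ⬝ᵥ (D⁻¹ *ᵥ 1))) := by
    simpa using h1u.add hν0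
  have hκ0 := hκ.eventually_ne hone
  set d := (1 : Fin m → ℝ) ⬝ᵥ (D⁻¹ *ᵥ 1) with hd
  -- The limit of `S⁻¹1`.
  set z : Fin m → ℝ := d⁻¹ • (D⁻¹ *ᵥ 1) with hz
  have hz1 : (1 : Fin m → ℝ) ⬝ᵥ z = 1 := by
    rw [hz, dotProduct_smul, smul_eq_mul, ← hd, inv_mul_cancel₀ hone]
  have hSz : Tendsto (fun t => (S t)⁻¹ *ᵥ (1 : Fin m → ℝ)) l (𝓝 z) := by
    refine ((hκ.inv₀ hone).smul hu).congr' ?_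
    filter_upwards [hS, hEu, hSE, hκ0] with t h1 h2 h3 h4
    exact (inv_mulVec_one_of_eq (posDef_isUnit_det h1) h2 h3 h4).symm
  -- The limit of `ν S⁻¹`. It annihilates `1`, and this is why `X = 1` behaves differently: `1'S⁻¹1`
  -- stays bounded, while for `X ≠ 1` the form `X'S⁻¹X` grows like `ν⁻¹`.
  set G : Matrix (Fin m) (Fin m) ℝ := (1 - vecMulVec z 1) * D⁻¹ with hG
  have hSG : Tendsto (fun t => ν t • (S t)⁻¹) l (𝓝 G) := by
    have hc : Continuous fun q : Fin m → ℝ => 1 - vecMulVec q (1 : Fin m → ℝ) :=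
      continuous_const.sub (continuous_id.matrix_vecMulVec continuous_const)
    have h1 := ((hc.tendsto z).comp hSz).mul hEinv
    refine h1.congr' ?_
    filter_upwards [hS, hEu, hSE] with t h1 h2 h3
    exact (smul_inv_of_eq (posDef_isUnit_det h1) h2 h3).symm
  -- the determinant
  obtain ⟨K1, hK1, hdet⟩ : ∃ K, 0 ≤ K ∧ ∀ᶠ t in l, ν t ^ (m - 1) ≤ K * (S t).det := by
    have h1 := hdetE.mul hκ
    have h2 : ∀ᶠ t in l, (S t).det =
        ν t ^ (m - 1) * ((E t).det * (1 ⬝ᵥ ((E t)⁻¹ *ᵥ 1) + ν t)) := by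
      filter_upwards [hEu, hSE, hν] with t h1 h2 h3
      exact det_of_eq (by omega) h1 h3.ne' h2
    obtain ⟨K, hK, h3⟩ := exists_eventually_one_le_mul h1 (mul_ne_zero hD hone) (by
      filter_upwards [h2, hS, hν] with t h2 h3 h4
      have h5 := h3.det_pos
      rw [h2] at h5
      exact (pos_of_mul_pos_right h5 (by positivity)).le)
    refine ⟨K, hK, ?_⟩
    filter_upwards [h2, h3, hν] with t h2 h3 h4
    rw [h2]
    calc ν t ^ (m - 1) = ν t ^ (m - 1) * 1 := (mul_one _).symm
      _ ≤ ν t ^ (m - 1) * (K * _) := mul_le_mul_of_nonneg_left h3 (by positivity)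
      _ = _ := by ring
  -- the vector `X`
  obtain ⟨w, hw, hXw⟩ : ∃ w : Fin m → ℝ,
      Tendsto (fun t => ν t ^ meanExponent X • ((S t)⁻¹ *ᵥ X)) l (𝓝 w) ∧ X ⬝ᵥ w ≠ 0 := by
    by_cases hX1 : X = 1
    · refine ⟨z, ?_, ?_⟩
      · simpa [meanExponent, hX1] using hSz
      · rw [hX1, hz1]; exact one_ne_zero
    · refine ⟨G *ᵥ X, ?_, ?_⟩
      · simp only [meanExponent, hX1, if_false, pow_one, ← smul_mulVec]
        exact ((continuous_id.matrix_mulVec continuous_const).tendsto G).comp hSG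
      -- Cleared of denominators, `X'GX = 0` is exactly the equality excluded by `hmix`.
      · have h1 : X ⬝ᵥ (G *ᵥ X) = X ⬝ᵥ (D⁻¹ *ᵥ X) -
            d⁻¹ * ((1 ⬝ᵥ (D⁻¹ *ᵥ X)) * (X ⬝ᵥ (D⁻¹ *ᵥ 1))) := by
          rw [hG, ← mulVec_mulVec, sub_mulVec, one_mulVec, vecMulVec_mulVec, op_smul_eq_smul,
            dotProduct_sub, dotProduct_smul, hz, dotProduct_smul, smul_eq_mul, smul_eq_mul]
          ring
        rw [h1]
        intro h0
        apply hmix hX1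
        field_simp at h0 ⊢
        linarith
  have hform : Tendsto (fun t => ν t ^ meanExponent X * (X ⬝ᵥ ((S t)⁻¹ *ᵥ X))) l
      (𝓝 (X ⬝ᵥ w)) := by
    have := ((Continuous.dotProduct (continuous_const (y := X)) continuous_id).tendsto w).comp hw
    refine this.congr fun t => ?_
    simp
  have hform0 : ∀ᶠ t in l, 0 < ν t ^ meanExponent X * (X ⬝ᵥ ((S t)⁻¹ *ᵥ X)) := by
    filter_upwards [hν, hS] with t h1 h2
    exact mul_pos (pow_pos h1 _) (posDef_pos h2.inv hX0)
  obtain ⟨K2, hK2, hform_ge⟩ := exists_eventually_one_le_mul hform hXw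
    (hform0.mono fun _ h => h.le)
  have hform_le := eventually_abs_le_of_tendsto hform
  -- the quadratic form
  obtain ⟨K4, hK4, hEle⟩ := exists_eventually_matrix_le hE
  -- the derivative
  obtain ⟨K5, hK5, hder⟩ : ∃ K, 0 ≤ K ∧ ∀ᶠ t in l, ∀ i j, |(E' t * (ν t • (S t)⁻¹)) i j| ≤ K := by
    exact exists_eventually_matrix_le (hE'.mul hSG)
  -- the projection
  obtain ⟨K6, hK6, hproj⟩ : ∃ K, 0 ≤ K ∧ ∀ᶠ t in l, ∀ i j, |glsProj X (S t) i j| ≤ K := by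
    -- The same power of `ν` normalizes the scalar and the vector, and cancels in the projection,
    -- which therefore converges.
    have h1 : Tendsto (fun t => (ν t ^ meanExponent X * (X ⬝ᵥ ((S t)⁻¹ *ᵥ X)))⁻¹ •
        vecMulVec X (ν t ^ meanExponent X • ((S t)⁻¹ *ᵥ X))) l
        (𝓝 ((X ⬝ᵥ w)⁻¹ • vecMulVec X w)) := by
      refine (hform.inv₀ hXw).smul ?_
      have hc : Continuous fun q : Fin m → ℝ => vecMulVec X q :=
        continuous_const.matrix_vecMulVec continuous_id
      exact (hc.tendsto w).comp hw
    obtain ⟨K, hK, h2⟩ := exists_eventually_matrix_le h1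
    refine ⟨K, hK, ?_⟩
    filter_upwards [h2, hS, hν] with t h2 h3 h4 i j
    convert! h2 i j using 2
    rw [glsProj_apply X h3, Matrix.smul_apply, vecMulVec_apply, Pi.smul_apply, smul_eq_mul, smul_eq_mul]
    have := (pow_pos h4 (meanExponent X)).ne'
    field_simp
  refine ⟨1 + K1 + K2 + (|X ⬝ᵥ w| + 1) + K4 + K5 + K6, by positivity, ?_⟩
  have hXw0 := abs_nonneg (X ⬝ᵥ w)
  filter_upwards [hS, hS1, hSE, hSE', hν, hν0.eventually_le_const one_pos, hdet, hform_ge,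
    hform_le, hform0, hEle, hder, hproj] with t hS hS1 hSE hSE' hν hν1 hdet hform_ge hform_le
    hform0 hEle hder hproj
  refine ⟨hν, by linarith, by positivity, ?_, ?_, ?_, fun v => ?_, fun v hv => ?_, ?_, ?_⟩
  · exact hdet.trans (mul_le_mul_of_nonneg_right (by linarith) hS.det_pos.le)
  · exact hform_ge.trans (mul_le_mul_of_nonneg_right (by linarith) hform0.le)
  · linarith [le_abs_self (ν t ^ meanExponent X * (X ⬝ᵥ ((S t)⁻¹ *ᵥ X)))]
  · have h1 : v ⬝ᵥ (S t *ᵥ v) ≤ (∑ i, |v i|) ^ 2 := by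
      refine (le_abs_self _).trans ((abs_form_le hS1).trans_eq ?_)
      ring
    exact h1.trans (le_mul_of_one_le_left (sq_nonneg _) (by linarith))
  · have h1 : v ⬝ᵥ (S t *ᵥ v) = ν t * (v ⬝ᵥ (E t *ᵥ v)) := by
      rw [hSE, add_mulVec, dotProduct_add, vecMulVec_mulVec, op_smul_eq_smul, dotProduct_smul,
        hv, smul_zero, zero_add, smul_mulVec, dotProduct_smul, smul_eq_mul]
    have h2 : v ⬝ᵥ (E t *ᵥ v) ≤ K4 * (∑ i, |v i|) ^ 2 := by
      refine (le_abs_self _).trans ((abs_form_le hEle).trans_eq ?_)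
      ring
    rw [h1]
    calc ν t * (v ⬝ᵥ (E t *ᵥ v)) ≤ ν t * (K4 * (∑ i, |v i|) ^ 2) :=
          mul_le_mul_of_nonneg_left h2 hν.le
      _ = K4 * ν t * (∑ i, |v i|) ^ 2 := by ring
      _ ≤ _ := by
        gcongr
        linarith
  · intro i j
    -- The factor `ν'/ν` carries all the growth; the matrix beside it converges to `D G`.
    have h1 : (S' t * (S t)⁻¹) = (ν' t / ν t) • (E' t * (ν t • (S t)⁻¹)) := by
      rw [hSE', Matrix.mul_smul, smul_smul, div_mul_cancel₀ _ hν.ne', Matrix.smul_mul]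
    rw [h1, Matrix.smul_apply, smul_eq_mul, abs_mul, abs_div, abs_of_pos hν, mul_comm]
    refine mul_le_mul_of_nonneg_right ((hder i j).trans (by linarith)) (by positivity)
  · intro i j
    exact (hproj i j).trans (by linarith)

/-! ### Correlation matrices of a factor -/

section factor

variable {p m : ℕ} {ρ0 : ℝ → ℝ} {x : Fin m → EuclideanSpace ℝ (Fin p)}

theorem factorCorr_diag (h0 : ρ0 0 = 1) (t : ℝ) (i : Fin m) : factorCorr ρ0 x t i i = 1 := by
  simp [factorCorr, h0]

theorem factorCorrDeriv_diag (t : ℝ) (i : Fin m) : factorCorrDeriv ρ0 x t i i = 0 := by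
  simp [factorCorrDeriv, factorCorr]

theorem factorCorr_symm (t : ℝ) (i j : Fin m) :
    factorCorr ρ0 x t i j = factorCorr ρ0 x t j i := by
  simp [factorCorr, dist_comm]

theorem factorCorr_transpose (t : ℝ) : (factorCorr ρ0 x t)ᵀ = factorCorr ρ0 x t := by
  ext i j
  rw [transpose_apply, factorCorr_symm]

theorem factorCorrDeriv_transpose (t : ℝ) :
    (factorCorrDeriv ρ0 x t)ᵀ = factorCorrDeriv ρ0 x t := by
  ext i j
  simp only [transpose_apply, factorCorrDeriv, of_apply, factorCorr_symm _ i j]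

theorem measurable_factorCorrDeriv (i j : Fin m) :
    Measurable fun t => factorCorrDeriv ρ0 x t i j :=
  measurable_deriv _

/-- Evaluate the form at `e_i + e_j` and `e_i - e_j`. -/
theorem abs_le_one_of_posDef {ι : Type*} [Fintype ι] [DecidableEq ι] {S : Matrix ι ι ℝ}
    (hS : S.PosDef) (hd : ∀ i, S i i = 1) (i j : ι) : |S i j| ≤ 1 := by
  have hsymm : S j i = S i j := congrFun (congrFun (posDef_transpose hS) i) j
  have h1 := posDef_nonneg hS (Pi.single i 1 + Pi.single j 1)
  have h2 := posDef_nonneg hS (Pi.single i 1 - Pi.single j 1)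
  simp only [mulVec_add, mulVec_sub, dotProduct_add, add_dotProduct, dotProduct_sub,
    sub_dotProduct, mulVec_single_one, single_one_dotProduct, col_apply, hd, hsymm] at h1 h2
  rw [abs_le]
  constructor <;> linarith

/-- The limit controls a neighbourhood of infinity, and compactness the remaining interval. -/
theorem exists_one_le_mul_of_tendsto {f : ℝ → ℝ} {δ L : ℝ} (hc : ContinuousOn f (Ici δ))
    (hpos : ∀ t, δ ≤ t → 0 < f t) (hlim : Tendsto f atTop (𝓝 L)) (hL : 0 < L) :
    ∃ K, 0 ≤ K ∧ ∀ t, δ ≤ t → 1 ≤ K * f t := by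
  obtain ⟨K, hK, h⟩ := exists_eventually_one_le_mul hlim hL.ne'
    ((eventually_ge_atTop δ).mono fun t ht => (hpos t ht).le)
  obtain ⟨T, hT⟩ := eventually_atTop.1 h
  obtain ⟨t0, ht0, hmin⟩ := isCompact_Icc.exists_isMinOn (nonempty_Icc.2 (le_max_left δ T))
    (hc.mono Icc_subset_Ici_self)
  have hf0 := hpos t0 ht0.1
  refine ⟨max K (f t0)⁻¹, le_max_of_le_left hK, fun t ht => ?_⟩
  rcases le_total t (max δ T) with h1 | h1
  · calc (1 : ℝ) = (f t0)⁻¹ * f t0 := (inv_mul_cancel₀ hf0.ne').symm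
      _ ≤ (f t0)⁻¹ * f t := mul_le_mul_of_nonneg_left (hmin ⟨ht, h1⟩) (by positivity)
      _ ≤ _ := mul_le_mul_of_nonneg_right (le_max_right _ _) (hpos t ht).le
  · exact (hT t ((le_max_right _ _).trans h1)).trans
      (mul_le_mul_of_nonneg_right (le_max_left _ _) (hpos t ht).le)

theorem continuousOn_factorCorr (hdiff : DifferentiableOn ℝ ρ0 (Ioi 0)) :
    ContinuousOn (factorCorr ρ0 x) (Ioi 0) := by
  refine continuousOn_pi.2 fun i => continuousOn_pi.2 fun j => ?_
  simp only [factorCorr, of_apply]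
  rcases eq_or_lt_of_le (dist_nonneg (x := x i) (y := x j)) with h | h
  · simp only [← h, zero_mul]
    exact continuousOn_const
  · exact hdiff.continuousOn.comp (by fun_prop) fun t ht => mul_pos h ht

theorem tendsto_factorCorr_atTop (h0 : ρ0 0 = 1) (hlim : Tendsto ρ0 atTop (𝓝 0))
    (hx : Function.Injective x) : Tendsto (factorCorr ρ0 x) atTop (𝓝 1) := by
  refine tendsto_pi_nhds.2 fun i => tendsto_pi_nhds.2 fun j => ?_
  by_cases hij : i = j
  · subst hij
    simp only [factorCorr_diag h0, one_apply_eq]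
    exact tendsto_const_nhds
  · rw [one_apply_ne hij]
    have hd : 0 < dist (x i) (x j) := dist_pos.2 (hx.ne hij)
    exact hlim.comp (tendsto_id.const_mul_atTop hd)

theorem exists_one_le_mul_det_factorCorr (h0 : ρ0 0 = 1) (hlim : Tendsto ρ0 atTop (𝓝 0))
    (hdiff : DifferentiableOn ℝ ρ0 (Ioi 0)) (hx : Function.Injective x)
    (hpd : ∀ t : ℝ, 0 < t → (factorCorr ρ0 x t).PosDef) {δ : ℝ} (hδ : 0 < δ) :
    ∃ K, 0 ≤ K ∧ ∀ t, δ ≤ t → 1 ≤ K * (factorCorr ρ0 x t).det := by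
  have hc : Continuous fun M : Matrix (Fin m) (Fin m) ℝ => M.det := continuous_id.matrix_det
  refine exists_one_le_mul_of_tendsto (L := 1)
    (hc.comp_continuousOn ((continuousOn_factorCorr hdiff).mono fun t ht => hδ.trans_le ht))
    (fun t ht => (hpd t (hδ.trans_le ht)).det_pos) ?_ one_pos
  rw [← det_one (n := Fin m) (R := ℝ)]
  exact (hc.tendsto (1 : Matrix (Fin m) (Fin m) ℝ)).comp (tendsto_factorCorr_atTop h0 hlim hx)

/-- By symmetry the trace of the square is the sum of the squared entries. -/
theorem abs_factorCorrDeriv_le (t : ℝ) (i j : Fin m) :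
    |factorCorrDeriv ρ0 x t i j| ≤
      √(factorCorrDeriv ρ0 x t * factorCorrDeriv ρ0 x t).trace := by
  have hsymm : ∀ a b, factorCorrDeriv ρ0 x t b a = factorCorrDeriv ρ0 x t a b := fun a b => by
    conv_rhs => rw [← factorCorrDeriv_transpose, transpose_apply]
  apply Real.abs_le_sqrt
  have h1 : ∀ a b, factorCorrDeriv ρ0 x t a b * factorCorrDeriv ρ0 x t b a =
      factorCorrDeriv ρ0 x t a b ^ 2 := fun a b => by rw [hsymm a b, sq]
  simp only [trace, diag_apply, mul_apply, h1]
  exact (Finset.single_le_sum (f := fun b => factorCorrDeriv ρ0 x t i b ^ 2)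
    (fun b _ => sq_nonneg _) (Finset.mem_univ j)).trans
    (Finset.single_le_sum (f := fun a => ∑ b, factorCorrDeriv ρ0 x t a b ^ 2)
      (fun a _ => Finset.sum_nonneg fun b _ => sq_nonneg _) (Finset.mem_univ i))

theorem integrableOn_sum_abs_factorCorrDeriv {T : Set ℝ} {g : ℝ → ℝ} (hT : MeasurableSet T)
    (hg : IntegrableOn g T) (hle : ∀ t ∈ T, ∀ i j, |factorCorrDeriv ρ0 x t i j| ≤ g t) :
    IntegrableOn (fun t => ∑ i, ∑ j, |factorCorrDeriv ρ0 x t i j|) T := by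
  refine integrable_finsetSum _ fun i _ => integrable_finsetSum _ fun j _ => ?_
  refine Integrable.mono' hg (measurable_factorCorrDeriv i j).abs.aestronglyMeasurable ?_
  refine (ae_restrict_iff' hT).2 (Eventually.of_forall fun t ht => ?_)
  rw [Real.norm_eq_abs, abs_abs]
  exact hle t ht i j

/-- Bounds for a factor away from the origin. -/
theorem exists_factorBound_Ioi (h0 : ρ0 0 = 1) (hlim : Tendsto ρ0 atTop (𝓝 0))
    (hdiff : DifferentiableOn ℝ ρ0 (Ioi 0)) (hx : Function.Injective x)
    (hpd : ∀ t : ℝ, 0 < t → (factorCorr ρ0 x t).PosDef) {X : Fin m → ℝ} (hX : X ≠ 0)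
    {δ : ℝ} (hδ : 0 < δ) (hint : IntegrableOn
      (fun t => √(factorCorrDeriv ρ0 x t * factorCorrDeriv ρ0 x t).trace) (Ioi δ)) :
    ∃ (μ h : ℝ → ℝ) (K : ℝ), (∀ t ∈ Ioi δ,
        FactorBound (factorCorr ρ0 x t) (factorCorrDeriv ρ0 x t) X (μ t) (h t) K) ∧
      ∀ s : ℝ, 0 < s → IntegrableOn (fun t => h t * μ t ^ s) (Ioi δ) := by
  obtain ⟨K0, hK0, hdet⟩ := exists_one_le_mul_det_factorCorr h0 hlim hdiff hx hpd hδ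
  obtain ⟨K, hK, hbound⟩ := exists_factorBound_of_det hX K0 hK0
  refine ⟨fun _ => 1, fun t => K * ∑ i, ∑ j, |factorCorrDeriv ρ0 x t i j|, K, fun t ht => ?_,
    fun s _ => ?_⟩
  · have hpdt := hpd t (hδ.trans ht)
    exact hbound _ _ hpdt (abs_le_one_of_posDef hpdt (factorCorr_diag h0 t)) (hdet t (le_of_lt ht))
  · simp only [Real.one_rpow, mul_one]
    exact (integrableOn_sum_abs_factorCorrDeriv measurableSet_Ioi hint
      fun t _ => abs_factorCorrDeriv_le t).const_mul K

end factor

/-! ### Functions with nonvanishing derivative near the origin -/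

theorem exists_Ioc_of_eventually {P : ℝ → Prop} (h : ∀ᶠ t in 𝓝[>] (0 : ℝ), P t) :
    ∃ δ, 0 < δ ∧ ∀ t ∈ Ioc 0 δ, P t :=
  mem_nhdsGT_iff_exists_Ioc_subset.1 h

/-- A derivative of constant sign is integrable when its primitive has a finite limit at the
endpoint. -/
theorem integrableOn_deriv_Ioc {g g' : ℝ → ℝ} {δ L : ℝ} (hδ : 0 < δ)
    (hg : ∀ t ∈ Ioc 0 δ, HasDerivAt g (g' t) t) (hL : Tendsto g (𝓝[>] 0) (𝓝 L))
    (hs : (∀ t ∈ Ioc 0 δ, g' t ≤ 0) ∨ ∀ t ∈ Ioc 0 δ, 0 ≤ g' t) : IntegrableOn g' (Ioc 0 δ) := by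
  wlog hpos : ∀ t ∈ Ioc 0 δ, 0 ≤ g' t generalizing g g' L
  · have hneg := hs.resolve_right hpos
    have := this (g := -g) (g' := -g') (fun t ht => (hg t ht).neg) hL.neg
      (Or.inr fun t ht => neg_nonneg.2 (hneg t ht)) (fun t ht => neg_nonneg.2 (hneg t ht))
    have h2 := this.neg
    rwa [neg_neg] at h2
  -- Redefining `g` at `0` as its limit makes it continuous on the closed interval.
  refine intervalIntegral.integrableOn_deriv_of_nonneg (g := Function.update g 0 L) ?_ ?_
    fun t ht => hpos t (Ioo_subset_Ioc_self ht)
  · rw [continuousOn_update_iff, Icc_sdiff_left]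
    refine ⟨fun t ht => (hg t ht).continuousAt.continuousWithinAt, fun _ => ?_⟩
    rwa [nhdsWithin_Ioc_eq_nhdsGT hδ]
  · intro t ht
    refine (hg t (Ioo_subset_Ioc_self ht)).congr_of_eventuallyEq ?_
    filter_upwards [eventually_ne_nhds ht.1.ne'] with u hu
    exact Function.update_of_ne hu _ _

/-- A derivative has the intermediate value property, so `ν'` has constant sign and `ν` is monotone;
with `0 < ν ≤ B` the limit exists whichever the sign. -/
theorem exists_limit_and_integrableOn {ν : ℝ → ℝ} {B : ℝ} (hpos : ∀ᶠ t in 𝓝[>] (0 : ℝ), 0 < ν t)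
    (hd : ∀ᶠ t in 𝓝[>] (0 : ℝ), DifferentiableAt ℝ ν t)
    (hne : ∀ᶠ t in 𝓝[>] (0 : ℝ), deriv ν t ≠ 0) (hB : ∀ᶠ t in 𝓝[>] (0 : ℝ), ν t ≤ B) :
    ∃ L, 0 ≤ L ∧ Tendsto ν (𝓝[>] 0) (𝓝 L) ∧ ∃ δ, 0 < δ ∧ IntegrableOn (deriv ν) (Ioc 0 δ) ∧
      ∀ s : ℝ, 0 < s → IntegrableOn (fun t => |deriv ν t| / ν t * ν t ^ s) (Ioc 0 δ) := by
  obtain ⟨δ, hδ, h⟩ := exists_Ioc_of_eventually (hpos.and (hd.and (hne.and hB)))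
  have hder : ∀ t ∈ Ioc 0 δ, HasDerivAt ν (deriv ν t) t := fun t ht => (h t ht).2.1.hasDerivAt
  have hsign := hasDerivWithinAt_forall_lt_or_forall_gt_of_forall_ne (convex_Ioc 0 δ)
    (fun t ht => (hder t ht).hasDerivWithinAt) fun t ht => (h t ht).2.2.1
  have hsub : Ioo 0 δ ⊆ Ioc 0 δ := Ioo_subset_Ioc_self
  have hcont : ContinuousOn ν (Ioo 0 δ) := fun t ht =>
    (hder t (hsub ht)).continuousAt.continuousWithinAt
  obtain ⟨L, hL⟩ : ∃ L, Tendsto ν (𝓝[>] 0) (𝓝 L) := by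
    rcases hsign with hs | hs
    · refine ⟨_, AntitoneOn.tendsto_nhdsWithin_Ioo_right (nonempty_Ioo.2 hδ)
        (antitoneOn_of_deriv_nonpos (convex_Ioo 0 δ) hcont ?_ ?_) ?_⟩
      · rw [interior_Ioo]
        exact fun t ht => (hder t (hsub ht)).differentiableAt.differentiableWithinAt
      · rw [interior_Ioo]
        exact fun t ht => (hs t (hsub ht)).le
      · exact ⟨B, by rintro _ ⟨t, ht, rfl⟩; exact (h t (hsub ht)).2.2.2⟩
    · refine ⟨_, MonotoneOn.tendsto_nhdsWithin_Ioo_right (nonempty_Ioo.2 hδ)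
        (monotoneOn_of_deriv_nonneg (convex_Ioo 0 δ) hcont ?_ ?_) ?_⟩
      · rw [interior_Ioo]
        exact fun t ht => (hder t (hsub ht)).differentiableAt.differentiableWithinAt
      · rw [interior_Ioo]
        exact fun t ht => (hs t (hsub ht)).le
      · exact ⟨0, by rintro _ ⟨t, ht, rfl⟩; exact (h t (hsub ht)).1.le⟩
  have hsign' : (∀ t ∈ Ioc 0 δ, deriv ν t ≤ 0) ∨ ∀ t ∈ Ioc 0 δ, 0 ≤ deriv ν t :=
    hsign.imp (fun hs t ht => (hs t ht).le) fun hs t ht => (hs t ht).le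
  refine ⟨L, ge_of_tendsto hL (hpos.mono fun _ h => h.le), hL, δ, hδ,
    integrableOn_deriv_Ioc hδ hder hL hsign', fun s hs => ?_⟩
  -- The derivative of `ν^s`, which still has a limit at the origin when `L = 0` because `s > 0`.
  -- Its absolute value is `s` times the required integrand.
  have hint : IntegrableOn (fun t => deriv ν t * s * ν t ^ (s - 1)) (Ioc 0 δ) := by
    refine integrableOn_deriv_Ioc (g := fun t => ν t ^ s) hδ
      (fun t ht => (hder t ht).rpow_const (Or.inl (h t ht).1.ne'))
      ((Real.continuousAt_rpow_const L s (Or.inr hs.le)).tendsto.comp hL) ?_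
    refine hsign'.imp (fun hs' t ht => ?_) fun hs' t ht => ?_
    · have := Real.rpow_pos_of_pos (h t ht).1 (s - 1)
      exact mul_nonpos_of_nonpos_of_nonneg
        (mul_nonpos_of_nonpos_of_nonneg (hs' t ht) hs.le) this.le
    · have := Real.rpow_pos_of_pos (h t ht).1 (s - 1)
      have := hs' t ht
      positivity
  refine IntegrableOn.congr_fun (hint.norm.const_mul s⁻¹) (fun t ht => ?_) measurableSet_Ioc
  have hν := (h t ht).1
  simp only [norm_mul, Real.norm_eq_abs, abs_of_pos hs]
  rw [abs_of_pos (Real.rpow_pos_of_pos hν _), Real.rpow_sub_one hν.ne']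
  field_simp

/-! ### Correlation matrices near the origin -/

/-- The limit at the origin of an isotropic correlation function is nonnegative. -/
theorem limit_nonneg_of_isIsotropicCorrelation {p : ℕ} {ρ0 : ℝ → ℝ}
    (hcorr : IsIsotropicCorrelation p ρ0) {e : EuclideanSpace ℝ (Fin p)} (he : e ≠ 0) {c : ℝ}
    (hc : Tendsto ρ0 (𝓝[>] 0) (𝓝 c)) : 0 ≤ c := by
  -- Take `q + 1` equally spaced points on a line and shrink them to the origin: the sum of the
  -- entries of their correlation matrix tends to `(q + 1)(1 + q c)`. Nonnegativity for all `q`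
  -- forces `c ≥ 0`.
  have hq : ∀ q : ℕ, 0 ≤ 1 + q * c := by
    intro q
    let z : ℝ → Fin (q + 1) → EuclideanSpace ℝ (Fin p) := fun t i => (t * (i : ℝ)) • e
    have hz : ∀ t : ℝ, 0 ≤ ∑ i, ∑ j, ρ0 (dist (z t i) (z t j)) := by
      intro t
      have := (hcorr.2 (q + 1) (z t)).dotProduct_mulVec_nonneg 1
      simpa [dotProduct, mulVec] using this
    have hlim : Tendsto (fun t => ∑ i, ∑ j, ρ0 (dist (z t i) (z t j))) (𝓝[>] 0)
        (𝓝 (∑ i : Fin (q + 1), ∑ j : Fin (q + 1), (c + if i = j then 1 - c else 0))) := by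
      refine tendsto_finsetSum _ fun i _ => tendsto_finsetSum _ fun j _ => ?_
      by_cases hij : i = j
      · subst hij
        simp [hcorr.1]
      · rw [if_neg hij, add_zero]
        have hij' : (i : ℝ) - j ≠ 0 := by
          rw [sub_ne_zero]
          exact_mod_cast fun h => hij (Fin.ext h)
        have hpos : 0 < |(i : ℝ) - j| * ‖e‖ := mul_pos (abs_pos.2 hij') (norm_pos_iff.2 he)
        refine hc.comp (tendsto_nhdsWithin_iff.2 ⟨?_, ?_⟩)
        · have h0 : Tendsto (fun t : ℝ => dist (z t i) (z t j)) (𝓝 0)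
              (𝓝 (dist (z 0 i) (z 0 j))) := by
            have : Continuous fun t : ℝ => dist (z t i) (z t j) := by
              simp only [z]
              fun_prop
            exact this.tendsto 0
          have h1 : dist (z 0 i) (z 0 j) = 0 := by simp [z]
          rw [h1] at h0
          exact h0.mono_left nhdsWithin_le_nhds
        · filter_upwards [self_mem_nhdsWithin] with t ht
          have ht' : (0 : ℝ) < t := ht
          have : z t i - z t j = (t * ((i : ℝ) - j)) • e := by
            simp only [z, ← sub_smul, mul_sub]
          rw [mem_Ioi, dist_eq_norm, this, norm_smul, Real.norm_eq_abs, abs_mul, mul_assoc]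
          exact mul_pos (abs_pos.2 ht'.ne') hpos
    have h2 := ge_of_tendsto' hlim hz
    have h3 : ∑ i : Fin (q + 1), ∑ j : Fin (q + 1), (c + if i = j then 1 - c else 0) =
        ((q : ℝ) + 1) * (1 + q * c) := by
      simp [Finset.sum_add_distrib]
      ring
    rw [h3] at h2
    exact nonneg_of_mul_nonneg_right h2 (by positivity)
  by_contra! hneg
  obtain ⟨q, hq'⟩ := exists_nat_gt (1 / -c)
  rw [div_lt_iff₀ (by linarith)] at hq'
  have := hq q
  linarith

section expansion

variable {r : ℕ} {p n : Fin r → ℕ} {ρ0 : ℝ → ℝ}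
  {s : ∀ k, Fin (n k) → EuclideanSpace ℝ (Fin (p k))} {X : ∀ k, Fin (n k) → ℝ}
  {ν ω : ℝ → ℝ} {D Dstar : ∀ k, Matrix (Fin (n k)) (Fin (n k)) ℝ}
  {R : ∀ k, ℝ → Matrix (Fin (n k)) (Fin (n k)) ℝ}

theorem SmallRangeExpansion.exists_eq_rankOne_add
    (hexp : SmallRangeExpansion ρ0 s X ν ω D Dstar R) (k : Fin r) :
    ∃ E : ℝ → Matrix (Fin (n k)) (Fin (n k)) ℝ, Tendsto E (𝓝[>] 0) (𝓝 (D k)) ∧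
      ∀ᶠ t in 𝓝[>] (0 : ℝ), factorCorr ρ0 (s k) t = vecMulVec 1 1 + ν t • E t := by
  refine ⟨fun t => Matrix.of fun i j => D k i j + ω t / ν t * Dstar k i j + R k t i j / ν t,
    tendsto_pi_nhds.2 fun i => tendsto_pi_nhds.2 fun j => ?_, ?_⟩
  · simpa using ((tendsto_const_nhds (x := D k i j)).add
      (hexp.omega_small.mul_const (Dstar k i j))).add (hexp.rem_small k i j)
  · have h : ∀ᶠ t in 𝓝[>] (0 : ℝ), ∀ i j,
        factorCorr ρ0 (s k) t i j = 1 + ν t * D k i j + ω t * Dstar k i j + R k t i j := by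
      simp only [eventually_all]
      exact hexp.expansion k
    filter_upwards [h, hexp.nu_pos] with t ht hν
    ext i j
    rw [ht]
    simp only [Matrix.add_apply, vecMulVec_apply, Matrix.smul_apply, of_apply, Pi.one_apply,
      smul_eq_mul]
    field_simp
    ring

theorem SmallRangeExpansion.exists_deriv_eq
    (hexp : SmallRangeExpansion ρ0 s X ν ω D Dstar R) (k : Fin r) :
    ∃ E : ℝ → Matrix (Fin (n k)) (Fin (n k)) ℝ, Tendsto E (𝓝[>] 0) (𝓝 (D k)) ∧
      ∀ᶠ t in 𝓝[>] (0 : ℝ), factorCorrDeriv ρ0 (s k) t = deriv ν t • E t := by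
  refine ⟨fun t => Matrix.of fun i j => D k i j + deriv ω t / deriv ν t * Dstar k i j +
    deriv (fun u => R k u i j) t / deriv ν t,
    tendsto_pi_nhds.2 fun i => tendsto_pi_nhds.2 fun j => ?_, ?_⟩
  · simpa using ((tendsto_const_nhds (x := D k i j)).add
      (hexp.deriv_omega_small.mul_const (Dstar k i j))).add (hexp.deriv_rem_small k i j)
  · have h : ∀ᶠ t in 𝓝[>] (0 : ℝ), ∀ i j, factorCorrDeriv ρ0 (s k) t i j =
        deriv ν t * D k i j + deriv ω t * Dstar k i j + deriv (fun u => R k u i j) t := by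
      simp only [eventually_all]
      exact hexp.expansion_deriv k
    filter_upwards [h, hexp.deriv_nu_ne_zero] with t ht hν
    ext i j
    rw [ht]
    simp only [Matrix.smul_apply, of_apply, smul_eq_mul]
    field_simp

theorem SmallRangeExpansion.mean_ne_zero
    (hexp : SmallRangeExpansion ρ0 s X ν ω D Dstar R) (k : Fin r) : X k ≠ 0 := by
  intro h
  have := hexp.mean_form_ne_zero k
  simp [h] at this

theorem exists_entry_ne_zero {m : ℕ} (hm : 2 ≤ m) {M : Matrix (Fin m) (Fin m) ℝ}
    (hM : M.det ≠ 0) : ∃ i j, M i j ≠ 0 := by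
  by_contra! h
  have : M = 0 := Matrix.ext h
  rw [this] at hM
  have : Nonempty (Fin m) := ⟨⟨0, by omega⟩⟩
  exact hM det_zero

/-- The derivative is `ν'` times a matrix converging to `D k`, which has a nonzero entry. This
supplies the set on which the priors are positive. -/
theorem SmallRangeExpansion.eventually_deriv_ne_zero (hn : ∀ k, 2 ≤ n k)
    (hexp : SmallRangeExpansion ρ0 s X ν ω D Dstar R) (k : Fin r) :
    ∀ᶠ t in 𝓝[>] (0 : ℝ), factorCorrDeriv ρ0 (s k) t ≠ 0 := by
  obtain ⟨E, hE, h⟩ := hexp.exists_deriv_eq k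
  obtain ⟨i, j, hij⟩ := exists_entry_ne_zero (hn k) (hexp.det_ne_zero k)
  filter_upwards [h, hexp.deriv_nu_ne_zero,
    (tendsto_pi_nhds.1 (tendsto_pi_nhds.1 hE i) j).eventually_ne hij] with t h1 h2 h3 h4
  rw [h1] at h4
  exact mul_ne_zero h2 h3 (congrFun (congrFun h4 i) j)

/-- At a nonzero entry of `D k` the product `ν E` is a correlation minus one, hence at most two in
absolute value, while `|E|` is bounded below. -/
theorem SmallRangeExpansion.exists_nu_le (hn : ∀ k, 2 ≤ n k)
    (hcorr : ∀ k, IsIsotropicCorrelation (p k) ρ0)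
    (hpd : ∀ k, ∀ t : ℝ, 0 < t → (factorCorr ρ0 (s k) t).PosDef)
    (hexp : SmallRangeExpansion ρ0 s X ν ω D Dstar R) (k : Fin r) :
    ∃ B, ∀ᶠ t in 𝓝[>] (0 : ℝ), ν t ≤ B := by
  obtain ⟨E, hE, h⟩ := hexp.exists_eq_rankOne_add k
  obtain ⟨i, j, hij⟩ := exists_entry_ne_zero (hn k) (hexp.det_ne_zero k)
  have hEij := tendsto_pi_nhds.1 (tendsto_pi_nhds.1 hE i) j
  obtain ⟨K, hK, hKE⟩ := exists_eventually_one_le_mul hEij.abs (abs_ne_zero.2 hij)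
    (Eventually.of_forall fun t => abs_nonneg _)
  refine ⟨K * 2, ?_⟩
  filter_upwards [h, hKE, hexp.nu_pos, self_mem_nhdsWithin] with t h1 h2 h3 h4
  have h5 := abs_le_one_of_posDef (hpd k t h4) (factorCorr_diag (hcorr k).1 t) i j
  have h6 : factorCorr ρ0 (s k) t i j = 1 + ν t * E t i j := by
    rw [h1]
    simp
  have h7 : ν t * |E t i j| ≤ 2 := by
    rw [← abs_of_pos h3, ← abs_mul, show ν t * E t i j = factorCorr ρ0 (s k) t i j - 1 by
      rw [h6]; ring]
    have := abs_le.1 h5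
    rw [abs_le]
    constructor <;> linarith
  calc ν t = ν t * 1 := (mul_one _).symm
    _ ≤ ν t * (K * |E t i j|) := mul_le_mul_of_nonneg_left h2 h3.le
    _ = K * (ν t * |E t i j|) := by ring
    _ ≤ K * 2 := mul_le_mul_of_nonneg_left h7 hK

/-- When `ν` does not vanish at the origin, the correlation matrix stays nonsingular there. -/
theorem SmallRangeExpansion.exists_eventually_one_le_mul_det (hn : ∀ k, 2 ≤ n k)
    (hcorr : ∀ k, IsIsotropicCorrelation (p k) ρ0) (hs : ∀ k, Function.Injective (s k))
    (hpd : ∀ k, ∀ t : ℝ, 0 < t → (factorCorr ρ0 (s k) t).PosDef)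
    (hexp : SmallRangeExpansion ρ0 s X ν ω D Dstar R) (k : Fin r) {L : ℝ} (hL : 0 < L)
    (hν : Tendsto ν (𝓝[>] 0) (𝓝 L)) :
    ∃ K, 0 ≤ K ∧ ∀ᶠ t in 𝓝[>] (0 : ℝ), 1 ≤ K * (factorCorr ρ0 (s k) t).det := by
  obtain ⟨E, hE, h⟩ := hexp.exists_eq_rankOne_add k
  have hlim : Tendsto (factorCorr ρ0 (s k)) (𝓝[>] 0) (𝓝 (vecMulVec 1 1 + L • D k)) :=
    (tendsto_const_nhds.add (hν.smul hE)).congr' (h.mono fun t ht => ht.symm)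
  set S0 : Matrix (Fin (n k)) (Fin (n k)) ℝ := vecMulVec 1 1 + L • D k with hS0
  have hentry : ∀ i j, S0 i j = 1 + L * D k i j := fun i j => by
    simp [hS0]
  have hlim' : ∀ i j, Tendsto (fun t => factorCorr ρ0 (s k) t i j) (𝓝[>] 0) (𝓝 (S0 i j)) :=
    fun i j => tendsto_pi_nhds.1 (tendsto_pi_nhds.1 hlim i) j
  have hdiag : ∀ i, S0 i i = 1 := by
    intro i
    refine tendsto_nhds_unique (hlim' i i) ?_
    simp only [factorCorr_diag (hcorr k).1]
    exact tendsto_const_nhds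
  -- Rescaling by the distance shows that every off-diagonal limit is the one-sided limit of `ρ0` at
  -- the origin, hence all are equal.
  have hρ : ∀ i j, i ≠ j → Tendsto ρ0 (𝓝[>] 0) (𝓝 (S0 i j)) := by
    intro i j hij
    have hd : 0 < dist (s k i) (s k j) := dist_pos.2 ((hs k).ne hij)
    have hdiv : Tendsto (fun u => u / dist (s k i) (s k j)) (𝓝[>] 0) (𝓝[>] 0) := by
      refine tendsto_nhdsWithin_iff.2 ⟨?_, ?_⟩
      · have : Tendsto (fun u : ℝ => u / dist (s k i) (s k j)) (𝓝 0)
            (𝓝 (0 / dist (s k i) (s k j))) := (continuous_id.div_const _).tendsto 0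
        rw [zero_div] at this
        exact this.mono_left nhdsWithin_le_nhds
      · filter_upwards [self_mem_nhdsWithin] with u hu
        exact div_pos hu hd
    refine ((hlim' i j).comp hdiv).congr fun u => ?_
    simp only [factorCorr, of_apply, Function.comp_apply]
    rw [mul_div_cancel₀ _ hd.ne']
  obtain ⟨i0, j0, hij0⟩ := exists_entry_ne_zero (hn k) (hexp.det_ne_zero k)
  set c := S0 i0 j0 with hcdef
  have hne : i0 ≠ j0 := by
    rintro rfl
    have := hentry i0 i0
    rw [hdiag i0] at this
    have : L * D k i0 i0 = 0 := by linarith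
    exact mul_ne_zero hL.ne' hij0 this
  have hc1 : c ≠ 1 := by
    rw [hcdef, hentry]
    have := mul_ne_zero hL.ne' hij0
    intro h0
    apply this
    linarith
  have hc_le : c ≤ 1 := by
    refine le_of_tendsto (hlim' i0 j0) ?_
    filter_upwards [self_mem_nhdsWithin] with t ht
    exact (abs_le.1 (abs_le_one_of_posDef (hpd k t ht) (factorCorr_diag (hcorr k).1 t) i0 j0)).2
  have hc_nonneg : 0 ≤ c := limit_nonneg_of_isIsotropicCorrelation (hcorr k)
    (sub_ne_zero.2 ((hs k).ne hne)) (hρ i0 j0 hne)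
  -- The limit has compound symmetry. Here `c < 1` because an entry of `L D` is nonzero, and `c ≥ 0`
  -- by the many-point argument, so the sum is positive definite.
  have hS0c : S0 = (1 - c) • (1 : Matrix (Fin (n k)) (Fin (n k)) ℝ) +
      c • vecMulVec 1 (star (1 : Fin (n k) → ℝ)) := by
    ext i j
    by_cases hij : i = j
    · subst hij
      simp [hdiag]
    · rw [tendsto_nhds_unique (hρ i j hij) (hρ i0 j0 hne), ← hcdef]
      simp [one_apply_ne hij]
  have hpos : S0.PosDef := by
    rw [hS0c]
    exact (PosDef.one.smul (sub_pos.2 (lt_of_le_of_ne hc_le hc1))).add_posSemidef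
      ((posSemidef_vecMulVec_self_star 1).smul hc_nonneg)
  have hdet : Tendsto (fun t => (factorCorr ρ0 (s k) t).det) (𝓝[>] 0) (𝓝 S0.det) :=
    ((continuous_id.matrix_det).tendsto S0).comp hlim
  refine exists_eventually_one_le_mul hdet hpos.det_pos.ne' ?_
  filter_upwards [self_mem_nhdsWithin] with t ht
  exact (hpd k t ht).det_pos.le

/-- Bounds for a factor near the origin. -/
theorem SmallRangeExpansion.exists_factorBound_Ioc (hn : ∀ k, 2 ≤ n k)
    (hcorr : ∀ k, IsIsotropicCorrelation (p k) ρ0) (hs : ∀ k, Function.Injective (s k))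
    (hpd : ∀ k, ∀ t : ℝ, 0 < t → (factorCorr ρ0 (s k) t).PosDef)
    (hexp : SmallRangeExpansion ρ0 s X ν ω D Dstar R) (k : Fin r) :
    ∃ (δ : ℝ) (μ h : ℝ → ℝ) (K : ℝ), 0 < δ ∧ (∀ t ∈ Ioc 0 δ,
        FactorBound (factorCorr ρ0 (s k) t) (factorCorrDeriv ρ0 (s k) t) (X k) (μ t) (h t) K) ∧
      ∀ a : ℝ, 0 < a → IntegrableOn (fun t => h t * μ t ^ a) (Ioc 0 δ) := by
  obtain ⟨B, hB⟩ := hexp.exists_nu_le hn hcorr hpd k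
  obtain ⟨L, hL0, hL, δ1, hδ1, hint1, hint2⟩ := exists_limit_and_integrableOn hexp.nu_pos
    hexp.nu_diff hexp.deriv_nu_ne_zero hB
  obtain ⟨E', hE', hSE'⟩ := hexp.exists_deriv_eq k
  have hle : ∀ t : ℝ, 0 < t → ∀ i j, |factorCorr ρ0 (s k) t i j| ≤ 1 := fun t ht =>
    abs_le_one_of_posDef (hpd k t ht) (factorCorr_diag (hcorr k).1 t)
  -- For `L = 0` the factor degenerates to `11'` and `ν` is the scale; for `L > 0` it stays
  -- nonsingular, the scale is `1`, and `h` is integrable because `ν'` is.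
  rcases eq_or_lt_of_le hL0 with rfl | hLpos
  · obtain ⟨E, hE, hSE⟩ := hexp.exists_eq_rankOne_add k
    obtain ⟨K, hK, hbound⟩ := exists_eventually_factorBound (hn k)
      (eventually_mem_nhdsWithin.mono fun t ht => hpd k t ht)
      (eventually_mem_nhdsWithin.mono fun t ht => hle t ht)
      hSE hSE' hE hE' hexp.nu_pos hL (hexp.det_ne_zero k) (hexp.one_form_ne_zero k)
      (hexp.mean_form_ne_zero k) (hexp.mixed_form_ne k)
    obtain ⟨δ2, hδ2, hb⟩ := exists_Ioc_of_eventually hbound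
    refine ⟨min δ1 δ2, ν, fun t => K * (|deriv ν t| / ν t), K, lt_min hδ1 hδ2,
      fun t ht => hb t ⟨ht.1, ht.2.trans (min_le_right _ _)⟩, fun a ha => ?_⟩
    simp only [mul_assoc]
    exact Integrable.const_mul ((hint2 a ha).mono_set (Ioc_subset_Ioc_right (min_le_left δ1 δ2))) K
  · obtain ⟨K0, hK0, hdet⟩ := hexp.exists_eventually_one_le_mul_det hn hcorr hs hpd k hLpos hL
    obtain ⟨K, hK, hbound⟩ := exists_factorBound_of_det (hexp.mean_ne_zero k) K0 hK0
    obtain ⟨K', hK', hE'le⟩ := exists_eventually_matrix_le hE'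
    obtain ⟨δ2, hδ2, hb⟩ := exists_Ioc_of_eventually (hdet.and (hE'le.and hSE'))
    have hsub : ∀ t ∈ Ioc 0 (min δ1 δ2), t ∈ Ioc 0 δ2 := fun t ht =>
      ⟨ht.1, ht.2.trans (min_le_right _ _)⟩
    refine ⟨min δ1 δ2, fun _ => 1, fun t => K * ∑ i, ∑ j, |factorCorrDeriv ρ0 (s k) t i j|, K,
      lt_min hδ1 hδ2, fun t ht => hbound _ _ (hpd k t ht.1) (hle t ht.1) (hb t (hsub t ht)).1,
      fun a _ => ?_⟩
    simp only [Real.one_rpow, mul_one]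
    refine Integrable.const_mul (integrableOn_sum_abs_factorCorrDeriv measurableSet_Ioc
      (g := fun t => K' * |deriv ν t|)
      ((hint1.mono_set (Ioc_subset_Ioc_right (min_le_left δ1 δ2))).abs.const_mul K')
      fun t ht i j => ?_) K
    obtain ⟨-, h1, h2⟩ := hb t (hsub t ht)
    rw [h2, Matrix.smul_apply, smul_eq_mul, abs_mul, mul_comm]
    exact mul_le_mul_of_nonneg_right (h1 i j) (abs_nonneg _)

/-- Bounds for a factor on the whole range of the parameter. -/
theorem SmallRangeExpansion.exists_factorBound (hn : ∀ k, 2 ≤ n k)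
    (hcorr : ∀ k, IsIsotropicCorrelation (p k) ρ0) (hlim : Tendsto ρ0 atTop (𝓝 0))
    (hdiff : DifferentiableOn ℝ ρ0 (Ioi 0)) (hs : ∀ k, Function.Injective (s k))
    (hpd : ∀ k, ∀ t : ℝ, 0 < t → (factorCorr ρ0 (s k) t).PosDef)
    (hexp : SmallRangeExpansion ρ0 s X ν ω D Dstar R)
    (hint : ∀ k, ∀ δ : ℝ, 0 < δ → IntegrableOn
      (fun t => √(factorCorrDeriv ρ0 (s k) t * factorCorrDeriv ρ0 (s k) t).trace) (Ioi δ))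
    (k : Fin r) :
    ∃ (μ h : ℝ → ℝ) (K : ℝ), (∀ t : ℝ, 0 < t →
        FactorBound (factorCorr ρ0 (s k) t) (factorCorrDeriv ρ0 (s k) t) (X k) (μ t) (h t) K) ∧
      ∀ a : ℝ, 0 < a → IntegrableOn (fun t => h t * μ t ^ a) (Ioi 0) := by
  obtain ⟨δ, μ1, h1, K1, hδ, hb1, hi1⟩ := hexp.exists_factorBound_Ioc hn hcorr hs hpd k
  obtain ⟨μ2, h2, K2, hb2, hi2⟩ := exists_factorBound_Ioi (hcorr k).1 hlim hdiff (hs k) (hpd k)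
    (hexp.mean_ne_zero k) hδ (hint k δ hδ)
  refine ⟨fun t => if t ≤ δ then μ1 t else μ2 t, fun t => if t ≤ δ then h1 t else h2 t,
    max K1 K2, fun t ht => ?_, fun a ha => ?_⟩
  · dsimp only
    split_ifs with h
    · exact (hb1 t ⟨ht, h⟩).mono (hpd k t ht) (le_max_left _ _)
    · exact (hb2 t (not_le.1 h)).mono (hpd k t ht) (le_max_right _ _)
  · rw [← Ioc_union_Ioi_eq_Ioi hδ.le]
    refine IntegrableOn.union ?_ ?_
    · refine (hi1 a ha).congr_fun (fun t ht => ?_) measurableSet_Ioc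
      simp only [if_pos ht.2]
    · refine (hi2 a ha).congr_fun (fun t ht => ?_) measurableSet_Ioi
      simp only [if_neg (not_le.2 (mem_Ioi.1 ht))]

end expansion

/-! ### Bounds for the prior and the integrated likelihood -/

theorem prod_rpow_mul_prod_rpow {r : ℕ} {μ : Fin r → ℝ} (hμ : ∀ k, 0 < μ k) (α β : Fin r → ℝ) :
    (∏ k, μ k ^ α k) * ∏ k, μ k ^ β k = ∏ k, μ k ^ (α k + β k) := by
  rw [← Finset.prod_mul_distrib]
  exact Finset.prod_congr rfl fun k _ => (Real.rpow_add (hμ k) _ _).symm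

theorem prod_rpow_rpow {r : ℕ} {μ : Fin r → ℝ} (hμ : ∀ k, 0 < μ k) (α : Fin r → ℝ) (b : ℝ) :
    (∏ k, μ k ^ α k) ^ b = ∏ k, μ k ^ (α k * b) := by
  rw [← Real.finsetProd_rpow _ _ fun k _ => (Real.rpow_pos_of_pos (hμ k) _).le]
  exact Finset.prod_congr rfl fun k _ => (Real.rpow_mul (hμ k).le _ _).symm

theorem prod_rpow_pos {r : ℕ} {μ : Fin r → ℝ} (hμ : ∀ k, 0 < μ k) (α : Fin r → ℝ) :
    0 < ∏ k, μ k ^ α k :=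
  Finset.prod_pos fun k _ => Real.rpow_pos_of_pos (hμ k) _

theorem residualQ_eq_mul_one_sub_glsProj {ι : Type*} [Fintype ι] [DecidableEq ι] (X : ι → ℝ)
    (C : Matrix ι ι ℝ) : residualQ X C = C⁻¹ * (1 - glsProj X C) := rfl

section product

variable {r : ℕ} {n : Fin r → ℕ} {S S' : ∀ k, Matrix (Fin (n k)) (Fin (n k)) ℝ}
  {X : ∀ k, Fin (n k) → ℝ} {μ h : Fin r → ℝ} {K : ℝ}

theorem form_inv_piKron (hS : ∀ k, (S k).PosDef) (X : ∀ k, Fin (n k) → ℝ) :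
    kronVec X ⬝ᵥ ((piKron S)⁻¹ *ᵥ kronVec X) = ∏ k, X k ⬝ᵥ ((S k)⁻¹ *ᵥ X k) := by
  rw [piKron_inv _ fun k => posDef_isUnit_det (hS k), form_piKron]

/-- Numerator and scalar denominator both factor, so the projection is bounded entrywise by the
product of the factor bounds, with no power of `μ`. -/
theorem glsProj_piKron (hS : ∀ k, (S k).PosDef) (X : ∀ k, Fin (n k) → ℝ) :
    glsProj (kronVec X) (piKron S) = piKron fun k => glsProj (X k) (S k) := by
  simp only [glsProj]
  rw [form_inv_piKron hS, piKron_inv _ fun k => posDef_isUnit_det (hS k), ← piKron_vecMulVec,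
    piKron_mul, ← Finset.prod_inv_distrib, prod_smul_piKron]

theorem piKron_update_mul_inv (hS : ∀ k, (S k).PosDef) (k : Fin r)
    (B : Matrix (Fin (n k)) (Fin (n k)) ℝ) :
    piKron (Function.update S k B) * (piKron S)⁻¹ =
      piKron (Function.update (fun _ => 1) k (B * (S k)⁻¹)) := by
  rw [piKron_inv _ fun k => posDef_isUnit_det (hS k), piKron_mul]
  congr 1
  funext l
  by_cases hl : l = k
  · subst hl
    simp only [Function.update_self]
  · simp only [Function.update_of_ne hl]
    exact mul_nonsing_inv _ (posDef_isUnit_det (hS l))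

theorem abs_piKron_update_mul_inv_le (hS : ∀ k, (S k).PosDef)
    (H : ∀ k, FactorBound (S k) (S' k) (X k) (μ k) (h k) K) (k : Fin r) (i j : DesignIndex n) :
    |(piKron (Function.update S k (S' k)) * (piKron S)⁻¹) i j| ≤ h k := by
  rw [piKron_update_mul_inv hS, piKron_apply, Finset.abs_prod,
    ← Finset.mul_prod_erase _ _ (Finset.mem_univ k), Function.update_self]
  refine (mul_le_of_le_one_right (abs_nonneg _) (Finset.prod_le_one (fun _ _ => abs_nonneg _)
    fun l hl => ?_)).trans ((H k).deriv_le (i k) (j k))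
  rw [Function.update_of_ne (Finset.ne_of_mem_erase hl), one_apply]
  split_ifs <;> simp

theorem abs_glsProj_piKron_le (hS : ∀ k, (S k).PosDef)
    (H : ∀ k, FactorBound (S k) (S' k) (X k) (μ k) (h k) K) (i j : DesignIndex n) :
    |glsProj (kronVec X) (piKron S) i j| ≤ K ^ r := by
  rw [glsProj_piKron hS, piKron_apply, Finset.abs_prod]
  refine (Finset.prod_le_prod (fun _ _ => abs_nonneg _)
    fun k _ => (H k).proj_le (i k) (j k)).trans_eq ?_
  simp

/-- `W_k = U_k (I - P)` with `P` bounded, so the reference prior obeys the same bound as the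
independence Jeffreys prior up to a constant. -/
theorem abs_piKron_update_mul_residualQ_le (hS : ∀ k, (S k).PosDef)
    (H : ∀ k, FactorBound (S k) (S' k) (X k) (μ k) (h k) K) (k : Fin r) (i j : DesignIndex n) :
    |(piKron (Function.update S k (S' k)) * residualQ (kronVec X) (piKron S)) i j| ≤
      (1 + K ^ r * Fintype.card (DesignIndex n)) * h k := by
  set U := piKron (Function.update S k (S' k)) * (piKron S)⁻¹ with hU
  have hUle := abs_piKron_update_mul_inv_le hS H k
  have hK : 0 ≤ K := (H k).mu_pos.le.trans (H k).mu_le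
  rw [residualQ_eq_mul_one_sub_glsProj, ← Matrix.mul_assoc, ← hU, Matrix.mul_sub, Matrix.mul_one,
    Matrix.sub_apply, mul_apply]
  refine (abs_sub _ _).trans ?_
  have h1 := abs_dotProduct_le (u := U i)
    (fun l => abs_glsProj_piKron_le hS H l j)
  have h2 : ∑ l, |U i l| ≤ Fintype.card (DesignIndex n) * h k := by
    refine (Finset.sum_le_sum fun l _ => hUle i l).trans_eq ?_
    rw [Finset.sum_const, Finset.card_univ, nsmul_eq_mul]
  have h3 := h1.trans (mul_le_mul_of_nonneg_left h2 (pow_nonneg hK r))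
  have h4 := hUle i j
  rw [← hU] at h4
  rw [dotProduct] at h3
  linarith

/-- With `N_k` the product of the other sizes, `μ_k` enters the determinant to the power `(n_k - 1)
N_k = n - N_k`. -/
theorem det_piKron_rpow_le (hS : ∀ k, (S k).PosDef)
    (H : ∀ k, FactorBound (S k) (S' k) (X k) (μ k) (h k) K) (hn : ∀ k, 2 ≤ n k) :
    (piKron S).det ^ (-(1 : ℝ) / 2) ≤
      (∏ k, K ^ (∏ l ∈ Finset.univ.erase k, n l)) ^ ((1 : ℝ) / 2) *
      ∏ k, μ k ^ ((((∏ l ∈ Finset.univ.erase k, n l : ℕ) : ℝ) - (∏ l, n l : ℕ)) / 2) := by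
  set N : Fin r → ℕ := fun k => ∏ l ∈ Finset.univ.erase k, n l with hN
  have hμ : ∀ k, 0 < μ k := fun k => (H k).mu_pos
  have hK : ∀ k : Fin r, 0 < K := fun k => (hμ k).trans_le (H k).mu_le
  have h1 : ∏ k, (μ k ^ (n k - 1)) ^ N k ≤ (∏ k, K ^ N k) * (piKron S).det := by
    rw [det_piKron hS, ← Finset.prod_mul_distrib]
    refine Finset.prod_le_prod (fun k _ => by have := hμ k; positivity) fun k _ => ?_
    rw [← mul_pow]
    have := hμ k
    exact pow_le_pow_left₀ (by positivity) (H k).det_ge _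
  have hdet := (posDef_piKron hS).det_pos
  have hKpos : 0 < ∏ k, K ^ N k := Finset.prod_pos fun k _ => pow_pos (hK k) _
  have hleft : 0 < ∏ k, (μ k ^ (n k - 1)) ^ N k :=
    Finset.prod_pos fun k _ => by have := hμ k; positivity
  have h2 := Real.rpow_le_rpow_of_nonpos hleft h1 (show -(1 : ℝ) / 2 ≤ 0 by norm_num)
  rw [Real.mul_rpow hKpos.le hdet.le] at h2
  have h3 : ∏ k, (μ k ^ (n k - 1)) ^ N k = ∏ k, μ k ^ (((∏ l, n l : ℕ) : ℝ) - N k) := by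
    refine Finset.prod_congr rfl fun k _ => ?_
    rw [← pow_mul, ← Real.rpow_natCast]
    congr 1
    rw [← Finset.mul_prod_erase _ _ (Finset.mem_univ k), Nat.cast_mul, Nat.cast_mul,
      Nat.cast_sub (by have := hn k; omega)]
    simp only [hN]
    push_cast
    ring
  rw [h3, prod_rpow_rpow hμ] at h2
  have h4 : (∏ k, K ^ N k) ^ (-(1 : ℝ) / 2) = ((∏ k, K ^ N k) ^ ((1 : ℝ) / 2))⁻¹ := by
    rw [← Real.rpow_neg hKpos.le]
    congr 1
    ring
  rw [h4, inv_mul_le_iff₀ (by positivity)] at h2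
  refine h2.trans_eq ?_
  congr 1
  refine Finset.prod_congr rfl fun k _ => ?_
  congr 1
  ring

theorem form_rpow_le (hS : ∀ k, (S k).PosDef)
    (H : ∀ k, FactorBound (S k) (S' k) (X k) (μ k) (h k) K) (hX : ∀ k, X k ≠ 0) :
    (kronVec X ⬝ᵥ ((piKron S)⁻¹ *ᵥ kronVec X)) ^ (-(1 : ℝ) / 2) ≤
      (K ^ r) ^ ((1 : ℝ) / 2) * ∏ k, μ k ^ ((meanExponent (X k) : ℝ) / 2) := by
  have hμ : ∀ k, 0 < μ k := fun k => (H k).mu_pos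
  have hform : ∀ k, 0 < X k ⬝ᵥ ((S k)⁻¹ *ᵥ X k) := fun k => posDef_pos (hS k).inv (hX k)
  have hK : 0 ≤ K ^ r := by
    rcases Nat.eq_zero_or_pos r with rfl | hr
    · simp
    · exact pow_nonneg ((hμ ⟨0, hr⟩).le.trans (H ⟨0, hr⟩).mu_le) r
  rw [form_inv_piKron hS]
  have hA : 0 < ∏ k, X k ⬝ᵥ ((S k)⁻¹ *ᵥ X k) := Finset.prod_pos fun k _ => hform k
  have h1 : 1 ≤ K ^ r * ((∏ k, μ k ^ (meanExponent (X k) : ℝ)) *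
      ∏ k, X k ⬝ᵥ ((S k)⁻¹ *ᵥ X k)) := by
    have : ∏ k : Fin r, (1 : ℝ) ≤
        ∏ k, K * (μ k ^ meanExponent (X k) * (X k ⬝ᵥ ((S k)⁻¹ *ᵥ X k))) :=
      Finset.prod_le_prod (fun _ _ => zero_le_one) fun k _ => (H k).form_ge
    simpa [Finset.prod_mul_distrib] using this
  set A := ∏ k, X k ⬝ᵥ ((S k)⁻¹ *ᵥ X k) with hAdef
  have hP := prod_rpow_pos hμ fun k => (meanExponent (X k) : ℝ)
  have h2 : A⁻¹ ≤ K ^ r * ∏ k, μ k ^ (meanExponent (X k) : ℝ) := by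
    rw [inv_eq_one_div, div_le_iff₀ hA]
    linarith
  have h3 := Real.rpow_le_rpow (by positivity) h2 (show (0 : ℝ) ≤ 1 / 2 by norm_num)
  rw [Real.mul_rpow hK hP.le, prod_rpow_rpow hμ, Real.inv_rpow hA.le, ← Real.rpow_neg hA.le] at h3
  simp only [mul_one_div] at h3
  rwa [neg_div]

theorem sqrt_form_le (hS : ∀ k, (S k).PosDef)
    (H : ∀ k, FactorBound (S k) (S' k) (X k) (μ k) (h k) K) :
    √(kronVec X ⬝ᵥ ((piKron S)⁻¹ *ᵥ kronVec X)) ≤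
      √(K ^ r) * ∏ k, μ k ^ (-(meanExponent (X k) : ℝ) / 2) := by
  have hμ : ∀ k, 0 < μ k := fun k => (H k).mu_pos
  rw [form_inv_piKron hS]
  have h1 : (∏ k, μ k ^ (meanExponent (X k) : ℝ)) *
      ∏ k, X k ⬝ᵥ ((S k)⁻¹ *ᵥ X k) ≤ K ^ r := by
    have : ∏ k, μ k ^ meanExponent (X k) * (X k ⬝ᵥ ((S k)⁻¹ *ᵥ X k)) ≤ ∏ k : Fin r, K :=
      Finset.prod_le_prod (fun k _ => mul_nonneg (pow_nonneg (hμ k).le _)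
        (posDef_nonneg (hS k).inv _)) fun k _ => (H k).form_le
    simpa [Finset.prod_mul_distrib] using this
  have hP := prod_rpow_pos hμ fun k => (meanExponent (X k) : ℝ)
  rw [mul_comm, ← le_div_iff₀ hP] at h1
  refine (Real.sqrt_le_sqrt h1).trans_eq ?_
  rw [Real.sqrt_div' _ hP.le, div_eq_mul_inv, Real.sqrt_eq_rpow (∏ k, μ k ^ _),
    prod_rpow_rpow hμ, ← Finset.prod_inv_distrib]
  congr 1
  refine Finset.prod_congr rfl fun k _ => ?_
  rw [← Real.rpow_neg (hμ k).le]
  congr 1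
  ring

/-- For a product contrast `w'Σw` factors; a factor orthogonal to `1` contributes `μ_k` (`f k = 1`),
any other only a constant (`f k = 0`). -/
theorem le_residualSS_of_orthogonal (hS : ∀ k, (S k).PosDef)
    (H : ∀ k, FactorBound (S k) (S' k) (X k) (μ k) (h k) K) (hX : ∀ k, X k ≠ 0)
    {w : ∀ k, Fin (n k) → ℝ} (hw : ∀ k, w k ≠ 0) {j : Fin r} (hj : w j ⬝ᵥ X j = 0)
    {f : Fin r → ℝ} (hf : ∀ k, f k = 0 ∨ f k = 1 ∧ w k ⬝ᵥ 1 = 0) (y : DesignIndex n → ℝ) :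
    (kronVec w ⬝ᵥ y) ^ 2 / (∏ k, K * (∑ i, |w k i|) ^ 2) * ∏ k, μ k ^ (-f k) ≤
      residualSS (kronVec X) y (piKron S) := by
  have hμ : ∀ k, 0 < μ k := fun k => (H k).mu_pos
  have hwX : kronVec w ⬝ᵥ kronVec X = 0 := by
    rw [kronVec_dotProduct]
    exact Finset.prod_eq_zero (Finset.mem_univ j) hj
  refine le_trans ?_ (sq_div_le_residualSS (posDef_piKron hS) (kronVec_ne_zero hX) y _
    (kronVec_ne_zero hw) hwX)
  have hpos := posDef_pos (posDef_piKron hS) (kronVec_ne_zero hw)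
  have hle : kronVec w ⬝ᵥ (piKron S *ᵥ kronVec w) ≤
      (∏ k, K * (∑ i, |w k i|) ^ 2) * ∏ k, μ k ^ f k := by
    rw [form_piKron, ← Finset.prod_mul_distrib]
    refine Finset.prod_le_prod (fun k _ => posDef_nonneg (hS k) _) fun k _ => ?_
    rcases hf k with h0 | ⟨h1, h1'⟩
    · rw [h0, Real.rpow_zero, mul_one]
      exact (H k).quad_le (w k)
    · rw [h1, Real.rpow_one]
      refine ((H k).quad_le_of_orthogonal (w k) h1').trans_eq ?_
      ring
  have hneg : ∏ k, μ k ^ (-f k) = (∏ k, μ k ^ f k)⁻¹ := by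
    rw [← Finset.prod_inv_distrib]
    exact Finset.prod_congr rfl fun k _ => Real.rpow_neg (hμ k).le _
  rw [hneg, ← div_eq_mul_inv, div_div]
  exact div_le_div_of_nonneg_left (sq_nonneg _) hpos hle

end product

/-! ### Uniform bounds for the integrated likelihood -/

section uniform

variable {r : ℕ} {n : Fin r → ℕ} {X : ∀ k, Fin (n k) → ℝ}

/-- Product contrasts that are orthogonal to the mean vector in one factor, and to the vector of
ones in as many factors as possible. -/
theorem exists_contrasts (hn : ∀ k, 2 ≤ n k) (X : ∀ k, Fin (n k) → ℝ) :
    ∃ w : Fin r → ∀ k, Fin (n k) → ℝ, (∀ j k, w j k ≠ 0) ∧ (∀ j, w j j ⬝ᵥ X j = 0) ∧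
      (∀ j k, k ≠ j → w j k ⬝ᵥ 1 = 0) ∧ ∀ j, (X j = 1 ∨ 3 ≤ n j) → w j j ⬝ᵥ 1 = 0 := by
  choose v hv hv1 using fun k => exists_ne_zero_orthogonal
    (show 1 < n k from hn k) (fun _ => (1 : Fin (n k) → ℝ))
  have hu : ∀ j, ∃ u : Fin (n j) → ℝ, u ≠ 0 ∧ u ⬝ᵥ X j = 0 ∧
      ((X j = 1 ∨ 3 ≤ n j) → u ⬝ᵥ 1 = 0) := by
    intro j
    by_cases h3 : 3 ≤ n j
    · obtain ⟨u, hu, hu'⟩ := exists_ne_zero_orthogonal (show 2 < n j from h3) ![X j, 1]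
      exact ⟨u, hu, hu' 0, fun _ => hu' 1⟩
    · obtain ⟨u, hu, hu'⟩ := exists_ne_zero_orthogonal (show 1 < n j from hn j) fun _ => X j
      refine ⟨u, hu, hu' 0, fun h => ?_⟩
      rw [← h.resolve_right h3]
      exact hu' 0
  choose u hu huX hu1 using hu
  refine ⟨fun j => Function.update v j (u j), fun j k => ?_, fun j => ?_, fun j k hk => ?_,
    fun j hj => ?_⟩ <;> dsimp only
  · by_cases hk : k = j
    · subst hk; rw [Function.update_self]; exact hu k
    · rw [Function.update_of_ne hk]; exact hv k
  · rw [Function.update_self]; exact huX j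
  · rw [Function.update_of_ne hk]; exact hv1 k 0
  · rw [Function.update_self]; exact hu1 j hj

open Classical in
/-- The power of the small parameters with which the residual sum of squares diverges. -/
noncomputable def ssRate (X : ∀ k, Fin (n k) → ℝ) : ℝ :=
  if ∃ j, X j = 1 ∨ 3 ≤ n j then 1 else 1 - 1 / r

theorem exists_le_residualSS (hr : 0 < r) (hX : ∀ k, X k ≠ 0)
    {w : Fin r → ∀ k, Fin (n k) → ℝ} (hw : ∀ j k, w j k ≠ 0) (hwX : ∀ j, w j j ⬝ᵥ X j = 0)
    (hw1 : ∀ j k, k ≠ j → w j k ⬝ᵥ 1 = 0)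
    (hw1' : ∀ j, (X j = 1 ∨ 3 ≤ n j) → w j j ⬝ᵥ 1 = 0)
    {y : DesignIndex n → ℝ} (hy : ∀ j, kronVec (w j) ⬝ᵥ y ≠ 0) {K : ℝ} (hK : 0 < K) :
    ∃ c, 0 < c ∧ ∀ (S S' : ∀ k, Matrix (Fin (n k)) (Fin (n k)) ℝ) (μ h : Fin r → ℝ),
      (∀ k, (S k).PosDef) → (∀ k, FactorBound (S k) (S' k) (X k) (μ k) (h k) K) →
      c * ∏ k, μ k ^ (-ssRate X) ≤ residualSS (kronVec X) y (piKron S) := by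
  let c : Fin r → ℝ := fun j => (kronVec (w j) ⬝ᵥ y) ^ 2 / ∏ k, K * (∑ i, |w j k i|) ^ 2
  have hc : ∀ j, 0 < c j := by
    intro j
    have h1 : 0 < (kronVec (w j) ⬝ᵥ y) ^ 2 := by
      have := hy j
      positivity
    refine div_pos h1 (Finset.prod_pos fun k _ => mul_pos hK (pow_pos ?_ 2))
    obtain ⟨i, hi⟩ := Function.ne_iff.1 (hw j k)
    exact Finset.sum_pos' (fun i _ => abs_nonneg _) ⟨i, Finset.mem_univ i, abs_pos.2 hi⟩
  by_cases hgen : ∃ j, X j = 1 ∨ 3 ≤ n j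
  · obtain ⟨j, hj⟩ := hgen
    have hrate : ssRate X = 1 := if_pos ⟨j, hj⟩
    refine ⟨c j, hc j, fun S S' μ h hS H => ?_⟩
    rw [hrate]
    refine le_residualSS_of_orthogonal hS H hX (hw j) (hwX j) (f := fun _ => 1) (fun k => ?_) y
    refine Or.inr ⟨rfl, ?_⟩
    by_cases hk : k = j
    · subst hk; exact hw1' k hj
    · exact hw1 j k hk
  · have hrate : ssRate X = 1 - 1 / r := if_neg hgen
    have hr' : (0 : ℝ) < r := by exact_mod_cast hr
    refine ⟨∏ j, c j ^ (1 / r : ℝ), Finset.prod_pos fun j _ => Real.rpow_pos_of_pos (hc j) _,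
      fun S S' μ h hS H => ?_⟩
    have hμ : ∀ k, 0 < μ k := fun k => (H k).mu_pos
    let f : Fin r → Fin r → ℝ := fun j k => if k = j then 0 else 1
    have hle : ∀ j, c j * ∏ k, μ k ^ (-f j k) ≤ residualSS (kronVec X) y (piKron S) := by
      intro j
      refine le_residualSS_of_orthogonal hS H hX (hw j) (hwX j) (f := f j) (fun k => ?_) y
      by_cases hk : k = j
      · exact Or.inl (if_pos hk)
      · exact Or.inr ⟨if_neg hk, hw1 j k hk⟩
    have hpos : ∀ j, 0 < c j * ∏ k, μ k ^ (-f j k) := fun j =>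
      mul_pos (hc j) (prod_rpow_pos hμ _)
    have hSS : 0 < residualSS (kronVec X) y (piKron S) := (hpos ⟨0, hr⟩).trans_le (hle ⟨0, hr⟩)
    -- No contrast gains in all factors: the `j`-th one loses `μ_j`. The geometric mean of the `r`
    -- bounds spreads this loss evenly, each `μ_k` keeping `r - 1` of `r` shares.
    have h1 : ∏ j, (c j * ∏ k, μ k ^ (-f j k)) ^ (1 / r : ℝ) ≤
        ∏ _j : Fin r, residualSS (kronVec X) y (piKron S) ^ (1 / r : ℝ) :=
      Finset.prod_le_prod (fun j _ => (Real.rpow_pos_of_pos (hpos j) _).le) fun j _ =>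
        Real.rpow_le_rpow (hpos j).le (hle j) (by positivity)
    rw [Finset.prod_const, Finset.card_univ, Fintype.card_fin, ← Real.rpow_natCast,
      ← Real.rpow_mul hSS.le, one_div_mul_cancel hr'.ne', Real.rpow_one] at h1
    refine le_trans (le_of_eq ?_) h1
    simp only [Real.mul_rpow (hc _).le (prod_rpow_pos hμ _).le, prod_rpow_rpow hμ]
    rw [Finset.prod_mul_distrib]
    congr 1
    rw [Finset.prod_comm]
    refine Finset.prod_congr rfl fun k _ => ?_
    rw [← Real.rpow_sum_of_pos (hμ k), ← Finset.sum_mul, hrate]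
    congr 1
    simp only [f, Finset.sum_neg_distrib]
    have : ∑ j : Fin r, (if k = j then (0 : ℝ) else 1) = r - 1 := by
      have h2 : ∀ j : Fin r, (if k = j then (0 : ℝ) else 1) = 1 - if k = j then 1 else 0 := by
        intro j
        split_ifs <;> simp
      simp [h2]
    rw [this]
    field_simp

/-- The power of the small parameter of a factor in the integrated likelihood. -/
noncomputable def likelihoodRate (X : ∀ k, Fin (n k) → ℝ) (a : ℝ) (k : Fin r) : ℝ :=
  (((∏ l ∈ Finset.univ.erase k, n l : ℕ) : ℝ) - (∏ l, n l : ℕ)) / 2 +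
    (meanExponent (X k) : ℝ) / 2 + ssRate X * ssExponent (DesignIndex n) a

theorem exists_integratedLikelihood_le (hr : 0 < r) (hn : ∀ k, 2 ≤ n k) (hX : ∀ k, X k ≠ 0)
    {w : Fin r → ∀ k, Fin (n k) → ℝ} (hw : ∀ j k, w j k ≠ 0) (hwX : ∀ j, w j j ⬝ᵥ X j = 0)
    (hw1 : ∀ j k, k ≠ j → w j k ⬝ᵥ 1 = 0)
    (hw1' : ∀ j, (X j = 1 ∨ 3 ≤ n j) → w j j ⬝ᵥ 1 = 0)
    {y : DesignIndex n → ℝ} (hy : ∀ j, kronVec (w j) ⬝ᵥ y ≠ 0) {K : ℝ} (hK : 0 < K)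
    {a : ℝ} (ha : 0 ≤ ssExponent (DesignIndex n) a) :
    ∃ c, 0 ≤ c ∧ ∀ (S S' : ∀ k, Matrix (Fin (n k)) (Fin (n k)) ℝ) (μ h : Fin r → ℝ),
      (∀ k, (S k).PosDef) → (∀ k, FactorBound (S k) (S' k) (X k) (μ k) (h k) K) →
      0 < residualSS (kronVec X) y (piKron S) ∧
      integratedLikelihood (kronVec X) y a (piKron S) ≤ c * ∏ k, μ k ^ likelihoodRate X a k := by
  obtain ⟨c, hc, hle⟩ := exists_le_residualSS hr hX hw hwX hw1 hw1' hy hK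
  set β := ssExponent (DesignIndex n) a with hβ
  refine ⟨(∏ k, K ^ (∏ l ∈ Finset.univ.erase k, n l)) ^ ((1 : ℝ) / 2) *
    (K ^ r) ^ ((1 : ℝ) / 2) * c ^ (-β), by positivity, fun S S' μ h hS H => ?_⟩
  have hμ : ∀ k, 0 < μ k := fun k => (H k).mu_pos
  have hP := prod_rpow_pos hμ fun _ => -ssRate X
  have hSS := hle S S' μ h hS H
  refine ⟨(mul_pos hc hP).trans_le hSS, ?_⟩
  have h1 := det_piKron_rpow_le hS H hn
  have h2 := form_rpow_le hS H hX
  have h3 := Real.rpow_le_rpow_of_nonpos (mul_pos hc hP) hSS (neg_nonpos.2 ha)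
  rw [Real.mul_rpow hc.le hP.le, prod_rpow_rpow hμ] at h3
  have hA : 0 ≤ (kronVec X ⬝ᵥ ((piKron S)⁻¹ *ᵥ kronVec X)) ^ (-(1 : ℝ) / 2) :=
    Real.rpow_nonneg (posDef_nonneg (posDef_piKron hS).inv _) _
  have hS0 : 0 ≤ residualSS (kronVec X) y (piKron S) ^ (-β) :=
    Real.rpow_nonneg ((mul_pos hc hP).trans_le hSS).le _
  have hdet : 0 ≤ (piKron S).det ^ (-(1 : ℝ) / 2) :=
    Real.rpow_nonneg (posDef_piKron hS).det_pos.le _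
  rw [integratedLikelihood]
  refine (mul_le_mul (mul_le_mul h1 h2 hA (hdet.trans h1)) h3 hS0
    (mul_nonneg (hdet.trans h1) (hA.trans h2))).trans_eq ?_
  have h4 : ∏ k, μ k ^ likelihoodRate X a k =
      (∏ k, μ k ^ ((((∏ l ∈ Finset.univ.erase k, n l : ℕ) : ℝ) - (∏ l, n l : ℕ)) / 2)) *
      (∏ k, μ k ^ ((meanExponent (X k) : ℝ) / 2)) * ∏ k, μ k ^ (-ssRate X * -β) := by
    rw [prod_rpow_mul_prod_rpow hμ, prod_rpow_mul_prod_rpow hμ]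
    refine Finset.prod_congr rfl fun k _ => ?_
    rw [likelihoodRate, neg_mul_neg]
  rw [h4]
  ring

theorem two_le_prod_erase (hr : 2 ≤ r) (hn : ∀ k, 2 ≤ n k) (k : Fin r) :
    2 ≤ ∏ l ∈ Finset.univ.erase k, n l := by
  have : Nontrivial (Fin r) := Fin.nontrivial_iff_two_le.2 hr
  obtain ⟨j, hj⟩ := exists_ne k
  have hmem : j ∈ Finset.univ.erase k := Finset.mem_erase.2 ⟨hj, Finset.mem_univ j⟩
  exact (hn j).trans (Finset.single_le_prod' (fun l _ => by have := hn l; omega) hmem)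

theorem ssExponent_designIndex (a : ℝ) :
    ssExponent (DesignIndex n) a = ((∏ l, n l : ℕ) : ℝ) / 2 + a - 3 / 2 := by
  rw [ssExponent, card_designIndex]

theorem ssExponent_pos (hr : 2 ≤ r) (hn : ∀ k, 2 ≤ n k) {a : ℝ} (ha : 1 / 2 < a) :
    0 < ssExponent (DesignIndex n) a := by
  have h1 := two_le_prod_erase hr hn ⟨0, by omega⟩
  have h2 : 4 ≤ ∏ l, n l := by
    rw [← Finset.mul_prod_erase _ _ (Finset.mem_univ (⟨0, by omega⟩ : Fin r))]
    exact Nat.mul_le_mul (hn _) h1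
  have h3 : (4 : ℝ) ≤ (∏ l, n l : ℕ) := by exact_mod_cast h2
  rw [ssExponent_designIndex]
  linarith

/-- With full rate the terms in `n` cancel and `N_k/2 + a - 3/2` remains; it is positive since `N_k
≥ 2`. -/
theorem likelihoodRate_sub_pos_of_exists (hr : 2 ≤ r) (hn : ∀ k, 2 ≤ n k)
    (hgen : ∃ j, X j = 1 ∨ 3 ≤ n j) {a : ℝ} (ha : 1 / 2 < a) (k : Fin r) :
    0 < likelihoodRate X a k - (meanExponent (X k) : ℝ) / 2 := by
  have hrate : ssRate X = 1 := if_pos hgen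
  have h1 : (2 : ℝ) ≤ (∏ l ∈ Finset.univ.erase k, n l : ℕ) := by
    exact_mod_cast two_le_prod_erase hr hn k
  rw [likelihoodRate, hrate, ssExponent_designIndex]
  linarith

/-- All sizes are two, so `n = 2^r` and `N_k = 2^(r-1)`, and every mean exponent is one. -/
theorem likelihoodRate_eq_of_not_exists (hr : 2 ≤ r) (hn : ∀ k, 2 ≤ n k)
    (hgen : ¬∃ j, X j = 1 ∨ 3 ≤ n j) (a : ℝ) (k : Fin r) :
    likelihoodRate X a k = -2 ^ (r - 2) + 1 / 2 +
      (1 - 1 / r) * (2 * 2 ^ (r - 2) + a - 3 / 2) := by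
  push Not at hgen
  have hn2 : ∀ j, n j = 2 := fun j => le_antisymm (by have := (hgen j).2; omega) (hn j)
  have hrate : ssRate X = 1 - 1 / r := if_neg (by push Not; exact hgen)
  have he : meanExponent (X k) = 1 := if_neg (hgen k).1
  obtain ⟨q, rfl⟩ : ∃ q, r = q + 2 := ⟨r - 2, by omega⟩
  rw [likelihoodRate, hrate, ssExponent_designIndex, he]
  simp only [hn2, Finset.prod_const, Finset.card_univ, Fintype.card_fin,
    Finset.card_erase_of_mem (Finset.mem_univ k), Nat.add_sub_cancel]
  have : q + 2 - 1 = q + 1 := rfl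
  rw [this]
  push_cast
  ring

theorem likelihoodRate_sub_pos (hr : 2 ≤ r) (hn : ∀ k, 2 ≤ n k) {a : ℝ} (ha : 1 / 2 < a)
    (hexc : r = 2 → (∀ k, n k = 2) → (∀ k, X k ≠ 1) → 3 / 2 < a) (k : Fin r) :
    0 < likelihoodRate X a k - (meanExponent (X k) : ℝ) / 2 := by
  by_cases hgen : ∃ j, X j = 1 ∨ 3 ≤ n j
  · exact likelihoodRate_sub_pos_of_exists hr hn hgen ha k
  · rw [likelihoodRate_eq_of_not_exists hr hn hgen]
    push Not at hgen
    have he : meanExponent (X k) = 1 := if_neg (hgen k).1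
    rw [he, Nat.cast_one]
    have hr0 : (2 : ℝ) ≤ r := by exact_mod_cast hr
    have hkey : -2 ^ (r - 2) + 1 / 2 + (1 - 1 / (r : ℝ)) * (2 * 2 ^ (r - 2) + a - 3 / 2) - 1 / 2 =
        (2 ^ (r - 2) * ((r : ℝ) - 2) + ((r : ℝ) - 1) * (a - 3 / 2)) / r := by
      field_simp
      ring
    rw [hkey]
    refine div_pos ?_ (by linarith)
    obtain ⟨q, rfl⟩ : ∃ q, r = q + 2 := ⟨r - 2, by omega⟩
    rw [Nat.add_sub_cancel]
    push_cast
    -- For `r = 2` the numerator is just `a - 3/2`, the source of the exceptional condition. For `r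
    -- ≥ 3`, `a - 3/2 > -1` and `2^q q ≥ 2q ≥ q + 1` suffice.
    rcases Nat.eq_zero_or_pos q with rfl | hq
    · have := hexc rfl (fun j => le_antisymm (by have := (hgen j).2; omega) (hn j))
        fun j => (hgen j).1
      norm_num
      linarith
    · have h1 : (1 : ℝ) ≤ q := by exact_mod_cast hq
      have h2 : (2 : ℝ) ≤ 2 ^ q := by
        calc (2 : ℝ) = 2 ^ 1 := (pow_one 2).symm
          _ ≤ 2 ^ q := pow_le_pow_right₀ one_le_two hq
      nlinarith

/-- Without the Jeffreys-rule factor an additional `1/2` is available, and `a > 1/2` is enough even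
for `r = 2` in the degenerate case. -/
theorem likelihoodRate_pos (hr : 2 ≤ r) (hn : ∀ k, 2 ≤ n k) {a : ℝ} (ha : 1 / 2 < a)
    (k : Fin r) : 0 < likelihoodRate X a k := by
  by_cases hgen : ∃ j, X j = 1 ∨ 3 ≤ n j
  · have := likelihoodRate_sub_pos_of_exists hr hn hgen ha k
    have h0 : (0 : ℝ) ≤ meanExponent (X k) := Nat.cast_nonneg _
    linarith
  · rw [likelihoodRate_eq_of_not_exists hr hn hgen]
    have hr0 : (2 : ℝ) ≤ r := by exact_mod_cast hr
    have hkey : -2 ^ (r - 2) + 1 / 2 + (1 - 1 / (r : ℝ)) * (2 * 2 ^ (r - 2) + a - 3 / 2) =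
        (2 ^ (r - 2) * ((r : ℝ) - 2) + r / 2 + ((r : ℝ) - 1) * (a - 3 / 2)) / r := by
      field_simp
      ring
    rw [hkey]
    refine div_pos ?_ (by linarith)
    obtain ⟨q, rfl⟩ : ∃ q, r = q + 2 := ⟨r - 2, by omega⟩
    rw [Nat.add_sub_cancel]
    push_cast
    have h1 : (0 : ℝ) ≤ q := Nat.cast_nonneg q
    have h2 : (1 : ℝ) ≤ 2 ^ q := one_le_pow₀ one_le_two
    nlinarith

end uniform

/-! ### The marginal priors -/

section prior

variable {r : ℕ} {p n : Fin r → ℕ} {ρ0 : ℝ → ℝ}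
  {s : ∀ k, Fin (n k) → EuclideanSpace ℝ (Fin (p k))} {X : ∀ k, Fin (n k) → ℝ}

open Classical in
/-- The power of the small parameter of a factor by which a marginal prior is larger than the
independence Jeffreys prior. -/
noncomputable def priorRate (X : ∀ k, Fin (n k) → ℝ) (kind : PriorKind) (k : Fin r) : ℝ :=
  if kind = PriorKind.jeffreysRule then (meanExponent (X k) : ℝ) / 2 else 0

theorem marginalPrior_nonneg (kind : PriorKind) (ξ : Fin r → ℝ) :
    0 ≤ marginalPrior ρ0 s X kind ξ := by
  cases kind with
  | reference => exact Real.sqrt_nonneg _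
  | independenceJeffreys => exact Real.sqrt_nonneg _
  | jeffreysRule => exact mul_nonneg (Real.sqrt_nonneg _) (Real.sqrt_nonneg _)

theorem nonempty_designIndex (hn : ∀ k, 2 ≤ n k) : Nonempty (DesignIndex n) :=
  ⟨fun k => ⟨0, by have := hn k; omega⟩⟩

theorem exists_marginalPrior_le (hn : ∀ k, 2 ≤ n k) (kind : PriorKind) {K : ℝ} (hK : 0 < K) :
    ∃ c, 0 ≤ c ∧ ∀ (ξ : Fin r → ℝ) (μ h : Fin r → ℝ),
      (∀ k, (factorCorr ρ0 (s k) (ξ k)).PosDef) →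
      (∀ k, FactorBound (factorCorr ρ0 (s k) (ξ k)) (factorCorrDeriv ρ0 (s k) (ξ k)) (X k)
        (μ k) (h k) K) →
      marginalPrior ρ0 s X kind ξ ≤ c * ((∏ k, h k) * ∏ k, μ k ^ (-priorRate X kind k)) := by
  have hne := nonempty_designIndex hn
  obtain ⟨c1, hc1, hJ1⟩ : ∃ c, 0 ≤ c ∧ ∀ (ξ : Fin r → ℝ) (μ h : Fin r → ℝ),
      (∀ k, (factorCorr ρ0 (s k) (ξ k)).PosDef) →
      (∀ k, FactorBound (factorCorr ρ0 (s k) (ξ k)) (factorCorrDeriv ρ0 (s k) (ξ k)) (X k)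
        (μ k) (h k) K) → indepJeffreysPrior ρ0 s ξ ≤ c * ∏ k, h k := by
    refine ⟨√((Fintype.card (Option (Fin r))).factorial *
      ((Fintype.card (DesignIndex n) : ℝ) ^ 2) ^ Fintype.card (Option (Fin r))),
      Real.sqrt_nonneg _, fun ξ μ h hS H => ?_⟩
    refine sqrt_det_infoMatrix_le (Nat.cast_nonneg _) le_rfl (fun k => (H k).h_nonneg)
      fun k i j => ?_
    rw [corrMatrixDeriv_eq_piKron, corrMatrix_eq_piKron]
    exact abs_piKron_update_mul_inv_le (S' := fun k => factorCorrDeriv ρ0 (s k) (ξ k)) hS H k i j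
  cases kind with
  | independenceJeffreys =>
    refine ⟨c1, hc1, fun ξ μ h hS H => ?_⟩
    simpa [priorRate, marginalPrior] using hJ1 ξ μ h hS H
  | jeffreysRule =>
    refine ⟨√(K ^ r) * c1, mul_nonneg (Real.sqrt_nonneg _) hc1, fun ξ μ h hS H => ?_⟩
    have h1 := hJ1 ξ μ h hS H
    have h2 := sqrt_form_le hS H
    refine (mul_le_mul h2 h1 (Real.sqrt_nonneg _) ((Real.sqrt_nonneg _).trans h2)).trans_eq ?_
    simp only [priorRate, if_true, neg_div]
    ring
  | reference =>
    refine ⟨√((Fintype.card (Option (Fin r))).factorial *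
      ((Fintype.card (DesignIndex n) : ℝ) ^ 2) ^ Fintype.card (Option (Fin r))) *
      (1 + K ^ r * Fintype.card (DesignIndex n)) ^ r, by positivity, fun ξ μ h hS H => ?_⟩
    have hcard : (1 : ℝ) ≤ Fintype.card (DesignIndex n) := by
      exact_mod_cast Fintype.card_pos
    refine (sqrt_det_infoMatrix_le (by linarith) (by linarith)
      (h := fun k => (1 + K ^ r * Fintype.card (DesignIndex n)) * h k)
      (fun k => mul_nonneg (by positivity) (H k).h_nonneg) fun k i j => ?_).trans_eq ?_
    · rw [corrMatrixDeriv_eq_piKron, corrMatrix_eq_piKron]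
      exact abs_piKron_update_mul_residualQ_le
        (S' := fun k => factorCorrDeriv ρ0 (s k) (ξ k)) hS H k i j
    · simp [priorRate, Finset.prod_mul_distrib, mul_assoc]

theorem corrMatrixDeriv_transpose (k : Fin r) (ξ : Fin r → ℝ) :
    (corrMatrixDeriv ρ0 s k ξ)ᵀ = corrMatrixDeriv ρ0 s k ξ := by
  rw [corrMatrixDeriv_eq_piKron, piKron_transpose]
  congr 1
  funext l
  by_cases hl : l = k
  · subst hl
    simp only [Function.update_self, factorCorrDeriv_transpose]
  · simp only [Function.update_of_ne hl]
    exact factorCorr_transpose _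

/-- Positive definiteness of the information matrix, with the covariate vector `X` for the reference
prior and with `0` for the Jeffreys priors. -/
theorem marginalPrior_pos (hr : 2 ≤ r) (hn : ∀ k, 2 ≤ n k) (hX : ∀ k, X k ≠ 0)
    {ξ : Fin r → ℝ} (hS : ∀ k, (factorCorr ρ0 (s k) (ξ k)).PosDef)
    (hne : ∀ k, factorCorrDeriv ρ0 (s k) (ξ k) ≠ 0) (kind : PriorKind) :
    0 < marginalPrior ρ0 s X kind ξ := by
  have hC : (corrMatrix ρ0 s ξ).PosDef := posDef_piKron hS
  have hnd : ∀ (c0 : ℝ) (c : Fin r → ℝ), (∀ v, v ⬝ᵥ kronVec X = 0 →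
      v ⬝ᵥ ((c0 • corrMatrix ρ0 s ξ + ∑ k, c k • corrMatrixDeriv ρ0 s k ξ) *ᵥ v) = 0) →
      c0 = 0 ∧ ∀ k, c k = 0 := by
    intro c0 c h
    simp only [corrMatrixDeriv_eq_piKron, corrMatrix_eq_piKron] at h
    exact coeff_eq_zero_of_form_eq_zero hr hn hS (fun k => factorCorrDeriv_transpose (ξ k))
      (fun k i => factorCorrDeriv_diag (ξ k) i) hne X c0 c h
  have hJ1 : 0 < indepJeffreysPrior ρ0 s ξ := by
    have h := posDef_infoMatrix hC 0 (fun k => corrMatrixDeriv_transpose k ξ)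
      fun c0 c h => hnd c0 c fun v _ => h v (dotProduct_zero v)
    rw [trace_mul_residualQ_zero hC, residualQ_zero] at h
    exact Real.sqrt_pos.2 h.det_pos
  cases kind with
  | reference =>
    have h := posDef_infoMatrix hC (kronVec X) (fun k => corrMatrixDeriv_transpose k ξ) hnd
    rw [trace_mul_residualQ_of_ne_zero hC (kronVec_ne_zero hX)] at h
    exact Real.sqrt_pos.2 h.det_pos
  | independenceJeffreys => exact hJ1
  | jeffreysRule =>
    exact mul_pos (Real.sqrt_pos.2 (posDef_pos hC.inv (kronVec_ne_zero hX))) hJ1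

end prior

/-! ### Measurability -/

section measurability

variable {r : ℕ} {p n : Fin r → ℕ} {ρ0 : ℝ → ℝ}
  {s : ∀ k, Fin (n k) → EuclideanSpace ℝ (Fin (p k))} {X : ∀ k, Fin (n k) → ℝ}

theorem setOf_forall_pos_eq_pi :
    {ξ : Fin r → ℝ | ∀ k, 0 < ξ k} = Set.pi univ fun _ => Ioi (0 : ℝ) := by
  ext ξ
  simp

theorem measurableSet_orthant : MeasurableSet {ξ : Fin r → ℝ | ∀ k, 0 < ξ k} := by
  rw [setOf_forall_pos_eq_pi]
  exact MeasurableSet.univ_pi fun _ => measurableSet_Ioi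

theorem continuousOn_factorCorr_apply (hdiff : DifferentiableOn ℝ ρ0 (Ioi 0)) (k : Fin r)
    (i j : Fin (n k)) :
    ContinuousOn (fun ξ : Fin r → ℝ => factorCorr ρ0 (s k) (ξ k) i j) {ξ | ∀ k, 0 < ξ k} :=
  (continuousOn_pi.1 (continuousOn_pi.1 (continuousOn_factorCorr (x := s k) hdiff) i) j).comp
    (continuous_apply k).continuousOn fun _ hξ => hξ k

theorem continuousOn_corrMatrix (hdiff : DifferentiableOn ℝ ρ0 (Ioi 0)) :
    ContinuousOn (corrMatrix ρ0 s) {ξ | ∀ k, 0 < ξ k} := by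
  refine continuousOn_pi.2 fun i => continuousOn_pi.2 fun j => ?_
  have h : ContinuousOn (fun ξ : Fin r → ℝ => ∏ k, factorCorr ρ0 (s k) (ξ k) (i k) (j k))
      {ξ | ∀ k, 0 < ξ k} :=
    continuousOn_finsetProd _ fun k _ => continuousOn_factorCorr_apply hdiff k (i k) (j k)
  exact h

theorem continuousOn_inv_corrMatrix (hdiff : DifferentiableOn ℝ ρ0 (Ioi 0))
    (hpd : ∀ k, ∀ t : ℝ, 0 < t → (factorCorr ρ0 (s k) t).PosDef) :
    ContinuousOn (fun ξ => (corrMatrix ρ0 s ξ)⁻¹) {ξ | ∀ k, 0 < ξ k} := by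
  intro ξ hξ
  have hC : (corrMatrix ρ0 s ξ).PosDef := posDef_piKron fun k => hpd k _ (hξ k)
  refine (continuousAt_matrix_inv _ ?_).comp_continuousWithinAt (continuousOn_corrMatrix hdiff ξ hξ)
  rw [Ring.inverse_eq_inv']
  exact continuousAt_inv₀ hC.det_pos.ne'

theorem continuousOn_form_inv (hdiff : DifferentiableOn ℝ ρ0 (Ioi 0))
    (hpd : ∀ k, ∀ t : ℝ, 0 < t → (factorCorr ρ0 (s k) t).PosDef) (u v : DesignIndex n → ℝ) :
    ContinuousOn (fun ξ => u ⬝ᵥ ((corrMatrix ρ0 s ξ)⁻¹ *ᵥ v)) {ξ | ∀ k, 0 < ξ k} := by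
  have hc : Continuous fun M : Matrix (DesignIndex n) (DesignIndex n) ℝ => u ⬝ᵥ (M *ᵥ v) :=
    Continuous.dotProduct continuous_const (continuous_id.matrix_mulVec continuous_const)
  exact hc.comp_continuousOn (continuousOn_inv_corrMatrix hdiff hpd)

theorem continuousOn_integratedLikelihood (hdiff : DifferentiableOn ℝ ρ0 (Ioi 0))
    (hpd : ∀ k, ∀ t : ℝ, 0 < t → (factorCorr ρ0 (s k) t).PosDef) {x y : DesignIndex n → ℝ}
    (hx : x ≠ 0) (hy : ∀ ξ : Fin r → ℝ, (∀ k, 0 < ξ k) → 0 < residualSS x y (corrMatrix ρ0 s ξ))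
    (a : ℝ) :
    ContinuousOn (fun ξ => integratedLikelihood x y a (corrMatrix ρ0 s ξ))
      {ξ | ∀ k, 0 < ξ k} := by
  have hC : ∀ ξ : Fin r → ℝ, (∀ k, 0 < ξ k) → (corrMatrix ρ0 s ξ).PosDef := fun ξ hξ =>
    posDef_piKron fun k => hpd k _ (hξ k)
  have hA : ∀ ξ : Fin r → ℝ, (∀ k, 0 < ξ k) → x ⬝ᵥ ((corrMatrix ρ0 s ξ)⁻¹ *ᵥ x) ≠ 0 :=
    fun ξ hξ => (posDef_pos (hC ξ hξ).inv hx).ne'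
  have hdet : Continuous fun M : Matrix (DesignIndex n) (DesignIndex n) ℝ => M.det :=
    continuous_id.matrix_det
  refine ((ContinuousOn.rpow_const (hdet.comp_continuousOn (continuousOn_corrMatrix hdiff))
    fun ξ hξ => Or.inl (hC ξ hξ).det_pos.ne').mul
    ((continuousOn_form_inv hdiff hpd x x).rpow_const fun ξ hξ => Or.inl (hA ξ hξ))).mul
    (ContinuousOn.rpow_const ?_ fun ξ hξ => Or.inl (hy ξ hξ).ne')
  exact (continuousOn_form_inv hdiff hpd y y).sub
    (((continuousOn_form_inv hdiff hpd x y).pow 2).div (continuousOn_form_inv hdiff hpd x x) hA)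

theorem aemeasurable_mul_apply {α ι : Type*} [Fintype ι] [MeasurableSpace α] {m : Measure α}
    {M N : α → Matrix ι ι ℝ} (hM : ∀ i j, AEMeasurable (fun t => M t i j) m)
    (hN : ∀ i j, AEMeasurable (fun t => N t i j) m) (i j : ι) :
    AEMeasurable (fun t => (M t * N t) i j) m := by
  simp only [mul_apply]
  exact Finset.aemeasurable_fun_sum _ fun l _ => (hM i l).mul (hN l j)

theorem aemeasurable_det_infoMatrix {α ι : Type*} [Fintype ι] [MeasurableSpace α] {m : Measure α}
    (c : ℝ) {W : α → Fin r → Matrix ι ι ℝ}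
    (hW : ∀ k i j, AEMeasurable (fun t => W t k i j) m) :
    AEMeasurable (fun t => (infoMatrix c (W t)).det) m := by
  have htr : ∀ k, AEMeasurable (fun t => (W t k).trace) m := fun k =>
    Finset.aemeasurable_fun_sum _ fun i _ => hW k i i
  have hentry : ∀ a b, AEMeasurable (fun t => infoMatrix c (W t) a b) m := by
    intro a b
    cases a with
    | none =>
      cases b with
      | none => exact aemeasurable_const
      | some j => exact htr j
    | some i =>
      cases b with
      | none => exact htr i
      | some j =>
        exact Finset.aemeasurable_fun_sum _ fun l _ => aemeasurable_mul_apply (hW i) (hW j) l l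
  simp only [det_apply]
  refine Finset.aemeasurable_fun_sum _ fun σ _ => ?_
  simp only [Units.smul_def, zsmul_eq_mul]
  exact (Finset.aemeasurable_fun_prod _ fun a _ => hentry (σ a) a).const_mul _

/-- Needed only to pass from a vanishing integral to an integrand vanishing almost everywhere.
Measurability of `deriv` replaces any continuity of the derivative of `ρ0`. -/
theorem aemeasurable_marginalPrior (hdiff : DifferentiableOn ℝ ρ0 (Ioi 0))
    (hpd : ∀ k, ∀ t : ℝ, 0 < t → (factorCorr ρ0 (s k) t).PosDef) (kind : PriorKind) :
    AEMeasurable (marginalPrior ρ0 s X kind) (volume.restrict {ξ | ∀ k, 0 < ξ k}) := by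
  have hO := measurableSet_orthant (r := r)
  have hS : ∀ k i j, AEMeasurable (fun ξ : Fin r → ℝ => factorCorr ρ0 (s k) (ξ k) i j)
      (volume.restrict {ξ | ∀ k, 0 < ξ k}) := fun k i j =>
    (continuousOn_factorCorr_apply hdiff k i j).aemeasurable hO
  have hder : ∀ k i j, AEMeasurable (fun ξ => corrMatrixDeriv ρ0 s k ξ i j)
      (volume.restrict {ξ | ∀ k, 0 < ξ k}) := by
    intro k i j
    simp only [corrMatrixDeriv_eq_piKron, piKron_apply]
    refine Finset.aemeasurable_fun_prod _ fun l _ => ?_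
    by_cases hl : l = k
    · subst hl
      simp only [Function.update_self]
      exact ((measurable_factorCorrDeriv (i l) (j l)).comp (measurable_pi_apply l)).aemeasurable
    · simp only [Function.update_of_ne hl]
      exact hS l (i l) (j l)
  have hform : ∀ u v : DesignIndex n → ℝ, AEMeasurable
      (fun ξ => u ⬝ᵥ ((corrMatrix ρ0 s ξ)⁻¹ *ᵥ v)) (volume.restrict {ξ | ∀ k, 0 < ξ k}) :=
    fun u v => (continuousOn_form_inv hdiff hpd u v).aemeasurable hO
  have hinv : ∀ i j, AEMeasurable (fun ξ => (corrMatrix ρ0 s ξ)⁻¹ i j)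
      (volume.restrict {ξ | ∀ k, 0 < ξ k}) := fun i j =>
    (continuousOn_pi.1 (continuousOn_pi.1
      (continuousOn_inv_corrMatrix hdiff hpd) i) j).aemeasurable hO
  have hJ1 : AEMeasurable (indepJeffreysPrior ρ0 s) (volume.restrict {ξ | ∀ k, 0 < ξ k}) :=
    (aemeasurable_det_infoMatrix _ fun k => aemeasurable_mul_apply (hder k) hinv).sqrt
  cases kind with
  | independenceJeffreys => exact hJ1
  | jeffreysRule => exact (hform _ _).sqrt.mul hJ1
  | reference =>
    have hP : ∀ i j, AEMeasurable (fun ξ => (1 - (kronVec X ⬝ᵥ ((corrMatrix ρ0 s ξ)⁻¹ *ᵥ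
        kronVec X))⁻¹ • (vecMulVec (kronVec X) (kronVec X) * (corrMatrix ρ0 s ξ)⁻¹) :
          Matrix (DesignIndex n) (DesignIndex n) ℝ) i j)
        (volume.restrict {ξ | ∀ k, 0 < ξ k}) := by
      intro i j
      simp only [Matrix.sub_apply, Matrix.smul_apply, smul_eq_mul]
      exact aemeasurable_const.sub ((hform (kronVec X) (kronVec X)).inv.mul
        (aemeasurable_mul_apply (M := fun _ => vecMulVec (kronVec X) (kronVec X))
          (fun _ _ => aemeasurable_const) hinv i j))
    have hQ : ∀ i j, AEMeasurable (fun ξ => residualQ (kronVec X) (corrMatrix ρ0 s ξ) i j)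
        (volume.restrict {ξ | ∀ k, 0 < ξ k}) := by
      simp only [residualQ]
      exact aemeasurable_mul_apply hinv hP
    exact (aemeasurable_det_infoMatrix ((Fintype.card (DesignIndex n) : ℝ) - 1)
      (W := fun ξ k => corrMatrixDeriv ρ0 s k ξ * residualQ (kronVec X) (corrMatrix ρ0 s ξ))
      fun k => aemeasurable_mul_apply (hder k) hQ).sqrt

end measurability

/-! ### The total mass of the posterior -/

section posterior

variable {r : ℕ} {p n : Fin r → ℕ} {ρ0 : ℝ → ℝ}
  {s : ∀ k, Fin (n k) → EuclideanSpace ℝ (Fin (p k))} {X : ∀ k, Fin (n k) → ℝ}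

/-- The constant factor of the integrated likelihood. -/
noncomputable def likelihoodConst (β : ℝ) : ℝ :=
  √(2 * Real.pi) * 2 ^ β * Real.Gamma β

theorem posteriorMass_eq (hpd : ∀ k, ∀ t : ℝ, 0 < t → (factorCorr ρ0 (s k) t).PosDef)
    (hX : ∀ k, X k ≠ 0) {y : DesignIndex n → ℝ} (hy : ∀ ξ : Fin r → ℝ, (∀ k, 0 < ξ k) →
      0 < residualSS (kronVec X) y (corrMatrix ρ0 s ξ)) {a : ℝ}
    (hβ : 0 < ssExponent (DesignIndex n) a) (kind : PriorKind) :
    posteriorMass ρ0 s X (marginalPrior ρ0 s X kind) a y =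
      ∫⁻ ξ in {ξ : Fin r → ℝ | ∀ k, 0 < ξ k},
        ENNReal.ofReal (likelihoodConst (ssExponent (DesignIndex n) a) *
          (integratedLikelihood (kronVec X) y a (corrMatrix ρ0 s ξ) *
            marginalPrior ρ0 s X kind ξ)) :=
  setLIntegral_congr_fun measurableSet_orthant fun ξ hξ =>
    lintegral_likelihood (posDef_piKron fun k => hpd k _ (hξ k)) (kronVec_ne_zero hX) (hy ξ hξ) hβ
      (marginalPrior_nonneg kind ξ)

theorem likelihoodConst_pos {β : ℝ} (hβ : 0 < β) : 0 < likelihoodConst β := by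
  have := Real.Gamma_pos_of_pos hβ
  rw [likelihoodConst]
  positivity

theorem integratedLikelihood_pos {ι : Type*} [Fintype ι] [DecidableEq ι] {C : Matrix ι ι ℝ}
    (hC : C.PosDef) {x y : ι → ℝ} (hx : x ≠ 0) (hy : 0 < residualSS x y C) (a : ℝ) :
    0 < integratedLikelihood x y a C := by
  have h1 := hC.det_pos
  have h2 := posDef_pos hC.inv hx
  rw [integratedLikelihood]
  positivity

theorem posteriorMass_pos (hr : 2 ≤ r) (hn : ∀ k, 2 ≤ n k)
    (hdiff : DifferentiableOn ℝ ρ0 (Ioi 0))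
    (hpd : ∀ k, ∀ t : ℝ, 0 < t → (factorCorr ρ0 (s k) t).PosDef) (hX : ∀ k, X k ≠ 0)
    (hder : ∀ k, ∀ᶠ t in 𝓝[>] (0 : ℝ), factorCorrDeriv ρ0 (s k) t ≠ 0)
    {y : DesignIndex n → ℝ} (hy : ∀ ξ : Fin r → ℝ, (∀ k, 0 < ξ k) →
      0 < residualSS (kronVec X) y (corrMatrix ρ0 s ξ)) {a : ℝ}
    (hβ : 0 < ssExponent (DesignIndex n) a) (kind : PriorKind) :
    0 < posteriorMass ρ0 s X (marginalPrior ρ0 s X kind) a y := by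
  rw [posteriorMass_eq hpd hX hy hβ kind]
  refine pos_iff_ne_zero.2 fun h0 => ?_
  have hmeas : AEMeasurable (fun ξ : Fin r → ℝ =>
      ENNReal.ofReal (likelihoodConst (ssExponent (DesignIndex n) a) *
        (integratedLikelihood (kronVec X) y a (corrMatrix ρ0 s ξ) *
          marginalPrior ρ0 s X kind ξ))) (volume.restrict {ξ | ∀ k, 0 < ξ k}) :=
    ((((continuousOn_integratedLikelihood hdiff hpd (kronVec_ne_zero hX) hy a).aemeasurable
      measurableSet_orthant).mul (aemeasurable_marginalPrior hdiff hpd kind)).const_mul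
        _).ennreal_ofReal
  rw [lintegral_eq_zero_iff' hmeas] at h0
  have h1 := (ae_restrict_iff' measurableSet_orthant).1 h0
  obtain ⟨δ, hδ, hδ'⟩ := exists_Ioc_of_eventually (eventually_all.2 hder)
  -- A zero mass would make the integrand vanish almost everywhere, yet it is positive on this cube.
  have h2 : volume (Set.pi univ fun _ : Fin r => Ioc 0 δ) = 0 := by
    refine measure_mono_null (fun ξ hξ => ?_) h1
    have hξ' : ∀ k, ξ k ∈ Ioc 0 δ := fun k => hξ k (mem_univ k)
    have hpos : ∀ k, 0 < ξ k := fun k => (hξ' k).1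
    have hS : ∀ k, (factorCorr ρ0 (s k) (ξ k)).PosDef := fun k => hpd k _ (hpos k)
    intro hcon
    have h3 := hcon hpos
    simp only [Pi.zero_apply, ENNReal.ofReal_eq_zero] at h3
    refine absurd h3 (not_le.2 (mul_pos (likelihoodConst_pos hβ) (mul_pos
      (integratedLikelihood_pos (posDef_piKron hS) (kronVec_ne_zero hX) (hy ξ hpos) a)
      (marginalPrior_pos hr hn hX hS (fun k => hδ' _ (hξ' k) k) kind))))
  rw [volume_pi_pi] at h2
  obtain ⟨k, -, hk⟩ := Finset.prod_eq_zero_iff.1 h2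
  rw [Real.volume_Ioc, ENNReal.ofReal_eq_zero] at hk
  linarith

/-- The integrand is dominated by a constant times `∏ h_k μ_k^{b_k}` with all `b_k > 0`, a product
of integrable functions of one variable each. -/
theorem posteriorMass_lt_top (hn : ∀ k, 2 ≤ n k)
    (hpd : ∀ k, ∀ t : ℝ, 0 < t → (factorCorr ρ0 (s k) t).PosDef) (hX : ∀ k, X k ≠ 0)
    {μ h : Fin r → ℝ → ℝ} {K : ℝ} (hK : 0 < K) (H : ∀ k, ∀ t : ℝ, 0 < t → FactorBound
      (factorCorr ρ0 (s k) t) (factorCorrDeriv ρ0 (s k) t) (X k) (μ k t) (h k t) K)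
    (hint : ∀ k, ∀ b : ℝ, 0 < b → IntegrableOn (fun t => h k t * μ k t ^ b) (Ioi 0))
    {y : DesignIndex n → ℝ} (hy : ∀ ξ : Fin r → ℝ, (∀ k, 0 < ξ k) →
      0 < residualSS (kronVec X) y (corrMatrix ρ0 s ξ)) {a : ℝ}
    (hβ : 0 < ssExponent (DesignIndex n) a) {kind : PriorKind}
    (hrate : ∀ k, 0 < likelihoodRate X a k - priorRate X kind k) {c : ℝ}
    (hIL : ∀ ξ : Fin r → ℝ, (∀ k, 0 < ξ k) →
      integratedLikelihood (kronVec X) y a (corrMatrix ρ0 s ξ) ≤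
        c * ∏ k, μ k (ξ k) ^ likelihoodRate X a k) :
    posteriorMass ρ0 s X (marginalPrior ρ0 s X kind) a y < ⊤ := by
  obtain ⟨c', hc', hprior⟩ := exists_marginalPrior_le (ρ0 := ρ0) (s := s) (X := X) hn kind hK
  set c0 := likelihoodConst (ssExponent (DesignIndex n) a) with hc0
  have hc0pos : 0 < c0 := likelihoodConst_pos hβ
  have hI : IntegrableOn (fun ξ : Fin r → ℝ => ∏ k, (h k (ξ k) *
      μ k (ξ k) ^ (likelihoodRate X a k - priorRate X kind k))) {ξ | ∀ k, 0 < ξ k} := by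
    rw [setOf_forall_pos_eq_pi, IntegrableOn, volume_pi, Measure.restrict_pi_pi]
    exact Integrable.fintype_prod (f := fun k t => h k t *
      μ k t ^ (likelihoodRate X a k - priorRate X kind k)) fun k => hint k _ (hrate k)
  rw [posteriorMass_eq hpd hX hy hβ kind]
  refine lt_of_le_of_lt ?_ (hI.const_mul (c0 * (c * c'))).lintegral_lt_top
  refine setLIntegral_mono' measurableSet_orthant fun ξ hξ => ENNReal.ofReal_le_ofReal ?_
  have hS : ∀ k, (factorCorr ρ0 (s k) (ξ k)).PosDef := fun k => hpd k _ (hξ k)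
  have hμ : ∀ k, 0 < μ k (ξ k) := fun k => (H k _ (hξ k)).mu_pos
  have h1 := hIL ξ hξ
  have h2 := hprior ξ (fun k => μ k (ξ k)) (fun k => h k (ξ k)) hS fun k => H k _ (hξ k)
  have h3 := (integratedLikelihood_pos (posDef_piKron hS) (kronVec_ne_zero hX) (hy ξ hξ) a).le
  have h4 := mul_le_mul h1 h2 (marginalPrior_nonneg kind ξ) (h3.trans h1)
  rw [mul_assoc c0]
  refine mul_le_mul_of_nonneg_left (h4.trans_eq ?_) hc0pos.le
  simp only [sub_eq_add_neg]
  rw [Finset.prod_mul_distrib, ← prod_rpow_mul_prod_rpow hμ]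
  ring

theorem ae_dotProduct_ne_zero {ι : Type*} [Fintype ι] {w : ι → ℝ} (hw : w ≠ 0) :
    ∀ᵐ y : ι → ℝ, w ⬝ᵥ y ≠ 0 := by
  let f : (ι → ℝ) →ₗ[ℝ] ℝ := dotProductBilin ℝ ℝ w
  have hf : LinearMap.ker f ≠ ⊤ := by
    intro h
    have h1 : w ∈ LinearMap.ker f := h ▸ Submodule.mem_top
    exact hw (dotProduct_self_eq_zero.1 h1)
  have h0 := Measure.addHaar_submodule (volume : Measure (ι → ℝ)) _ hf
  rw [ae_iff]
  refine measure_mono_null (fun y hy => ?_) h0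
  exact not_not.1 hy

end posterior

end GPPropriety

theorem theorem3p6
    {r : ℕ} (hr : 2 ≤ r) {p n : Fin r → ℕ} (hn : ∀ k, 2 ≤ n k)
    (ρ0 : ℝ → ℝ)
    (hcorr : ∀ k, GPPropriety.IsIsotropicCorrelation (p k) ρ0)
    (hlim : Filter.Tendsto ρ0 Filter.atTop (nhds 0))
    (hdiff : DifferentiableOn ℝ ρ0 (Set.Ioi 0))
    (s : ∀ k, Fin (n k) → EuclideanSpace ℝ (Fin (p k)))
    (hs : ∀ k, Function.Injective (s k))
    (hpd : ∀ k, ∀ t : ℝ, 0 < t → (GPPropriety.factorCorr ρ0 (s k) t).PosDef)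
    (X : ∀ k, Fin (n k) → ℝ)
    (ν ω : ℝ → ℝ) (D Dstar : ∀ k, Matrix (Fin (n k)) (Fin (n k)) ℝ)
    (R : ∀ k, ℝ → Matrix (Fin (n k)) (Fin (n k)) ℝ)
    (hexp : GPPropriety.SmallRangeExpansion ρ0 s X ν ω D Dstar R)
    (hint : ∀ k, ∀ δ : ℝ, 0 < δ → MeasureTheory.IntegrableOn
      (fun t => Real.sqrt (GPPropriety.factorCorrDeriv ρ0 (s k) t *
        GPPropriety.factorCorrDeriv ρ0 (s k) t).trace) (Set.Ioi δ)) :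
    ∀ᵐ y : GPPropriety.DesignIndex n → ℝ, ∀ (kind : GPPropriety.PriorKind) (a : ℝ),
      1 / 2 < a →
      (kind = GPPropriety.PriorKind.jeffreysRule → r = 2 → (∀ k, n k = 2) → (∀ k, X k ≠ 1) →
        3 / 2 < a) →
      GPPropriety.ProperPosterior ρ0 s X (GPPropriety.marginalPrior ρ0 s X kind) a y := by
  have hX := hexp.mean_ne_zero
  choose μ h K' H' hI using fun k =>
    hexp.exists_factorBound hn hcorr hlim hdiff hs hpd hint k
  have hK' : ∀ k, 0 < K' k := fun k =>
    (H' k 1 one_pos).mu_pos.trans_le (H' k 1 one_pos).mu_le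
  -- The sum of the factor constants serves as one constant for all factors.
  have hK'le : ∀ k, K' k ≤ ∑ l, K' l := fun k =>
    Finset.single_le_sum (fun l _ => (hK' l).le) (Finset.mem_univ k)
  have H := fun k t ht => (H' k t ht).mono (hpd k t ht) (hK'le k)
  have hK : 0 < ∑ l, K' l := (hK' ⟨0, by omega⟩).trans_le (hK'le _)
  -- The contrasts depend only on the sizes and on `X`, so one null set of `y` serves every prior
  -- and every `a`.
  obtain ⟨w, hw, hwX, hw1, hw1'⟩ := GPPropriety.exists_contrasts hn X
  have hae : ∀ᵐ y : GPPropriety.DesignIndex n → ℝ, ∀ j, GPPropriety.kronVec (w j) ⬝ᵥ y ≠ 0 :=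
    ae_all_iff.2 fun j =>
      GPPropriety.ae_dotProduct_ne_zero (GPPropriety.kronVec_ne_zero (hw j))
  filter_upwards [hae] with y hy kind a ha hexc
  have hβ := GPPropriety.ssExponent_pos hr hn ha
  obtain ⟨c, -, hIL⟩ := GPPropriety.exists_integratedLikelihood_le (by omega) hn hX hw hwX hw1
    hw1' hy hK hβ.le
  have hIL' := fun (ξ : Fin r → ℝ) (hξ : ∀ k, 0 < ξ k) =>
    hIL _ _ _ _ (fun k => hpd k (ξ k) (hξ k)) fun k => H k (ξ k) (hξ k)
  have hrate : ∀ k, 0 < GPPropriety.likelihoodRate X a k - GPPropriety.priorRate X kind k := by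
    intro k
    by_cases hkind : kind = GPPropriety.PriorKind.jeffreysRule
    · rw [GPPropriety.priorRate, if_pos hkind]
      exact GPPropriety.likelihoodRate_sub_pos hr hn ha (hexc hkind) k
    · rw [GPPropriety.priorRate, if_neg hkind, sub_zero]
      exact GPPropriety.likelihoodRate_pos hr hn ha k
  exact ⟨GPPropriety.posteriorMass_pos hr hn hdiff hpd hX
      (fun k => hexp.eventually_deriv_ne_zero hn k) (fun ξ hξ => (hIL' ξ hξ).1) hβ kind,
    GPPropriety.posteriorMass_lt_top hn hpd hX hK H hI (fun ξ hξ => (hIL' ξ hξ).1) hβ hrate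
      fun ξ hξ => (hIL' ξ hξ).2⟩
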